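/- Let $\kappa$ be an infinite regular cardinal. A category is *$\kappa$-lex* if it has limits of all diagrams of size $<\kappa$, and a functor is *$\kappa$-lex* if it preserves them. A *family* on an object $X$ is a set of arrows with codomain $X$; it is *extremal epimorphic* if it does not factor through a proper subobject of $X$. A family on $Y$ is a *pullback* along $g:Y\to X$ of a family on $X$ if it is obtained by pulling back each of the arrows along $g$ (pullbacks being determined up to isomorphism). For a collection $E$ of families, $E^{pb}$ denotes the collection of all pullbacks of families in $E$. A *cotree* in $\mathcal C$ is a diagram $T^{op}\to\mathcal C$, where $T$ is a small rooted tree: a partial order with a least element (the root) in which the elements below any given one are well-ordered. Some maximal vertices of $T$ are marked as leaves; the *predecessors* of a vertex are the arrows into its object from the objects at its immediate successors in $T$ (so a maximal vertex that is not a leaf has the empty family of predecessors). A *continuous $(E,\kappa)$-cotree* is one in which the predecessors of every vertex that is not a leaf form a member of $E$, every branch (maximal chain of $T$) has fewer than $\kappa$ vertices, and the object at each limit vertex is the limit of the objects at the vertices strictly below it in $T$. Its *transfinite cocompositions* are the projections to the root object from the limits of its branches, except for those branches that end in a maximal vertex that is not a leaf. $E^{tree_\kappa}$ is the collection of all families on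 the root object formed by the transfinite cocompositions of a continuous $(E,\kappa)$-cotree (the closure of $E$ under the *$\kappa$-tree operation*), and $\langle E\rangle_\kappa=(E^{pb})^{tree_\kappa}$. A *small $\kappa$-site* $(\mathcal C,E)$ is a small $\kappa$-lex category $\mathcal C$ with a collection $E$ of families that contains $\{\mathrm{id}:1\to 1\}$ for a terminal object $1$. A *$\kappa$-topos* is a Grothendieck topos (a category equivalent to the category of sheaves of sets on a small site) that is $(\infty,\kappa)$-coherent: it is $\kappa$-lex, it has pullback-stable (effective epi)–mono factorizations and pullback-stable unions of small sets of subobjects, and its small extremal epimorphic families are compatible with $<\kappa$-limits, i.e. writing $\mathcal X$ for the collection of these families, all members of $\mathcal X^{pb}$ and of $(\mathcal X^{pb})^{tree_\kappa}$ are extremal epimorphic. A *map of $\kappa$-toposes* is a geometric morphism between $\kappa$-toposes whose inverse image functor is $\kappa$-lex. **Proposition.** Let $(\mathcal C,E)$ be a small $\kappa$-site. Then: 1. $\langle E\rangle_\kappa$ is closed under pullbacks and under the $\kappa$-tree operation. 2. $\langle E\rangle_\kappa$ is a Grothendieck topology: it contains the isomorphisms (as one-element families), it is closed under pullbacks and under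 composition of families, and the sieves that contain a family from $\langle E\rangle_\kappa$ are exactly the covering sieves of the Grothendieck topology generated by $\langle E\rangle_\kappa$. Let $Sh(\mathcal C,\langle E\rangle_\kappa)$ be the category of sheaves of sets for this topology. 3. $Sh(\mathcal C,\langle E\rangle_\kappa)$ is a $\kappa$-topos. 4. The full inclusion $Sh(\mathcal C,\langle E\rangle_\kappa)\hookrightarrow \mathbf{Set}^{\mathcal C^{op}}$ is (the direct image of) a map of $\kappa$-toposes; that is, the sheafification functor $a:\mathbf{Set}^{\mathcal C^{op}}\to Sh(\mathcal C,\langle E\rangle_\kappa)$ is $\kappa$-lex. 5. The sheafified Yoneda embedding $ay:\mathcal C\to Sh(\mathcal C,\langle E\rangle_\kappa)$ is $\kappa$-lex and maps every family in $E$ to an extremal epimorphic family. -/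

import Mathlib

open CategoryTheory Limits Opposite

universe w v u v' u'

namespace KappaTopos

section Limits

/-- `C` is `κ`-lex: it has limits of all diagrams with fewer than `κ` arrows. -/
def IsKappaLex (κ : Cardinal.{w}) (C : Type u) [Category.{v} C] : Prop :=
  ∀ (J : Type w) [SmallCategory J], HasCardinalLT (Arrow J) κ → HasLimitsOfShape J C

/-- `F` preserves limits of diagrams with fewer than `κ` arrows. -/
def PreservesKappaLimits (κ : Cardinal.{w}) {C : Type u} [Category.{v} C]
    {D : Type u'} [Category.{v'} D] (F : C ⥤ D) : Prop :=
  ∀ (J : Type w) [SmallCategory J], HasCardinalLT (Arrow J) κ → PreservesLimitsOfShape J F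

theorem IsKappaLex.hasPullbacks {κ : Cardinal.{w}} {C : Type u} [Category.{v} C]
    (h : IsKappaLex κ C) (hκ : κ.IsRegular) : HasPullbacks C := by
  have := h (ShrinkHoms.{w} (Shrink.{w} WalkingCospan)) (by
    rw [hasCardinalLT_arrow_shrinkHoms_iff, hasCardinalLT_arrow_shrink_iff]
    exact hasCardinalLT_of_finite _ κ hκ.aleph0_le)
  exact hasLimitsOfShape_of_equivalence
    ((Shrink.equivalence.{w} WalkingCospan).trans (ShrinkHoms.equivalence.{w} _)).symm

end Limits

section Families

/-- A family of arrows into `X` is extremal epimorphic if it does not factor through any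
proper subobject of `X`. -/
def IsExtremalEpiFamily {C : Type u} [Category.{v} C] {X : C} (R : Presieve X) : Prop :=
  ∀ ⦃S : C⦄ (m : S ⟶ X) [Mono m],
    (∀ ⦃Y : C⦄ (f : Y ⟶ X), R f → ∃ g : Y ⟶ S, g ≫ m = f) → IsIso m

/-- `R'` is a pullback of the family `R` along `g`: its arrows are pullbacks along `g` of
the arrows in `R`, at least one for each of them (pullbacks being determined only up to
isomorphism). -/
def IsPullbackFamily {C : Type u} [Category.{v} C] {X Y : C} (g : Y ⟶ X)
    (R : Presieve X) (R' : Presieve Y) : Prop :=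
  (∀ ⦃P : C⦄ (p : P ⟶ Y), R' p →
    ∃ (Z : C) (f : Z ⟶ X) (q : P ⟶ Z), R f ∧ IsPullback p q g f) ∧
  (∀ ⦃Z : C⦄ (f : Z ⟶ X), R f →
    ∃ (P : C) (p : P ⟶ Y) (q : P ⟶ Z), R' p ∧ IsPullback p q g f)

/-- `E^pb`: all the pullbacks of families in `E`. -/
def pbClosure {C : Type u} [Category.{v} C] (E : Precoverage C) : Precoverage C where
  coverings Y := {R' | ∃ (X : C) (g : Y ⟶ X) (R : Presieve X), R ∈ E X ∧ IsPullbackFamily g R R'}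

end Families

section Cotrees

/-- A cotree in `C`: a diagram in `C` on the opposite of a rooted tree `T`. Some of the maximal
vertices of `T` are marked as leaves; a maximal vertex which is not a leaf is considered
as a vertex whose family of predecessors is empty. -/
structure Cotree (C : Type u) [Category.{v} C] where
  /-- the vertices -/
  T : Type w
  [partialOrder : PartialOrder T]
  [orderBot : OrderBot T]
  [wellFounded : WellFoundedLT T]
  isChain_Iic : ∀ t : T, IsChain (· ≤ ·) (Set.Iic t)
  /-- the diagram -/
  diag : Tᵒᵖ ⥤ C
  /-- the marked leaves -/
  leaf : Set T
  isMax_of_mem_leaf : ∀ t ∈ leaf, IsMax t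

namespace Cotree

attribute [instance] Cotree.partialOrder Cotree.orderBot Cotree.wellFounded

variable {C : Type u} [Category.{v} C] (τ : Cotree.{w} C)

/-- The object at the vertex `t`. -/
abbrev obj (t : τ.T) : C := τ.diag.obj (op t)

/-- The arrow between the objects at two comparable vertices. -/
abbrev map {s t : τ.T} (h : s ≤ t) : τ.obj t ⟶ τ.obj s := τ.diag.map (homOfLE h).op

/-- The object at the root. -/
abbrev root : C := τ.obj ⊥

/-- The family formed by the predecessors (in the cotree) of a vertex `t`, which are the
immediate successors of `t` in the order of the tree. -/
def predecessors (t : τ.T) : Presieve (τ.obj t) :=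
  Presieve.ofArrows (fun s : {s : τ.T // t ⋖ s} => τ.obj s.1) (fun s => τ.map s.2.le)

/-- The restriction of the diagram to a set of vertices. -/
def restrict (A : Set τ.T) : (↥A)ᵒᵖ ⥤ C :=
  (Subtype.mono_coe (· ∈ A)).functor.op ⋙ τ.diag

/-- The object at `t`, as a cone on the part of the cotree between `t` and the root. -/
def coneIio (t : τ.T) : Cone (τ.restrict (Set.Iio t)) where
  pt := τ.obj t
  π :=
    { app := fun s => τ.map (le_of_lt s.unop.2)
      naturality := fun s s' f => by
        dsimp [restrict, Cotree.map]
        rw [Category.id_comp, ← Functor.map_comp]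
        rfl }

/-- Every vertex which is not a leaf is covered by an `E`-family, every branch (maximal chain)
has fewer than `κ` vertices, and the objects at limit vertices are limits. -/
structure IsContinuous (κ : Cardinal.{w}) (E : Precoverage C) : Prop where
  predecessors_mem : ∀ t ∉ τ.leaf, τ.predecessors t ∈ E (τ.obj t)
  branch_lt : ∀ b : Flag τ.T, Cardinal.mk (b : Set τ.T) < κ
  isLimit : ∀ t : τ.T, Order.IsSuccLimit t → Nonempty (IsLimit (τ.coneIio t))

/-- The branches, except those which stop at a vertex which is covered by the empty family. -/
def LiveBranch : Type w :=
  {b : Flag τ.T // ∀ t ∈ b, IsMax t → t ∈ τ.leaf}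

/-- The diagram formed by a branch. -/
abbrev branch (b : τ.LiveBranch) : (↥(b.1 : Set τ.T))ᵒᵖ ⥤ C := τ.restrict (b.1 : Set τ.T)

/-- The transfinite cocomposition of a branch, computed by a limit cone: the projection from
the limit of the branch to the root. -/
def cocomposition (b : τ.LiveBranch) (c : Cone (τ.branch b)) : c.pt ⟶ τ.root :=
  c.π.app (op ⟨⊥, b.1.bot_mem⟩)

/-- The family formed by the transfinite cocompositions of the branches. -/
def cocompositionFamily (c : ∀ b : τ.LiveBranch, LimitCone (τ.branch b)) :
    Presieve τ.root :=
  Presieve.ofArrows (fun b => (c b).cone.pt) (fun b => τ.cocomposition b (c b).cone)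

end Cotree

/-- The families which are obtained as the transfinite cocompositions of the branches of a
continuous `(E, κ)`-cotree. -/
inductive IsTreeFamily {C : Type u} [Category.{v} C] (κ : Cardinal.{w}) (E : Precoverage C) :
    ∀ X : C, Presieve X → Prop
  | mk (τ : Cotree.{w} C) (hτ : τ.IsContinuous κ E)
      (c : ∀ b : τ.LiveBranch, LimitCone (τ.branch b)) :
      IsTreeFamily κ E τ.root (τ.cocompositionFamily c)

/-- `E^{tree_κ}`: the closure of `E` under the `κ`-tree operation. -/
def treeClosure {C : Type u} [Category.{v} C] (κ : Cardinal.{w}) (E : Precoverage C) :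
    Precoverage C where
  coverings X := {R | IsTreeFamily κ E X R}

/-- `⟨E⟩_κ = (E^pb)^{tree_κ}`. -/
def bracket {C : Type u} [Category.{v} C] (κ : Cardinal.{w}) (E : Precoverage C) :
    Precoverage C :=
  treeClosure κ (pbClosure E)

end Cotrees

section Sites

/-- `(C, E)` is a `κ`-site: `C` is `κ`-lex and `E` contains the family consisting of the
identity of a terminal object. -/
structure IsKappaSite {C : Type u} [Category.{v} C] (κ : Cardinal.{w}) (E : Precoverage C) :
    Prop where
  isKappaLex : IsKappaLex κ C
  exists_terminal : ∃ T : C, Nonempty (IsTerminal T) ∧ Presieve.singleton (𝟙 T) ∈ E T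

/-- The topology generated by `⟨E⟩_κ`. -/
def topology {C : Type u} [Category.{v} C] (κ : Cardinal.{w}) (E : Precoverage C) :
    GrothendieckTopology C :=
  (bracket κ E).toGrothendieck

/-- A collection `K` of families is a Grothendieck topology, in the language of covering
families: it contains the isomorphisms and is closed under pullbacks and composition, and the
sieves that contain a family from `K` are the covering sieves of the topology generated
by `K`. -/
structure IsGrothendieckTopology {C : Type u} [Category.{v} C] (K : Precoverage C) : Prop where
  hasIsos : K.HasIsos
  isStableUnderBaseChange : K.IsStableUnderBaseChange
  isStableUnderComposition : K.IsStableUnderComposition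
  mem_iff : ∀ (X : C) (S : Sieve X), S ∈ K.toGrothendieck X ↔ ∃ R ∈ K X, R ≤ S.arrows

end Sites

section Toposes

/-- The extremal epimorphic families with a small set of legs. -/
def extremalFamilies (𝓔 : Type u) [Category.{v} 𝓔] : Precoverage 𝓔 where
  coverings _ := {R | Small.{w} R.uncurry ∧ IsExtremalEpiFamily R}

/-- A class `E` of families is compatible with limits of size less than `κ`: the pullbacks of its
members are extremal epimorphic, and so are the families obtained from continuous
`(E^pb, κ)`-cotrees. -/
structure IsCompatible {𝓔 : Type u} [Category.{v} 𝓔] (κ : Cardinal.{w}) (E : Precoverage 𝓔) :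
    Prop where
  pullback : ∀ (X : 𝓔), ∀ R ∈ pbClosure E X, IsExtremalEpiFamily R
  tree : ∀ (X : 𝓔), ∀ R ∈ treeClosure κ (pbClosure E) X, IsExtremalEpiFamily R

/-- `(∞, κ)`-coherent categories. -/
structure IsInftyKappaCoherent (κ : Cardinal.{w}) (𝓔 : Type u) [Category.{v} 𝓔] : Prop where
  isRegular : κ.IsRegular
  isKappaLex : IsKappaLex κ 𝓔
  exists_factorization : ∀ ⦃X Y : 𝓔⦄ (f : X ⟶ Y), ∃ (I : 𝓔) (e : X ⟶ I) (m : I ⟶ Y),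
    EffectiveEpi e ∧ Mono m ∧ e ≫ m = f
  effectiveEpi_of_isPullback : ∀ ⦃P X Y Z : 𝓔⦄ (p : P ⟶ Y) (q : P ⟶ X) (g : Y ⟶ Z) (e : X ⟶ Z),
    IsPullback p q g e → EffectiveEpi e → EffectiveEpi p
  exists_union :
    haveI : HasPullbacks 𝓔 := isKappaLex.hasPullbacks isRegular
    ∀ (X : 𝓔) (I : Type w) (S : I → Subobject X), ∃ U : Subobject X,
      IsLUB (Set.range S) U ∧
      ∀ ⦃Y : 𝓔⦄ (g : Y ⟶ X),
        IsLUB (Set.range fun i => (Subobject.pullback g).obj (S i)) ((Subobject.pullback g).obj U)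
  isCompatible : IsCompatible κ (extremalFamilies.{w} 𝓔)

/-- Grothendieck toposes: the categories equivalent to the category of sheaves of sets on a
small site. -/
def IsGrothendieckTopos (𝓔 : Type u) [Category.{w} 𝓔] : Prop :=
  ∃ (D : Type w) (_ : SmallCategory D) (J : GrothendieckTopology D),
    Nonempty (𝓔 ≌ Sheaf J (Type w))

/-- `κ`-toposes. -/
structure IsKappaTopos (κ : Cardinal.{w}) (𝓔 : Type u) [Category.{w} 𝓔] : Prop where
  isGrothendieckTopos : IsGrothendieckTopos 𝓔
  isInftyKappaCoherent : IsInftyKappaCoherent κ 𝓔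

/-- `G` is (the direct image of) a map of `κ`-toposes: a geometric morphism between `κ`-toposes
whose inverse image preserves limits of size less than `κ`. -/
structure IsKappaToposMap (κ : Cardinal.{w}) {𝓔₁ : Type u} [Category.{w} 𝓔₁]
    {𝓔₂ : Type u'} [Category.{w} 𝓔₂] (G : 𝓔₁ ⥤ 𝓔₂) : Prop where
  source : IsKappaTopos κ 𝓔₁
  target : IsKappaTopos κ 𝓔₂
  exists_inverseImage : ∃ F : 𝓔₂ ⥤ 𝓔₁, Nonempty (F ⊣ G) ∧
    PreservesFiniteLimits F ∧ PreservesKappaLimits κ F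

end Toposes

end KappaTopos

/-! Closure properties. A continuous cotree pulled back along an arrow into its root is again
continuous, since limits commute with pullbacks. A cotree whose vertices are covered by tree
families becomes a single cotree when the smaller trees are grafted onto it (`Grafting`); its
branches still have fewer than `κ` vertices because `κ` is regular. Two complications arise. Limits
and pullbacks are only defined up to isomorphism, so a looser closure `weakTree` is used and then
shown to add nothing (`IsPbClosed.weakTree_le`). Moreover a family is a mere set of arrows, so the
successors of a vertex and the branches of the tree covering it are related many-to-many;
duplicating vertices (`Cotree.decorate`) makes the relation a map. Composition of families is the
case of a tree with two levels.

Path lifting. The topos-theoretic part rests on `IsLocallyContinuous.exists_liveBranch`. Consider a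
cotree of presheaves in which sections lift locally, along families of `K`, from each vertex that is
not a leaf to its successors, and in which compatible sections lift to limit vertices. From a
section over `U` at the root, lift locally to successors again and again, taking limits of domains
in `C` at limit stages. All these partial lifts form a continuous `(K, κ)`-cotree in `C`. If `K` is
closed under the tree operation, its cocompositions belong to `K U`, and over each of them the
section lifts along a whole live branch.

Applications. Among sheaves, extremal epimorphic means locally surjective
(`IsSheafEmbedding.isExtremalEpiFamily_iff`), so path lifting gives compatibility with `κ`-small
limits; images of coproducts give unions. Presheaves are the case of the trivial topology, generated
by the nonempty families of isomorphisms. Applied to a well-ordered chain of intersections of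
sieves, path lifting shows that fewer than `κ` covering sieves have a covering intersection
(`iInf_mem_of_lt`). Thus fewer than `κ` local conditions can be met on one cover, and
sheafification, whose unit is locally bijective, preserves `κ`-small limits. The Yoneda embedding
preserves all limits and the families of `E` cover, which gives the last assertion. -/

namespace KappaTopos

/-! ### Order theory of well-founded trees -/

section TreeOrder

/-- The order on the vertices of a tree: the elements below a given one are well-ordered. -/
class TreeOrder (T : Type*) [PartialOrder T] : Prop where
  wellFounded : WellFoundedLT T
  isChain_Iic : ∀ t : T, IsChain (· ≤ ·) (Set.Iic t)

instance {C : Type u} [Category.{v} C] (τ : Cotree.{w} C) : TreeOrder τ.T where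
  wellFounded := τ.wellFounded
  isChain_Iic := τ.isChain_Iic

namespace TreeOrder

variable {T : Type*} [PartialOrder T] [TreeOrder T]

theorem total {s s' t : T} (h : s ≤ t) (h' : s' ≤ t) : s ≤ s' ∨ s' ≤ s :=
  (isChain_Iic t).total h h'

theorem exists_minimal (P : T → Prop) (h : ∃ t, P t) : ∃ t, P t ∧ ∀ r, r < t → ¬ P r := by
  have := wellFounded (T := T)
  obtain ⟨m, hm, hm'⟩ := wellFounded_lt.has_min {t | P t} h
  exact ⟨m, hm, fun r hr hP => hm' r hP hr⟩

theorem exists_covBy_le {s t : T} (h : s < t) : ∃ r, s ⋖ r ∧ r ≤ t := by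
  obtain ⟨r, ⟨h₁, h₂⟩, hr⟩ := exists_minimal (fun r => s < r ∧ r ≤ t) ⟨t, h, le_rfl⟩
  exact ⟨r, ⟨h₁, fun c hc hc' => hr c hc' ⟨hc, hc'.le.trans h₂⟩⟩, h₂⟩

theorem le_of_covBy {s r s' t : T} (h : s ⋖ r) (hr : r ≤ t) (hs : s < s') (hs' : s' ≤ t) :
    r ≤ s' := by
  rcases total hr hs' with h' | h'
  · exact h'
  · rcases h'.eq_or_lt with rfl | h''
    · exact le_rfl
    · exact (h.2 hs h'').elim

theorem covBy_right_unique {s r r' t : T} (h : s ⋖ r) (h' : s ⋖ r') (hr : r ≤ t) (hr' : r' ≤ t) :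
    r = r' :=
  le_antisymm (le_of_covBy h hr h'.lt hr') (le_of_covBy h' hr' h.lt hr)

theorem covBy_left_unique {s s' r : T} (h : s ⋖ r) (h' : s' ⋖ r) : s = s' := by
  rcases total h.le h'.le with h₁ | h₁
  · rcases h₁.eq_or_lt with rfl | h₂
    · rfl
    · exact (h.2 h₂ h'.lt).elim
  · rcases h₁.eq_or_lt with rfl | h₂
    · rfl
    · exact (h'.2 h₂ h.lt).elim

theorem mem_flag_of_le (b : Flag T) {s t : T} (ht : t ∈ b) (h : s ≤ t) : s ∈ b := by
  refine Flag.mem_iff_forall_le_or_ge.2 fun r hr => ?_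
  rcases b.le_or_le hr ht with h' | h'
  · exact total h h'
  · exact Or.inl (h.trans h')

theorem mem_flag_of_forall_lt (b : Flag T) {t : T} (h : ∀ s, s ∈ b → s ≤ t) : t ∈ b :=
  Flag.mem_iff_forall_le_or_ge.2 fun _ hr => Or.inr (h _ hr)

theorem le_of_lt_of_covBy {r s t : T} (h : r < t) (h' : s ⋖ t) : r ≤ s := by
  rcases total h.le h'.le with h₁ | h₁
  · exact h₁
  · rcases h₁.eq_or_lt with h₁ | h₁
    · exact h₁.ge
    · exact (h'.2 h₁ h).elim

/-- A chain which is a lower set and not maximal consists of the vertices strictly below some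
vertex. -/
theorem exists_Iio_eq {A : Set T} (hA : ∀ s t, s ≤ t → t ∈ A → s ∈ A)
    (h : ∃ t, t ∉ A ∧ ∀ a ∈ A, a ≤ t ∨ t ≤ a) : ∃ t, Set.Iio t = A := by
  obtain ⟨t₀, h₁, h₂⟩ := h
  have h₃ : ∀ a ∈ A, a < t₀ := fun a ha => by
    rcases h₂ a ha with h | h
    · exact h.lt_of_ne (fun h' => h₁ (h' ▸ ha))
    · exact (h₁ (hA _ _ h ha)).elim
  -- A minimal strict upper bound of `A` below `t₀`: an `r < t` outside the lower set `A` would be a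
  -- smaller one.
  obtain ⟨t, ⟨ht, ht₀⟩, ht'⟩ := exists_minimal (fun t => (∀ a ∈ A, a < t) ∧ t ≤ t₀) ⟨t₀, h₃, le_rfl⟩
  refine ⟨t, Set.ext fun r => ⟨fun hr => ?_, fun hr => ht r hr⟩⟩
  by_contra hrA
  refine ht' r hr ⟨fun a ha => ?_, hr.le.trans ht₀⟩
  rcases total (ht a ha).le (le_of_lt hr) with h | h
  · exact h.lt_of_ne (fun h' => hrA (h' ▸ ha))
  · exact (hrA (hA _ _ h ha)).elim

/-- A chain which is a lower set is a branch, or consists of the vertices strictly below some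
vertex. -/
theorem exists_flag_or_Iio {A : Set T} (hA : ∀ s t, s ≤ t → t ∈ A → s ∈ A)
    (hA' : IsChain (· ≤ ·) A) : (∃ b : Flag T, (b : Set T) = A) ∨ ∃ t, Set.Iio t = A := by
  by_cases h : ∃ t, t ∉ A ∧ ∀ a ∈ A, a ≤ t ∨ t ≤ a
  · exact Or.inr (exists_Iio_eq hA h)
  · push Not at h
    refine Or.inl ⟨⟨A, hA', fun s hs hAs => ?_⟩, rfl⟩
    refine Set.Subset.antisymm hAs fun t ht => ?_
    by_contra htA
    obtain ⟨a, ha, h₁, h₂⟩ := h t htA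
    rcases hs.total (hAs ha) ht with h | h
    · exact h₁ h
    · exact h₂ h

theorem bot_or_covBy_or_isSuccLimit [OrderBot T] (t : T) :
    t = ⊥ ∨ (∃ s, s ⋖ t) ∨ Order.IsSuccLimit t := by
  by_cases h : t = ⊥
  · exact Or.inl h
  · by_cases h' : ∃ s, s ⋖ t
    · exact Or.inr (Or.inl h')
    · push Not at h'
      exact Or.inr (Or.inr ⟨fun hm => h (isMin_iff_eq_bot.1 hm), h'⟩)

theorem exists_lt_of_isSuccLimit {s t : T} (ht : Order.IsSuccLimit t) (h : s < t) :
    ∃ r, s ⋖ r ∧ r < t := by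
  obtain ⟨r, h₁, h₂⟩ := exists_covBy_le h
  exact ⟨r, h₁, h₂.lt_of_ne (fun h' => ht.2 s (h' ▸ h₁))⟩

/-- The branch below a maximal vertex. -/
def flagIic (t : T) (ht : IsMax t) : Flag T :=
  ⟨Set.Iic t, isChain_Iic t, fun s hs h => Set.Subset.antisymm h fun r hr => by
    rcases hs.total hr (h (Set.mem_Iic.2 le_rfl)) with h' | h'
    · exact h'
    · exact ht h'⟩

theorem mem_flagIic {s t : T} (ht : IsMax t) : s ∈ flagIic t ht ↔ s ≤ t := Iff.rfl

theorem isMax_of_isMax_flag (b : Flag T) {t : T} (h : t ∈ b) (ht : ∀ s ∈ b, s ≤ t) : IsMax t := by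
  intro s hs
  exact ht s (mem_flag_of_forall_lt b fun r hr => (ht r hr).trans hs)

end TreeOrder

end TreeOrder

/-! ### Limits over sets of vertices, expressed by projections -/

section LimOn

variable {C : Type u} [Category.{v} C] {T : Type w} [Preorder T]

/-- The projections `p` present `X` as the limit of the part of the diagram `D` formed by the
vertices in `A`. -/
structure LimOn (D : Tᵒᵖ ⥤ C) (A : Set T) {X : C} (p : ∀ a, a ∈ A → (X ⟶ D.obj (op a))) :
    Prop where
  comp_map : ∀ a b (ha : a ∈ A) (hb : b ∈ A) (h : a ≤ b), p b hb ≫ D.map (homOfLE h).op = p a ha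
  existsUnique : ∀ {W : C} (q : ∀ a, a ∈ A → (W ⟶ D.obj (op a))),
    (∀ a b (ha : a ∈ A) (hb : b ∈ A) (h : a ≤ b), q b hb ≫ D.map (homOfLE h).op = q a ha) →
    ∃! l : W ⟶ X, ∀ a ha, l ≫ p a ha = q a ha

namespace LimOn

variable {D : Tᵒᵖ ⥤ C} {A : Set T} {X : C} {p : ∀ a, a ∈ A → (X ⟶ D.obj (op a))}

theorem hom_ext (h : LimOn D A p) {W : C} {f g : W ⟶ X}
    (hfg : ∀ a ha, f ≫ p a ha = g ≫ p a ha) : f = g := by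
  refine (h.existsUnique (fun a ha => g ≫ p a ha) ?_).unique hfg (fun _ _ => rfl)
  intro a b ha hb hab
  rw [Category.assoc, h.comp_map]

/-- It suffices to consider a cofinal set of vertices. -/
theorem of_cofinal (p : ∀ a, a ∈ A → (X ⟶ D.obj (op a)))
    (hp : ∀ a b (ha : a ∈ A) (hb : b ∈ A) (h : a ≤ b), p b hb ≫ D.map (homOfLE h).op = p a ha)
    {B : Set T} (hBA : B ⊆ A) (hB : ∀ a ∈ A, ∃ b ∈ B, a ≤ b)
    (h : LimOn D B (fun b hb => p b (hBA hb))) : LimOn D A p where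
  comp_map := hp
  existsUnique := by
    intro W q hq
    obtain ⟨l, hl, hl'⟩ := h.existsUnique (fun b hb => q b (hBA hb))
      (fun a b ha hb hab => hq a b _ _ hab)
    refine ⟨l, fun a ha => ?_, fun l' h' => hl' l' fun b hb => h' b (hBA hb)⟩
    obtain ⟨b, hb, hab⟩ := hB a ha
    rw [← hp a b ha (hBA hb) hab, ← hq a b ha (hBA hb) hab, ← hl b hb, Category.assoc]

/-- The limit over a chain with a greatest element. -/
theorem of_isGreatest {t : T} (ht : IsGreatest A t)
    (p : ∀ a, a ∈ A → (X ⟶ D.obj (op a)))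
    (hp : ∀ a b (ha : a ∈ A) (hb : b ∈ A) (h : a ≤ b), p b hb ≫ D.map (homOfLE h).op = p a ha)
    (hi : IsIso (p t ht.1)) : LimOn D A p where
  comp_map := hp
  existsUnique := by
    intro W q hq
    refine ⟨q t ht.1 ≫ inv (p t ht.1), fun a ha => ?_, fun l' h' => ?_⟩
    · rw [← hp a t ha ht.1 (ht.2 ha), Category.assoc, IsIso.inv_hom_id_assoc, hq]
    · rw [← h' t ht.1, Category.assoc, IsIso.hom_inv_id, Category.comp_id]

theorem isIso_of_isGreatest (h : LimOn D A p) {t : T} (ht : IsGreatest A t) :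
    IsIso (p t ht.1) := by
  obtain ⟨l, hl, -⟩ := h.existsUnique (W := D.obj (op t))
    (fun a ha => D.map (homOfLE (ht.2 ha)).op)
    (fun a b ha hb hab => by rw [← Functor.map_comp]; rfl)
  refine ⟨l, h.hom_ext fun a ha => ?_, ?_⟩
  · rw [Category.assoc, hl, Category.id_comp, h.comp_map]
  · rw [hl t ht.1]
    exact D.map_id _

theorem of_iso (h : LimOn D A p) {Y : C} (e : Y ≅ X) : LimOn D A (fun a ha => e.hom ≫ p a ha) where
  comp_map a b ha hb hab := by rw [Category.assoc, h.comp_map]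
  existsUnique := by
    intro W q hq
    obtain ⟨l, hl, hl'⟩ := h.existsUnique q hq
    refine ⟨l ≫ e.inv, fun a ha => by simp [hl], fun l' h' => ?_⟩
    rw [← hl' (l' ≫ e.hom) (fun a ha => by rw [Category.assoc]; exact h' a ha)]
    simp

/-- Transport along a bijection of the sets of vertices and isomorphisms of the objects. -/
theorem transport {T' : Type*} [Preorder T'] {D' : T'ᵒᵖ ⥤ C} {A' : Set T'} (h : LimOn D A p)
    (f : ∀ a, a ∈ A → T') (hf : ∀ a ha, f a ha ∈ A')
    (hf' : ∀ a b ha hb, f a ha ≤ f b hb → a ≤ b) (hfm : ∀ a b ha hb, a ≤ b → f a ha ≤ f b hb)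
    (hs : ∀ a' ∈ A', ∃ a ha, f a ha = a')
    (e : ∀ a ha, D'.obj (op (f a ha)) ≅ D.obj (op a))
    (he : ∀ a b ha hb (hab : a ≤ b), (e b hb).hom ≫ D.map (homOfLE hab).op =
      D'.map (homOfLE (hfm a b ha hb hab)).op ≫ (e a ha).hom)
    {p' : ∀ a, a ∈ A' → (X ⟶ D'.obj (op a))}
    (hp : ∀ a ha, p' (f a ha) (hf a ha) ≫ (e a ha).hom = p a ha) : LimOn D' A' p' where
  comp_map a' b' ha' hb' hab' := by
    obtain ⟨a, ha, rfl⟩ := hs a' ha'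
    obtain ⟨b, hb, rfl⟩ := hs b' hb'
    have hab := hf' a b ha hb hab'
    rw [← cancel_mono (e a ha).hom, Category.assoc, ← he a b ha hb hab, ← Category.assoc, hp, hp,
      h.comp_map a b ha hb hab]
  existsUnique := by
    intro W q hq
    obtain ⟨l, hl, hl'⟩ := h.existsUnique (fun a ha => q (f a ha) (hf a ha) ≫ (e a ha).hom)
      (fun a b ha hb hab => by
        rw [Category.assoc, he a b ha hb hab, ← Category.assoc, hq])
    refine ⟨l, fun a' ha' => ?_, fun l' h' => hl' l' fun a ha => ?_⟩
    · obtain ⟨a, ha, rfl⟩ := hs a' ha'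
      rw [← cancel_mono (e a ha).hom, Category.assoc, hp, hl]
    · rw [← hp, ← Category.assoc, h']

end LimOn

end LimOn

/-! ### Comparison with limit cones -/

section CotreeLimits

variable {C : Type u} [Category.{v} C]

namespace Cotree

variable (τ : Cotree.{w} C)

theorem limOn_of_isLimit {A : Set τ.T} {c : Cone (τ.restrict A)} (hc : IsLimit c) :
    LimOn τ.diag A (fun a ha => c.π.app (op ⟨a, ha⟩)) where
  comp_map a b ha hb h := c.w (homOfLE (show (⟨a, ha⟩ : A) ≤ ⟨b, hb⟩ from h)).op
  existsUnique := by
    intro W q hq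
    let s : Cone (τ.restrict A) :=
      { pt := W
        π := { app := fun a => q a.unop.1 a.unop.2
               naturality := fun a b f => by
                exact (Category.id_comp (q _ _)).trans
                  (hq _ _ _ _ (leOfHom f.unop)).symm } }
    refine ⟨hc.lift s, fun a ha => hc.fac s _, fun l hl => hc.uniq s l fun a => hl _ _⟩

/-- The cone given by a compatible family of projections. -/
def coneOn {A : Set τ.T} {X : C} {p : ∀ a, a ∈ A → (X ⟶ τ.obj a)} (h : LimOn τ.diag A p) :
    Cone (τ.restrict A) where
  pt := X
  π :=
    { app := fun a => p a.unop.1 a.unop.2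
      naturality := fun a b f => by
        exact (Category.id_comp (p _ _)).trans (h.comp_map _ _ _ _ (leOfHom f.unop)).symm }

/-- A limit in the elementary sense is a limit cone. -/
noncomputable def isLimitConeOn {A : Set τ.T} {X : C} {p : ∀ a, a ∈ A → (X ⟶ τ.obj a)}
    (h : LimOn τ.diag A p) : IsLimit (τ.coneOn h) :=
  have H (s : Cone (τ.restrict A)) := h.existsUnique (fun a ha => s.π.app (op ⟨a, ha⟩))
    (fun a b ha hb hab => s.w (homOfLE (show (⟨a, ha⟩ : A) ≤ ⟨b, hb⟩ from hab)).op)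
  { lift := fun s => (H s).choose
    fac := fun s a => (H s).choose_spec.1 a.unop.1 a.unop.2
    uniq := fun s m hm => (H s).choose_spec.2 m fun a ha => hm (op ⟨a, ha⟩) }

theorem nonempty_isLimit_coneIio_iff (t : τ.T) :
    Nonempty (IsLimit (τ.coneIio t)) ↔
      LimOn τ.diag (Set.Iio t) (fun a (ha : a < t) => τ.map ha.le) :=
  ⟨fun ⟨h⟩ => τ.limOn_of_isLimit h, fun h => ⟨τ.isLimitConeOn h⟩⟩

/-- An arrow of a poset is determined by its endpoints, and `κ` is infinite, so fewer than `κ`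
vertices span fewer than `κ` arrows. -/
theorem hasLimit_restrict {κ : Cardinal.{w}} (hκ : κ.IsRegular) (hC : IsKappaLex κ C)
    (A : Set τ.T) (hA : Cardinal.mk A < κ) : HasLimit (τ.restrict A) := by
  have : HasCardinalLT (Arrow (↥A)ᵒᵖ) κ := by
    refine HasCardinalLT.of_injective (X := A × A) ?_
      (fun f => (f.left.unop, f.right.unop)) ?_
    · rw [hasCardinalLT_iff_cardinal_mk_lt, Cardinal.mk_prod, Cardinal.lift_id]
      exact Cardinal.mul_lt_of_lt hκ.aleph0_le hA hA
    · rintro ⟨a, b, f⟩ ⟨a', b', f'⟩ h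
      obtain ⟨h₁, h₂⟩ := Prod.mk.inj h
      obtain rfl : a = a' := unop_injective h₁
      obtain rfl : b = b' := unop_injective h₂
      obtain rfl : f = f' := Subsingleton.elim _ _
      rfl
  have := hC _ this
  infer_instance

end Cotree

end CotreeLimits

end KappaTopos

namespace KappaTopos

/-! ### Trees of labelled paths in a given tree -/

section Thread

/-- The vertices of the tree obtained from a tree `T` by decorating each vertex `s` by labels
in `L s`, where the labels below `s` are subject to the condition `ok s`: a vertex `pt` of `T`
together with a valid choice of labels at all the vertices `≤ pt`. -/
structure Thread {T : Type w} [PartialOrder T] (L : T → Type w)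
    (ok : ∀ s, (∀ r, r ≤ s → L r) → Prop) where
  /-- the underlying vertex -/
  pt : T
  /-- the labels -/
  label : ∀ r, r ≤ pt → L r
  valid : ∀ s (h : s ≤ pt), ok s (fun r hr => label r (hr.trans h))

namespace Thread

variable {T : Type w} [PartialOrder T] {L : T → Type w} {ok : ∀ s, (∀ r, r ≤ s → L r) → Prop}

instance : PartialOrder (Thread L ok) where
  le p q := ∃ h : p.pt ≤ q.pt, ∀ r hr, q.label r (hr.trans h) = p.label r hr
  le_refl p := ⟨le_rfl, fun _ _ => rfl⟩
  le_trans p q r h h' := ⟨h.1.trans h'.1, fun s hs => (h'.2 s (hs.trans h.1)).trans (h.2 s hs)⟩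
  le_antisymm p q h h' := by
    obtain ⟨s, l, hl⟩ := p
    obtain ⟨s', l', hl'⟩ := q
    obtain rfl : s = s' := le_antisymm h.1 h'.1
    obtain rfl : l = l' := funext fun r => funext fun hr => h'.2 r hr
    rfl

theorem pt_le {p q : Thread L ok} (h : p ≤ q) : p.pt ≤ q.pt := h.1

theorem label_eq {p q : Thread L ok} (h : p ≤ q) (r : T) (hr : r ≤ p.pt) :
    q.label r (hr.trans h.1) = p.label r hr := h.2 r hr

theorem pt_mono : Monotone (Thread.pt : Thread L ok → T) := fun _ _ h => h.1

/-- The restriction of a thread. -/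
def restrict (p : Thread L ok) (s : T) (h : s ≤ p.pt) : Thread L ok where
  pt := s
  label r hr := p.label r (hr.trans h)
  valid r hr := p.valid r (hr.trans h)

theorem restrict_le (p : Thread L ok) (s : T) (h : s ≤ p.pt) : p.restrict s h ≤ p :=
  ⟨h, fun _ _ => rfl⟩

theorem le_of_pt_le {p q r : Thread L ok} (hp : p ≤ r) (hq : q ≤ r) (h : p.pt ≤ q.pt) : p ≤ q :=
  ⟨h, fun s hs => (hq.2 s (hs.trans h)).symm.trans (hp.2 s hs)⟩

theorem le_of_chain {b : Set (Thread L ok)} (hb : IsChain (· ≤ ·) b) {p q : Thread L ok}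
    (hp : p ∈ b) (hq : q ∈ b) (h : p.pt ≤ q.pt) : p ≤ q := by
  rcases hb.total hp hq with h' | h'
  · exact h'
  · exact le_of_pt_le le_rfl h' h

theorem eq_of_pt_eq {p q r : Thread L ok} (hp : p ≤ r) (hq : q ≤ r) (h : p.pt = q.pt) : p = q :=
  le_antisymm (le_of_pt_le hp hq h.le) (le_of_pt_le hq hp h.ge)

theorem pt_lt {p q : Thread L ok} (h : p < q) : p.pt < q.pt :=
  h.le.1.lt_of_ne fun h' => h.ne (eq_of_pt_eq h.le le_rfl h')

theorem lt_of_le_of_pt_lt {p q : Thread L ok} (h : p ≤ q) (h' : p.pt < q.pt) : p < q :=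
  h.lt_of_ne fun h'' => h'.ne (h'' ▸ rfl)

/-- Restricting the larger thread to an intermediate vertex produces an intermediate thread, so
covers of threads lie exactly over covers of vertices. -/
theorem covBy_iff {p q : Thread L ok} : p ⋖ q ↔ p ≤ q ∧ p.pt ⋖ q.pt := by
  refine ⟨fun h => ⟨h.le, pt_lt h.lt, fun s hs hs' => ?_⟩, fun h => ⟨lt_of_le_of_pt_lt h.1 h.2.lt,
    fun r hr hr' => h.2.2 (pt_lt hr) (pt_lt hr')⟩⟩
  exact h.2 (c := q.restrict s hs'.le)
    (lt_of_le_of_pt_lt (le_of_pt_le h.le (restrict_le _ _ _) hs.le) hs)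
    (lt_of_le_of_pt_lt (restrict_le _ _ _) hs')

instance [TreeOrder T] : TreeOrder (Thread L ok) where
  wellFounded := by
    have := TreeOrder.wellFounded (T := T)
    exact ⟨Subrelation.wf (fun h => pt_lt h) (InvImage.wf Thread.pt (wellFounded_lt (α := T)))⟩
  isChain_Iic p := by
    intro q hq r hr _
    rcases TreeOrder.total (pt_le hq) (pt_le hr) with h | h
    · exact Or.inl (le_of_pt_le hq hr h)
    · exact Or.inr (le_of_pt_le hr hq h)

theorem isSuccLimit_pt [OrderBot T] {p : Thread L ok} (h : Order.IsSuccLimit p) :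
    Order.IsSuccLimit p.pt := by
  refine ⟨fun hm => h.1 fun q hq => le_of_pt_le le_rfl hq (hm (pt_le hq)), fun s hs => ?_⟩
  exact h.2 (p.restrict s hs.le) (covBy_iff.2 ⟨restrict_le _ _ _, hs⟩)

/-- The least thread, when the label at the root is determined. -/
abbrev orderBot [OrderBot T] (l₀ : ∀ r, r ≤ (⊥ : T) → L r) (h : ∀ l, ok ⊥ l ↔ l = l₀) :
    OrderBot (Thread L ok) where
  bot :=
    { pt := ⊥
      label := l₀
      valid := fun s hs => by
        obtain rfl := le_bot_iff.1 hs
        exact (h _).2 rfl }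
  bot_le p := ⟨bot_le, fun r hr => congr_fun (congr_fun ((h _).1 (p.valid ⊥ bot_le)) r) hr⟩

open Classical in
/-- Add a label at the top. -/
noncomputable def extendLabel {t : T} (l : ∀ r, r < t → L r) (a : L t) : ∀ r, r ≤ t → L r :=
  fun r hr => if h : r < t then l r h else (hr.eq_of_not_lt h) ▸ a

theorem extendLabel_of_lt {t : T} (l : ∀ r, r < t → L r) (a : L t) (r : T) (hr : r < t) :
    extendLabel l a r hr.le = l r hr := dif_pos hr

theorem extendLabel_self {t : T} (l : ∀ r, r < t → L r) (a : L t) :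
    extendLabel l a t le_rfl = a := dif_neg (lt_irrefl t)

/-- Extend a thread by a label at the top. -/
noncomputable def extend {t : T} (l : ∀ r, r < t → L r) (a : L t)
    (h : ∀ s (h : s < t), ok s (fun r hr => l r (hr.trans_lt h))) (h' : ok t (extendLabel l a)) :
    Thread L ok where
  pt := t
  label := extendLabel l a
  valid s hs := by
    rcases hs.eq_or_lt with rfl | hs'
    · exact h'
    · convert h s hs' using 1
      exact funext fun r => funext fun hr => extendLabel_of_lt _ _ _ _

theorem le_extend {t : T} (l : ∀ r, r < t → L r) (a : L t)
    (h : ∀ s (h : s < t), ok s (fun r hr => l r (hr.trans_lt h))) (h' : ok t (extendLabel l a))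
    {p : Thread L ok} (hp : p.pt < t) (hp' : ∀ r hr, p.label r hr = l r (hr.trans_lt hp)) :
    p ≤ extend l a h h' :=
  ⟨hp.le, fun r hr => (extendLabel_of_lt _ _ _ _).trans (hp' r hr).symm⟩

/-- Below a successor `s` of `p.pt` all labels are already carried by `p`, so validity only has to
be checked at `s`. -/
theorem exists_extend [TreeOrder T] (p : Thread L ok) {s : T} (hs : p.pt ⋖ s) (a : L s)
    (h : ok s (extendLabel (fun r hr => p.label r (TreeOrder.le_of_lt_of_covBy hr hs)) a)) :
    ∃ q : Thread L ok, p ⋖ q ∧ ∃ h : q.pt = s, q.label s h.ge = a := by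
  have h' : ∀ r (hr : r < s), ok r (fun r' hr' =>
    p.label r' (TreeOrder.le_of_lt_of_covBy (hr'.trans_lt hr) hs)) := fun r hr =>
      p.valid r (TreeOrder.le_of_lt_of_covBy hr hs)
  refine ⟨extend _ a h' h, ?_, rfl, ?_⟩
  swap
  · exact extendLabel_self (fun r hr => p.label r (TreeOrder.le_of_lt_of_covBy hr hs)) a
  exact covBy_iff.2 ⟨le_extend _ _ _ _ hs.lt fun _ _ => rfl, hs⟩

section Flag

variable (b : Flag (Thread L ok))

/-- The vertices under the threads in a branch. -/
def support : Set T := {t | ∃ p ∈ b, p.pt = t}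

variable {b}

theorem pt_mem_support {p : Thread L ok} (hp : p ∈ b) : p.pt ∈ support b := ⟨p, hp, rfl⟩

/-- The labels of the threads in a branch. -/
noncomputable def glue (r : T) (hr : r ∈ support b) : L r :=
  hr.choose.label r hr.choose_spec.2.ge

theorem label_eq_glue {p : Thread L ok} (hp : p ∈ b) (r : T) (hr : r ≤ p.pt)
    (hr' : r ∈ support b) : p.label r hr = glue r hr' := by
  obtain ⟨h₁, h₂⟩ := hr'.choose_spec
  exact label_eq (le_of_chain b.chain_le h₁ hp (h₂.le.trans hr)) r h₂.ge

variable [TreeOrder T]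

theorem mem_support_of_le {s t : T} (h : s ≤ t) (ht : t ∈ support b) : s ∈ support b := by
  obtain ⟨p, hp, rfl⟩ := ht
  exact ⟨_, TreeOrder.mem_flag_of_le b hp (restrict_le p s h), rfl⟩

theorem isChain_support : IsChain (· ≤ ·) (support b) := by
  rintro _ ⟨p, hp, rfl⟩ _ ⟨q, hq, rfl⟩ -
  exact (b.le_or_le hp hq).imp pt_le pt_le

theorem glue_valid (s : T) (hs : s ∈ support b) :
    ok s (fun r hr => glue r (mem_support_of_le hr hs)) := by
  obtain ⟨p, hp, rfl⟩ := hs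
  convert p.valid p.pt le_rfl using 1
  exact funext fun r => funext fun hr => (label_eq_glue hp r hr _).symm

theorem support_cases (b : Flag (Thread L ok)) :
    (∃ c : Flag T, (c : Set T) = support b) ∨ ∃ t, Set.Iio t = support b :=
  TreeOrder.exists_flag_or_Iio (fun _ _ h ht => mem_support_of_le h ht) isChain_support

/-- A branch cannot be extended. -/
theorem not_ok_extendLabel {t : T} (ht : Set.Iio t = support b) (a : L t) :
    ¬ ok t (extendLabel (fun r hr => glue r (ht.le hr)) a) := by
  intro h
  let q : Thread L ok := extend (fun r hr => glue r (ht.le hr)) a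
    (fun s hs => glue_valid s (ht.le hs)) h
  have hq : q ∈ b := by
    refine TreeOrder.mem_flag_of_forall_lt b fun p hp => ?_
    exact le_extend _ _ _ _ (ht.ge (pt_mem_support hp)) fun r hr => label_eq_glue hp r hr _
  exact lt_irrefl t (ht.ge (pt_mem_support hq))

/-- Threads in a chain are determined by their vertices. -/
theorem mk_flag (b : Flag (Thread L ok)) : Cardinal.mk (b : Set (Thread L ok)) ≤
    Cardinal.mk (support b) :=
  Cardinal.mk_le_of_injective (f := fun p : (b : Set (Thread L ok)) =>
    (⟨p.1.pt, pt_mem_support p.2⟩ : support b)) fun p q h =>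
      Subtype.ext (le_antisymm
        (le_of_chain b.chain_le p.2 q.2 (congr_arg Subtype.val h).le)
        (le_of_chain b.chain_le q.2 p.2 (congr_arg Subtype.val h).ge))

theorem mk_support_lt {κ : Cardinal.{w}} (h : ∀ c : Flag T, Cardinal.mk (c : Set T) < κ) :
    Cardinal.mk (support b) < κ := by
  obtain ⟨c, hc⟩ := (isChain_support (b := b)).exists_subset_flag
  exact (Cardinal.mk_le_mk_of_subset hc).trans_lt (h c)

end Flag

end Thread

end Thread

end KappaTopos

namespace KappaTopos

/-! ### Diagrams defined by functional relations -/

section DiagOfRel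

variable {C : Type u} [Category.{v} C] {T : Type w} [Preorder T] (obj : T → C)
  (rel : ∀ s t, (obj t ⟶ obj s) → Prop)
  (ex : ∀ s t, s ≤ t → ∃ f, rel s t f)
  (uniq : ∀ s t f g, rel s t f → rel s t g → f = g)
  (id_rel : ∀ s, rel s s (𝟙 _))
  (comp_rel : ∀ r s t f g, rel r s f → rel s t g → rel r t (g ≫ f))

/-- A diagram on the opposite of a preorder whose arrows are described by a functional
relation. -/
noncomputable abbrev diagOfRel : Tᵒᵖ ⥤ C where
  obj t := obj t.unop
  map f := (ex _ _ (leOfHom f.unop)).choose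
  map_id t := uniq _ _ _ _ (ex _ _ (leOfHom (𝟙 t).unop)).choose_spec (id_rel _)
  map_comp f g := uniq _ _ _ _ (ex _ _ (leOfHom (f ≫ g).unop)).choose_spec
    (comp_rel _ _ _ _ _ (ex _ _ (leOfHom g.unop)).choose_spec
      (ex _ _ (leOfHom f.unop)).choose_spec)

theorem diagOfRel_map {s t : T} (h : s ≤ t) {f : obj t ⟶ obj s} (hf : rel s t f) :
    (diagOfRel obj rel ex uniq id_rel comp_rel).map (homOfLE h).op = f :=
  uniq _ _ _ _ (ex _ _ h).choose_spec hf

end DiagOfRel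

/-! ### The tree operation up to isomorphism -/

section WeakTree

variable {C : Type u} [Category.{v} C]

theorem Cotree.IsContinuous.mono {κ : Cardinal.{w}} {E E' : Precoverage C} (h : E ≤ E')
    {τ : Cotree.{w} C} (hτ : τ.IsContinuous κ E) : τ.IsContinuous κ E' where
  predecessors_mem t ht := h _ (hτ.predecessors_mem t ht)
  branch_lt := hτ.branch_lt
  isLimit := hτ.isLimit

theorem treeClosure_mono {κ : Cardinal.{w}} {E E' : Precoverage C} (h : E ≤ E') :
    treeClosure κ E ≤ treeClosure κ E' := by
  rintro _ _ ⟨τ, hτ, c⟩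
  exact ⟨τ, hτ.mono h, c⟩

/-- The same tree with another diagram. -/
abbrev Cotree.withDiag (τ : Cotree.{w} C) (D : τ.Tᵒᵖ ⥤ C) : Cotree.{w} C :=
  { τ with diag := D }

/-- Conjugating the predecessors of a vertex by isomorphisms amounts to pulling them back along an
isomorphism, so pullback stability keeps them in `E`. -/
theorem Cotree.isContinuous_copyObj {κ : Cardinal.{w}} {E : Precoverage C}
    (hE : pbClosure E ≤ E) {τ : Cotree.{w} C} (hτ : τ.IsContinuous κ E) (G : τ.Tᵒᵖ → C)
    (e : ∀ t, τ.diag.obj t ≅ G t) :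
    (τ.withDiag (τ.diag.copyObj G e)).IsContinuous κ E where
  predecessors_mem t ht := by
    have H (s : τ.T) (h : t ≤ s) : IsPullback ((e (op s)).inv ≫ τ.map h ≫ (e (op t)).hom)
        (e (op s)).inv (e (op t)).inv (τ.map h) := IsPullback.of_vert_isIso ⟨by simp⟩
    refine hE _ ⟨_, (e (op t)).inv, _, hτ.predecessors_mem t ht, ?_, ?_⟩
    · rintro _ _ ⟨s⟩
      exact ⟨_, _, (e (op s.1)).inv, ⟨s⟩, H _ s.2.le⟩
    · rintro _ _ ⟨s⟩
      exact ⟨_, _, (e (op s.1)).inv, ⟨s⟩, H _ s.2.le⟩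
  branch_lt := hτ.branch_lt
  isLimit t ht := by
    rw [nonempty_isLimit_coneIio_iff]
    have := (τ.nonempty_isLimit_coneIio_iff t).1 (hτ.isLimit t ht)
    refine (this.of_iso (e (op t)).symm).transport (fun a _ => a) (fun _ h => h)
      (fun _ _ _ _ h => h) (fun _ _ _ _ h => h) (fun a ha => ⟨a, ha, rfl⟩)
      (fun a _ => (e (op a)).symm) ?_ ?_
    · intro a b ha hb hab
      simp [Functor.copyObj]
    · intro a ha
      simp [Functor.copyObj, Cotree.map]

/-- The weak form of the `κ`-tree operation, where the legs are determined only up to isomorphism: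
the limits of the branches are computed by possibly several cones. -/
def IsWeakTree (κ : Cardinal.{w}) (E : Precoverage C) (X : C) (R : Presieve X) : Prop :=
  ∃ (τ : Cotree.{w} C) (e : τ.root ≅ X), τ.IsContinuous κ E ∧
    (∀ ⦃Y : C⦄ (f : Y ⟶ X), R f → ∃ (b : τ.LiveBranch) (p : ∀ a, a ∈ b.1 → (Y ⟶ τ.obj a)),
      LimOn τ.diag (b.1 : Set τ.T) p ∧ p ⊥ b.1.bot_mem ≫ e.hom = f) ∧
    (∀ b : τ.LiveBranch, ∃ (Y : C) (p : ∀ a, a ∈ b.1 → (Y ⟶ τ.obj a)),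
      LimOn τ.diag (b.1 : Set τ.T) p ∧ R (p ⊥ b.1.bot_mem ≫ e.hom))

/-- The closure under the weak tree operation. -/
def weakTree (κ : Cardinal.{w}) (E : Precoverage C) : Precoverage C where
  coverings X := {R | IsWeakTree κ E X R}

theorem treeClosure_le_weakTree (κ : Cardinal.{w}) (E : Precoverage C) :
    treeClosure κ E ≤ weakTree κ E := by
  rintro _ _ ⟨τ, hτ, c⟩
  refine ⟨τ, Iso.refl _, hτ, ?_, fun b => ⟨_, _, τ.limOn_of_isLimit (c b).isLimit, ?_⟩⟩
  · rintro _ _ ⟨b⟩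
    exact ⟨b, _, τ.limOn_of_isLimit (c b).isLimit, Category.comp_id _⟩
  · have : τ.cocompositionFamily c (τ.cocomposition b (c b).cone) := ⟨b⟩
    convert this using 1
    exact Category.comp_id _

/-- The limit cones in the tree operation are arbitrary, so prescribed limits of the branches may be
used; `eqToHom` allows for a root object that is only propositionally equal to `X`. -/
theorem mem_treeClosure_of_eq {κ : Cardinal.{w}} {E : Precoverage C} (τ : Cotree.{w} C)
    (hτ : τ.IsContinuous κ E) {X : C} (h : τ.root = X) (Y : τ.LiveBranch → C)
    (p : ∀ b : τ.LiveBranch, ∀ a, a ∈ b.1 → (Y b ⟶ τ.obj a))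
    (hp : ∀ b, LimOn τ.diag (b.1 : Set τ.T) (p b)) :
    Presieve.ofArrows Y (fun b => p b ⊥ b.1.bot_mem ≫ eqToHom h) ∈ treeClosure κ E X := by
  subst h
  simp only [eqToHom_refl, Category.comp_id]
  exact IsTreeFamily.mk τ hτ (fun b => ⟨τ.coneOn (hp b), τ.isLimitConeOn (hp b)⟩)

-- A tree family lives on the root object itself, so an isomorphic `X` has to be installed there:
-- the diagram `G` differs from that of `τ` only at the root.
open Classical in
theorem mem_treeClosure_of_iso {κ : Cardinal.{w}} {E : Precoverage C} (hE : pbClosure E ≤ E)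
    (τ : Cotree.{w} C) (hτ : τ.IsContinuous κ E) {X : C} (e : τ.root ≅ X) (Y : τ.LiveBranch → C)
    (p : ∀ b : τ.LiveBranch, ∀ a, a ∈ b.1 → (Y b ⟶ τ.obj a))
    (hp : ∀ b, LimOn τ.diag (b.1 : Set τ.T) (p b)) :
    Presieve.ofArrows Y (fun b => p b ⊥ b.1.bot_mem ≫ e.hom) ∈ treeClosure κ E X := by
  let G : τ.Tᵒᵖ → C := fun t => if t.unop = ⊥ then X else τ.diag.obj t
  have hG (t : τ.Tᵒᵖ) (ht : t.unop = ⊥) : G t = X := if_pos ht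
  have hG' (t : τ.Tᵒᵖ) (ht : ¬ t.unop = ⊥) : G t = τ.diag.obj t := if_neg ht
  let i (t : τ.Tᵒᵖ) : τ.diag.obj t ≅ G t :=
    if ht : t.unop = ⊥ then
      (eqToIso (congr_arg (fun s => τ.obj s) ht) : _ ≅ τ.root) ≪≫ e ≪≫ eqToIso (hG t ht).symm
    else eqToIso (hG' t ht).symm
  have hi : (i (op ⊥)).hom ≫ eqToHom (hG (op ⊥) rfl) = e.hom := by
    simp [i]
  have := mem_treeClosure_of_eq _ (Cotree.isContinuous_copyObj hE hτ G i) (X := X)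
    (hG (op ⊥) rfl) Y (fun b a ha => p b a ha ≫ (i (op a)).hom) (fun b => by
      refine (hp b).transport (fun a _ => a) (fun _ h => h)
        (fun _ _ _ _ h => h) (fun _ _ _ _ h => h) (fun a ha => ⟨a, ha, rfl⟩)
        (fun a _ => (i (op a)).symm) ?_ ?_
      · intro a b ha hb hab
        simp [Functor.copyObj]
      · intro a ha
        exact (Category.assoc _ _ _).trans ((congr_arg _ (Iso.hom_inv_id _)).trans
          (Category.comp_id _)))
  have h (b : τ.LiveBranch) : (p b ⊥ b.1.bot_mem ≫ (i (op ⊥)).hom) ≫ eqToHom (hG (op ⊥) rfl) =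
      p b ⊥ b.1.bot_mem ≫ e.hom := by
    rw [Category.assoc, hi]
  exact (congr_arg (Presieve.ofArrows Y) (funext h)) ▸ this

end WeakTree

/-! ### The one-vertex cotree -/

section Trivial

variable {C : Type u} [Category.{v} C]

/-- The cotree with one vertex. -/
def Cotree.single (X : C) : Cotree.{w} C where
  T := PUnit
  isChain_Iic _ := Set.subsingleton_of_subsingleton.isChain
  diag := (Functor.const _).obj X
  leaf := Set.univ
  isMax_of_mem_leaf _ _ _ _ := le_rfl

theorem Cotree.isContinuous_single {κ : Cardinal.{w}} (hκ : κ.IsRegular) (E : Precoverage C)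
    (X : C) : (Cotree.single.{w} X).IsContinuous κ E where
  predecessors_mem t ht := (ht (Set.mem_univ _)).elim
  branch_lt b := (Cardinal.mk_le_of_injective (f := fun _ => PUnit.unit)
    (fun a a' _ => Subtype.ext (show (a.1 : PUnit) = a'.1 from Subsingleton.elim _ _))).trans_lt (by
      rw [Cardinal.mk_punit]
      exact Cardinal.one_lt_aleph0.trans_le hκ.aleph0_le)
  isLimit t ht := (ht.1 fun _ _ => le_rfl).elim

/-- Needs nothing from `E`, as the only vertex is a leaf. It lets any weak tree family be seen as a
tree family of weak tree families. -/
theorem singleton_id_mem_weakTree {κ : Cardinal.{w}} (hκ : κ.IsRegular) (E : Precoverage C)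
    (X : C) : Presieve.singleton (𝟙 X) ∈ weakTree κ E X := by
  have hlim (b : (Cotree.single.{w} X).LiveBranch) : LimOn (Cotree.single.{w} X).diag
      (b.1 : Set (Cotree.single.{w} X).T) (fun _ _ => 𝟙 X) := by
    have : IsIso ((fun (a : (Cotree.single.{w} X).T) (_ : a ∈ b.1) => 𝟙 X) ⊥ b.1.bot_mem) :=
      ⟨𝟙 X, Category.comp_id (𝟙 X), Category.comp_id (𝟙 X)⟩
    exact LimOn.of_isGreatest ⟨b.1.bot_mem, fun _ _ => le_rfl⟩ _
      (fun _ _ _ _ _ => Category.comp_id _) this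
  refine ⟨Cotree.single X, Iso.refl _, Cotree.isContinuous_single hκ E X, ?_, fun b => ?_⟩
  · rintro _ _ ⟨⟩
    refine ⟨⟨TreeOrder.flagIic (T := (Cotree.single.{w} X).T) ⊥ fun _ _ => le_rfl,
      fun _ _ _ => Set.mem_univ _⟩, _, hlim _, ?_⟩
    exact Category.comp_id _
  · refine ⟨X, _, hlim b, ?_⟩
    have : Presieve.singleton (𝟙 X) (𝟙 X ≫ (Iso.refl X).hom) := by
      rw [Iso.refl_hom, Category.comp_id]
      exact ⟨⟩
    exact this

end Trivial

end KappaTopos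

/-! ### Grafting cotrees: the underlying tree and its arrows -/

namespace KappaTopos

variable {C : Type u} [Category.{v} C]

/-- The data used in order to graft cotrees on the vertices of the cotree `τ`: for each vertex `t`
a cotree `sub t` with the same object at the root, whose live branches correspond to the immediate
successors of `t`, the objects at these successors being limits of the branches. -/
structure Grafting (κ : Cardinal.{w}) (E : Precoverage C) (τ : Cotree.{w} C) where
  /-- the grafted cotrees -/
  sub : τ.T → Cotree.{w} C
  cont : ∀ t, (sub t).IsContinuous κ E
  /-- the comparison of the objects at the roots -/
  e : ∀ t, (sub t).root ≅ τ.obj t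
  /-- the branch which corresponds to a successor -/
  br : ∀ {t s : τ.T}, t ⋖ s → (sub t).LiveBranch
  /-- the projections from the object at a successor to the objects in the branch -/
  p : ∀ {t s : τ.T} (h : t ⋖ s) (x : (sub t).T), x ∈ (br h).1 → (τ.obj s ⟶ (sub t).obj x)
  lim : ∀ {t s : τ.T} (h : t ⋖ s), LimOn (sub t).diag ((br h).1 : Set (sub t).T) (p h)
  p_bot : ∀ {t s : τ.T} (h : t ⋖ s), p h ⊥ (br h).1.bot_mem ≫ (e t).hom = τ.map h.le
  -- Injectivity is not demanded: several successors may share a branch, since families do not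
  -- record multiplicities.
  surj : ∀ t ∉ τ.leaf, ∀ b : (sub t).LiveBranch, ∃ s, ∃ h : t ⋖ s, br h = b
  -- Over a leaf the grafted tree is a point, so that leaves remain maximal.
  eq_bot : ∀ t ∈ τ.leaf, ∀ x : (sub t).T, x = ⊥

namespace Grafting

variable {κ : Cardinal.{w}} {E : Precoverage C} {τ : Cotree.{w} C} (g : Grafting κ E τ)

/-- The vertices of the grafted tree. -/
structure Vertex : Type w where
  /-- the vertex of the basic tree -/
  base : τ.T
  /-- the vertex of the tree grafted on it -/
  top : (g.sub base).T

/-- The order of the grafted tree. -/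
inductive Le : g.Vertex → g.Vertex → Prop
  | same {t : τ.T} {x y : (g.sub t).T} (h : x ≤ y) : Le ⟨t, x⟩ ⟨t, y⟩
  | step {t s t' : τ.T} (h : t ⋖ s) (h' : s ≤ t') {x : (g.sub t).T} (hx : x ∈ (g.br h).1)
      (y : (g.sub t').T) : Le ⟨t, x⟩ ⟨t', y⟩

variable {g}

theorem Le.base_le {a b : g.Vertex} (h : g.Le a b) : a.base ≤ b.base := by
  cases h with
  | same h => exact le_rfl
  | step h h' hx y => exact h.le.trans h'

theorem Le.top_le {t : τ.T} {x y : (g.sub t).T} (h : g.Le ⟨t, x⟩ ⟨t, y⟩) : x ≤ y := by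
  cases h with
  | same h => exact h
  | step h h' hx y => exact (h.lt.not_ge h').elim

theorem Le.mem_br {t s t' : τ.T} {x : (g.sub t).T} {y : (g.sub t').T}
    (h : g.Le ⟨t, x⟩ ⟨t', y⟩) (hs : t ⋖ s) (hs' : s ≤ t') : x ∈ (g.br hs).1 := by
  cases h with
  | same h => exact (hs.lt.not_ge hs').elim
  | step h h' hx y =>
    obtain rfl := TreeOrder.covBy_right_unique h hs h' hs'
    exact hx

instance : PartialOrder g.Vertex where
  le := g.Le
  le_refl _ := Le.same le_rfl
  le_trans a b c h h' := by
    cases h with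
    | same h =>
      cases h' with
      | same h' => exact Le.same (h.trans h')
      | step hs hs' hx y => exact Le.step hs hs' (TreeOrder.mem_flag_of_le _ hx h) y
    | step h₁ h₂ hx y =>
      cases h' with
      | same h' => exact Le.step h₁ h₂ hx _
      | step hs hs' hx' y => exact Le.step h₁ (h₂.trans (hs.le.trans hs')) hx _
  le_antisymm a b h h' := by
    cases h with
    | same h => exact congr_arg _ (le_antisymm h h'.top_le)
    | step h₁ h₂ hx y => exact (h₁.lt.not_ge (h₂.trans h'.base_le)).elim

theorem base_mono {a b : g.Vertex} (h : a ≤ b) : a.base ≤ b.base := Le.base_le h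

theorem mk_le_mk {t : τ.T} {x y : (g.sub t).T} : (⟨t, x⟩ : g.Vertex) ≤ ⟨t, y⟩ ↔ x ≤ y :=
  ⟨fun h => Le.top_le h, fun h => Le.same h⟩

theorem mk_lt_mk {t : τ.T} {x y : (g.sub t).T} : (⟨t, x⟩ : g.Vertex) < ⟨t, y⟩ ↔ x < y := by
  rw [lt_iff_le_not_ge, lt_iff_le_not_ge, mk_le_mk, mk_le_mk]

theorem le_of_mem_br {t s t' : τ.T} (h : t ⋖ s) (h' : s ≤ t') {x : (g.sub t).T}
    (hx : x ∈ (g.br h).1) (y : (g.sub t').T) : (⟨t, x⟩ : g.Vertex) ≤ ⟨t', y⟩ := Le.step h h' hx y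

theorem bot_le_bot {t t' : τ.T} (h : t ≤ t') (y : (g.sub t').T) :
    (⟨t, ⊥⟩ : g.Vertex) ≤ ⟨t', y⟩ := by
  rcases h.eq_or_lt with rfl | h
  · exact Le.same bot_le
  · obtain ⟨s, hs, hs'⟩ := TreeOrder.exists_covBy_le h
    exact Le.step hs hs' (g.br hs).1.bot_mem _

instance : OrderBot g.Vertex where
  bot := ⟨⊥, ⊥⟩
  bot_le _ := bot_le_bot bot_le _

/-- Lexicographic induction: on the base vertex, then inside the tree grafted there. -/
theorem acc (t : τ.T) : ∀ x : (g.sub t).T, Acc (fun a b : g.Vertex => a < b) ⟨t, x⟩ := by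
  induction t using (wellFounded_lt (α := τ.T)).induction with | _ t ht
  intro x
  induction x using (wellFounded_lt (α := (g.sub t).T)).induction with | _ x hx
  refine Acc.intro _ fun a ha => ?_
  obtain ⟨t', y⟩ := a
  cases (show g.Le ⟨t', y⟩ ⟨t, x⟩ from ha.le) with
  | same _ => exact hx _ (mk_lt_mk.1 ha)
  | step h₁ h₂ _ _ => exact ht _ (h₁.lt.trans_le h₂) _

instance : WellFoundedLT g.Vertex := ⟨⟨fun a => acc a.base a.top⟩⟩

/-- A vertex below `c` whose base is strictly below that of `c` lies on the one branch leading
towards `c`, and this makes it comparable with the other vertices below `c`. -/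
theorem total_of_le {a b c : g.Vertex} (h : a ≤ c) (h' : b ≤ c) : a ≤ b ∨ b ≤ a := by
  rcases TreeOrder.total (base_mono h) (base_mono h') with h₁ | h₁
  · rcases h₁.eq_or_lt with h₂ | h₂
    · obtain ⟨t, x⟩ := a
      obtain ⟨t', y⟩ := b
      obtain rfl : t = t' := h₂
      cases (show g.Le _ _ from h) with
      | same h₃ =>
        exact (TreeOrder.total h₃ (Le.top_le h')).imp mk_le_mk.2 mk_le_mk.2
      | step hs hs' hx z =>
        exact ((g.br hs).1.le_or_le hx (Le.mem_br h' hs hs')).imp mk_le_mk.2 mk_le_mk.2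
    · obtain ⟨s, hs, hs'⟩ := TreeOrder.exists_covBy_le h₂
      exact Or.inl (Le.step hs hs' (Le.mem_br h hs (hs'.trans (base_mono h'))) _)
  · rcases h₁.eq_or_lt with h₂ | h₂
    · obtain ⟨t', y⟩ := a
      obtain ⟨t, x⟩ := b
      obtain rfl : t = t' := h₂
      cases (show g.Le _ _ from h) with
      | same h₃ =>
        exact (TreeOrder.total h₃ (Le.top_le h')).imp mk_le_mk.2 mk_le_mk.2
      | step hs hs' hx z =>
        exact ((g.br hs).1.le_or_le hx (Le.mem_br h' hs hs')).imp mk_le_mk.2 mk_le_mk.2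
    · obtain ⟨s, hs, hs'⟩ := TreeOrder.exists_covBy_le h₂
      exact Or.inr (Le.step hs hs' (Le.mem_br h' hs (hs'.trans (base_mono h))) _)

instance : TreeOrder g.Vertex where
  wellFounded := inferInstance
  isChain_Iic _ _ ha _ hb _ := total_of_le ha hb

variable (g)

/-- The objects at the vertices of the grafted cotree. -/
abbrev vobj (a : g.Vertex) : C := (g.sub a.base).obj a.top

/-- The arrow from an object above a successor. -/
abbrev stepMap {t s t' : τ.T} (h : t ⋖ s) (h' : s ≤ t') {x : (g.sub t).T} (hx : x ∈ (g.br h).1)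
    (y : (g.sub t').T) : (g.sub t').obj y ⟶ (g.sub t).obj x :=
  (g.sub t').map bot_le ≫ (g.e t').hom ≫ τ.map h' ≫ g.p h x hx

/-- The arrows of the grafted cotree. -/
inductive Arr : ∀ a b : g.Vertex, (g.vobj b ⟶ g.vobj a) → Prop
  | same {t : τ.T} {x y : (g.sub t).T} (h : x ≤ y) : Arr ⟨t, x⟩ ⟨t, y⟩ ((g.sub t).map h)
  | step {t s t' : τ.T} (h : t ⋖ s) (h' : s ≤ t') {x : (g.sub t).T} (hx : x ∈ (g.br h).1)
      (y : (g.sub t').T) : Arr ⟨t, x⟩ ⟨t', y⟩ (g.stepMap h h' hx y)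

theorem Arr.exists_of_le (a b : g.Vertex) (h : a ≤ b) : ∃ f, g.Arr a b f := by
  cases (show g.Le a b from h) with
  | same h₁ => exact ⟨_, Arr.same h₁⟩
  | step h₁ h₂ hx y => exact ⟨_, Arr.step h₁ h₂ hx y⟩

theorem Arr.unique (a b : g.Vertex) (f f' : g.vobj b ⟶ g.vobj a) (h : g.Arr a b f)
    (h' : g.Arr a b f') : f = f' := by
  cases h with
  | same h =>
    cases h' with
    | same h' => rfl
    | step h₁ h₂ hx y => exact (h₁.lt.not_ge h₂).elim
  | step h₁ h₂ hx y =>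
    cases h' with
    | same h => exact (h₁.lt.not_ge h₂).elim
    | step h₁' h₂' hx' y' =>
      obtain rfl := TreeOrder.covBy_right_unique h₁ h₁' h₂ h₂'
      rfl

theorem Arr.id (a : g.Vertex) : g.Arr a a (𝟙 _) := by
  have : (g.sub a.base).map (le_refl a.top) = 𝟙 _ := (g.sub a.base).diag.map_id _
  rw [← this]
  exact Arr.same le_rfl

theorem p_comp_map {t s : τ.T} (h : t ⋖ s) {x y : (g.sub t).T} (hxy : x ≤ y)
    (hy : y ∈ (g.br h).1) : g.p h y hy ≫ (g.sub t).map hxy =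
      g.p h x (TreeOrder.mem_flag_of_le _ hy hxy) :=
  (g.lim h).comp_map _ _ _ _ _

theorem p_comp_map_bot {t s : τ.T} (h : t ⋖ s) {y : (g.sub t).T}
    (hy : y ∈ (g.br h).1) : g.p h y hy ≫ (g.sub t).map bot_le ≫ (g.e t).hom = τ.map h.le := by
  rw [← Category.assoc, p_comp_map, p_bot]

theorem _root_.KappaTopos.Cotree.map_comp_map (τ : Cotree.{w} C) {r s t : τ.T} (h : r ≤ s)
    (h' : s ≤ t) : τ.map h' ≫ τ.map h = τ.map (h.trans h') := by
  rw [← Functor.map_comp]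
  rfl

theorem Arr.comp (a b c : g.Vertex) (f : g.vobj b ⟶ g.vobj a) (f' : g.vobj c ⟶ g.vobj b)
    (h : g.Arr a b f) (h' : g.Arr b c f') : g.Arr a c (f' ≫ f) := by
  cases h with
  | same h =>
    cases h' with
    | same h' =>
      rw [Cotree.map_comp_map]
      exact Arr.same _
    | step h₁ h₂ hx y =>
      have := Arr.step h₁ h₂ (TreeOrder.mem_flag_of_le _ hx h) y
      simpa only [stepMap, Category.assoc, p_comp_map] using this
  | step h₁ h₂ hx y =>
    cases h' with
    | same h' =>
      simp only [stepMap]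
      rw [← Category.assoc, Cotree.map_comp_map]
      exact Arr.step h₁ h₂ hx _
    | step h₁' h₂' hx' y' =>
      -- A path crossing the tree grafted on an intermediate vertex descends to the root of that
      -- tree, where `p_bot` turns the composite back into an arrow of `τ`.
      have h₃ : τ.map h₂' ≫ τ.map h₁'.le ≫ τ.map h₂ = τ.map (h₂.trans (h₁'.le.trans h₂')) := by
        rw [Cotree.map_comp_map, Cotree.map_comp_map]
      have h₄ : g.stepMap h₁' h₂' hx' y' ≫ g.stepMap h₁ h₂ hx y =
          g.stepMap h₁ (h₂.trans (h₁'.le.trans h₂')) hx y' := by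
        simp only [stepMap, Category.assoc]
        rw [← h₃, ← g.p_comp_map_bot h₁' hx']
        simp only [Category.assoc]
      rw [h₄]
      exact Arr.step _ _ _ _

end Grafting

end KappaTopos

/-! ### The grafted cotree: predecessors and limit vertices -/

namespace KappaTopos

variable {C : Type u} [Category.{v} C]

namespace Grafting

variable {κ : Cardinal.{w}} {E : Precoverage C} {τ : Cotree.{w} C} (g : Grafting κ E τ)

/-- The diagram of the grafted cotree. -/
noncomputable abbrev diag : g.Vertexᵒᵖ ⥤ C :=
  diagOfRel g.vobj g.Arr (Arr.exists_of_le g) (Arr.unique g) (Arr.id g) (Arr.comp g)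

variable {g} in
theorem isMax_of_mem_leaf {a : g.Vertex} (h : a.base ∈ τ.leaf) : IsMax a := by
  intro b hb
  cases (show g.Le a b from hb) with
  | same h₁ => exact (mk_le_mk.2 ((g.eq_bot _ h _).trans (g.eq_bot _ h _).symm).le)
  | step h₁ h₂ hx y => exact (h₁.lt.not_ge (τ.isMax_of_mem_leaf _ h h₁.le)).elim

/-- The grafted cotree. -/
noncomputable abbrev cotree : Cotree.{w} C where
  T := g.Vertex
  isChain_Iic := TreeOrder.isChain_Iic
  diag := g.diag
  leaf := {a | a.base ∈ τ.leaf}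
  isMax_of_mem_leaf _ h := isMax_of_mem_leaf h

theorem diag_map_same {t : τ.T} {x y : (g.sub t).T} (h : x ≤ y) :
    g.diag.map (homOfLE (mk_le_mk.2 h)).op = (g.sub t).map h :=
  diagOfRel_map g.vobj g.Arr (Arr.exists_of_le g) (Arr.unique g) (Arr.id g) (Arr.comp g)
    (mk_le_mk.2 h) (Arr.same h)

theorem diag_map_step {t s t' : τ.T} (h : t ⋖ s) (h' : s ≤ t') {x : (g.sub t).T}
    (hx : x ∈ (g.br h).1) (y : (g.sub t').T) :
    g.diag.map (homOfLE (le_of_mem_br h h' hx y)).op = g.stepMap h h' hx y :=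
  diagOfRel_map g.vobj g.Arr (Arr.exists_of_le g) (Arr.unique g) (Arr.id g) (Arr.comp g)
    (le_of_mem_br h h' hx y) (Arr.step h h' hx y)

/-- Because of this, the roots of the grafted trees form a copy of `τ` inside the grafted cotree,
through which limits can be computed. -/
theorem diag_map_bot {t t' : τ.T} (h : t ≤ t') :
    g.diag.map (homOfLE (bot_le_bot h (⊥ : (g.sub t').T))).op ≫ (g.e t).hom =
      (g.e t').hom ≫ τ.map h := by
  rcases h.eq_or_lt with rfl | h'
  · rw [show τ.map h = 𝟙 _ from τ.diag.map_id _, Category.comp_id]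
    refine (congr_arg (· ≫ (g.e t).hom) (g.diag.map_id (op ⟨t, ⊥⟩))).trans (Category.id_comp _)
  · obtain ⟨s, hs, hs'⟩ := TreeOrder.exists_covBy_le h'
    have h₁ := g.diag_map_step hs hs' (g.br hs).1.bot_mem (⊥ : (g.sub t').T)
    have h₂ : (g.sub t').map (le_refl ⊥) = 𝟙 _ := (g.sub t').diag.map_id _
    rw [h₁, stepMap]
    simp only [Category.assoc, g.p_bot hs, Cotree.map_comp_map]
    rw [h₂, Category.id_comp]

section Covers

variable {g}

theorem mem_br_of_le {t s : τ.T} {x : (g.sub t).T} {b : g.Vertex} (h : (⟨t, x⟩ : g.Vertex) ≤ b)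
    (hs : t ⋖ s) (hs' : s ≤ b.base) : x ∈ (g.br hs).1 := Le.mem_br h hs hs'

theorem covBy_same {t : τ.T} {x y : (g.sub t).T} (h : x ⋖ y) :
    (⟨t, x⟩ : g.Vertex) ⋖ ⟨t, y⟩ := by
  refine ⟨mk_lt_mk.2 h.lt, fun c hc hc' => ?_⟩
  obtain ⟨t', z⟩ := c
  obtain rfl : t = t' := le_antisymm (base_mono hc.le) (base_mono hc'.le)
  exact h.2 (mk_lt_mk.1 hc) (mk_lt_mk.1 hc')

theorem lt_of_mem_br {t s t' : τ.T} (h : t ⋖ s) (h' : s ≤ t') {x : (g.sub t).T}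
    (hx : x ∈ (g.br h).1) (y : (g.sub t').T) : (⟨t, x⟩ : g.Vertex) < ⟨t', y⟩ :=
  (le_of_mem_br h h' hx y).lt_of_ne fun h'' =>
    (h.lt.trans_le h').ne (congr_arg Vertex.base h'')

theorem covBy_step {t s : τ.T} (h : t ⋖ s) {x : (g.sub t).T} (hx : x ∈ (g.br h).1)
    (hm : IsMax x) : (⟨t, x⟩ : g.Vertex) ⋖ ⟨s, ⊥⟩ := by
  refine ⟨lt_of_mem_br h le_rfl hx _, fun c hc hc' => ?_⟩
  obtain ⟨t', z⟩ := c
  rcases (base_mono hc.le).eq_or_lt with h₁ | h₁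
  · obtain rfl : t = t' := h₁
    exact hm.not_lt (mk_lt_mk.1 hc)
  · rcases (base_mono hc'.le).eq_or_lt with h₂ | h₂
    · obtain rfl : t' = s := h₂
      exact not_lt_bot (mk_lt_mk.1 hc')
    · exact h.2 h₁ h₂

/-- A jump to another grafted tree starts at the last vertex of a branch, since later vertices of
that branch would come in between, and lands on a root, since the root lies below the rest of its
tree. -/
theorem covBy_cases {t : τ.T} {x : (g.sub t).T} {c : g.Vertex} (h : (⟨t, x⟩ : g.Vertex) ⋖ c) :
    (∃ y, x ⋖ y ∧ c = ⟨t, y⟩) ∨ ∃ s, ∃ hs : t ⋖ s, x ∈ (g.br hs).1 ∧ IsMax x ∧ c = ⟨s, ⊥⟩ := by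
  obtain ⟨t', z⟩ := c
  rcases (base_mono h.le).eq_or_lt with h₁ | h₁
  · obtain rfl : t = t' := h₁
    exact Or.inl ⟨z, ⟨mk_lt_mk.1 h.lt, fun y hy hy' => h.2 (mk_lt_mk.2 hy) (mk_lt_mk.2 hy')⟩, rfl⟩
  · obtain ⟨s, hs, hs'⟩ := TreeOrder.exists_covBy_le h₁
    have hx := Le.mem_br h.le hs hs'
    refine Or.inr ⟨s, hs, hx, ?_, ?_⟩
    · refine TreeOrder.isMax_of_isMax_flag _ hx fun y hy => ?_
      by_contra hxy
      have hxy' : x < y := ((g.br hs).1.le_or_le hx hy).elim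
        (fun h => h.lt_of_not_ge hxy) (fun h => (hxy h).elim)
      exact h.2 (mk_lt_mk.2 hxy') (lt_of_mem_br hs hs' hy _)
    · by_contra hne
      refine h.2 (lt_of_mem_br hs le_rfl hx ⊥) (lt_of_le_of_ne (bot_le_bot hs' _) (Ne.symm hne))

end Covers

/-- Jumping out of the grafted tree at `x` would make `x` the last vertex of a live branch, hence a
leaf. -/
theorem predecessors_of_notMem {t : τ.T} {x : (g.sub t).T} (hx : x ∉ (g.sub t).leaf) :
    g.cotree.predecessors ⟨t, x⟩ = (g.sub t).predecessors x := by
  refine le_antisymm ?_ ?_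
  · rintro _ _ ⟨⟨c, hc⟩⟩
    rcases covBy_cases hc with ⟨y, hy, rfl⟩ | ⟨s, hs, hx', hm, rfl⟩
    · have : g.cotree.map hc.le = (g.sub t).map hy.le := g.diag_map_same hy.le
      change (g.sub t).predecessors x (g.cotree.map hc.le)
      rw [this]
      exact ⟨(⟨y, hy⟩ : {y // x ⋖ y})⟩
    · exact (hx ((g.br hs).2 _ hx' hm)).elim
  · rintro _ _ ⟨⟨y, hy⟩⟩
    have : g.cotree.map (covBy_same hy).le = (g.sub t).map hy.le := g.diag_map_same hy.le
    change g.cotree.predecessors ⟨t, x⟩ ((g.sub t).map hy.le)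
    rw [← this]
    exact ⟨(⟨_, covBy_same hy⟩ : {c : g.Vertex // ⟨t, x⟩ ⋖ c})⟩

/-- A branch ending at `x` has the object at `x` as its limit, and so is the object at any successor
to which this branch leads; the connecting arrows are therefore invertible. There is at least one
because every live branch leads to some successor. Such vertices are the reason why `E` must contain
the nonempty families of isomorphisms. -/
theorem predecessors_of_mem {t : τ.T} (ht : t ∉ τ.leaf) {x : (g.sub t).T}
    (hx : x ∈ (g.sub t).leaf) :
    (∃ Y f, g.cotree.predecessors ⟨t, x⟩ (Y := Y) f) ∧
      ∀ Y f, g.cotree.predecessors ⟨t, x⟩ (Y := Y) f → IsIso f := by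
  have hm := (g.sub t).isMax_of_mem_leaf _ hx
  constructor
  · obtain ⟨s, hs, hbr⟩ := g.surj t ht ⟨TreeOrder.flagIic x hm, fun y hy hy' => by
      rwa [← hy'.eq_of_le hy] at hx⟩
    have : x ∈ (g.br hs).1 := by
      rw [hbr]
      exact (TreeOrder.mem_flagIic hm).2 le_rfl
    exact ⟨_, _, ⟨⟨_, covBy_step hs this hm⟩⟩⟩
  · rintro _ _ ⟨⟨c, hc⟩⟩
    rcases covBy_cases hc with ⟨y, hy, rfl⟩ | ⟨s, hs, hx', -, rfl⟩
    · exact (hm.not_lt hy.lt).elim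
    · have h₁ : g.cotree.map hc.le = g.stepMap hs le_rfl hx' ⊥ := g.diag_map_step hs le_rfl hx' ⊥
      have h₂ : IsIso (g.p hs x hx') := (g.lim hs).isIso_of_isGreatest
        ⟨hx', fun y hy => ((g.br hs).1.le_or_le hx' hy).elim (fun h => hm h) id⟩
      have h₃ : τ.map (le_refl s) = 𝟙 _ := τ.diag.map_id _
      have h₄ : (g.sub s).map (le_refl ⊥) = 𝟙 _ := (g.sub s).diag.map_id _
      have h₅ : g.stepMap hs le_rfl hx' ⊥ = (g.e s).hom ≫ g.p hs x hx' := by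
        rw [stepMap, h₃, h₄, Category.id_comp, Category.id_comp]
      change IsIso (g.cotree.map hc.le)
      rw [h₁, h₅]
      infer_instance

/-- A limit vertex is either the root over a successor in `τ`, the root over a limit vertex of `τ`,
or a limit vertex inside a grafted tree. Cofinal among the lower vertices are, respectively, the
branch leading to the successor, the lower roots, and the lower vertices of the same grafted tree;
over each of these the limit is known. -/
theorem limOn_Iio
    (hτ : ∀ t : τ.T, Order.IsSuccLimit t → Nonempty (IsLimit (τ.coneIio t))) (a : g.Vertex)
    (ha : Order.IsSuccLimit a) :
    LimOn g.diag (Set.Iio a) (fun b hb => g.diag.map (homOfLE (le_of_lt hb)).op) := by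
  have hcomp : ∀ b c (hb : b ∈ Set.Iio a) (hc : c ∈ Set.Iio a) (h : b ≤ c),
      g.diag.map (homOfLE (le_of_lt hc)).op ≫ g.diag.map (homOfLE h).op =
        g.diag.map (homOfLE (le_of_lt hb)).op := fun b c hb hc h => g.cotree.map_comp_map h hc.le
  obtain ⟨t, x⟩ := a
  rcases TreeOrder.bot_or_covBy_or_isSuccLimit x with rfl | ⟨y, hy⟩ | hx
  · rcases TreeOrder.bot_or_covBy_or_isSuccLimit t with rfl | ⟨r, hr⟩ | ht
    · exact (ha.1 isMin_bot).elim
    · have hA : ∀ x : (g.sub r).T, x ∈ (g.br hr).1 → (⟨r, x⟩ : g.Vertex) < ⟨t, ⊥⟩ :=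
        fun x hx => lt_of_mem_br hr le_rfl hx _
      refine LimOn.of_cofinal _ hcomp (B := {b | ∃ x ∈ (g.br hr).1, b = ⟨r, x⟩}) ?_ ?_ ?_
      · rintro _ ⟨x, hx, rfl⟩
        exact hA x hx
      · intro b hb
        rcases (base_mono (le_of_lt hb)).eq_or_lt with h | h
        · obtain ⟨t', x⟩ := b
          obtain rfl : t' = t := h
          exact (not_lt_bot (mk_lt_mk.1 hb)).elim
        · have h' : b.base ≤ r := by
            rcases TreeOrder.total (base_mono (le_of_lt hb)) hr.le with h' | h'
            · exact h'
            · rcases h'.eq_or_lt with h' | h'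
              · exact h'.ge
              · exact (hr.2 h' h).elim
          rcases h'.eq_or_lt with h' | h'
          · obtain ⟨t', x⟩ := b
            obtain rfl : t' = r := h'
            exact ⟨_, ⟨x, mem_br_of_le (le_of_lt hb) hr le_rfl, rfl⟩, le_rfl⟩
          · refine ⟨⟨r, ⊥⟩, ⟨⊥, (g.br hr).1.bot_mem, rfl⟩, ?_⟩
            obtain ⟨s, hs, hs'⟩ := TreeOrder.exists_covBy_le h'
            exact le_of_mem_br hs hs' (mem_br_of_le (le_of_lt hb) hs (hs'.trans hr.le)) _
      · refine ((g.lim hr).of_iso (g.e t)).transport (D' := g.diag)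
          (A' := {b | ∃ x ∈ (g.br hr).1, b = ⟨r, x⟩})
          (fun x _ => (⟨r, x⟩ : g.Vertex)) (fun x hx => ⟨x, hx, rfl⟩)
          (fun x y _ _ h => mk_le_mk.1 h) (fun x y _ _ h => mk_le_mk.2 h) ?_
          (fun x _ => Iso.refl _) ?_ ?_
        · rintro _ ⟨x, hx, rfl⟩
          exact ⟨x, hx, rfl⟩
        · intro x y hx hy hxy
          have := g.diag_map_same hxy
          simp only [Iso.refl_hom]
          exact (Category.id_comp _).trans (this.symm.trans (Category.comp_id _).symm)
        · intro x hx
          have h₃ : τ.map (le_refl t) = 𝟙 _ := τ.diag.map_id _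
          have h₄ : (g.sub t).map (le_refl ⊥) = 𝟙 _ := (g.sub t).diag.map_id _
          have h₅ : g.stepMap hr le_rfl hx ⊥ = (g.e t).hom ≫ g.p hr x hx := by
            rw [stepMap, h₃, h₄, Category.id_comp, Category.id_comp]
          exact (Category.comp_id _).trans ((g.diag_map_step hr le_rfl hx ⊥).trans h₅)
    · have hA : ∀ s : τ.T, s < t → (⟨s, ⊥⟩ : g.Vertex) < ⟨t, ⊥⟩ := fun s hs => by
        obtain ⟨s', h₁, h₂⟩ := TreeOrder.exists_covBy_le hs
        exact lt_of_mem_br h₁ h₂ (g.br h₁).1.bot_mem _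
      refine LimOn.of_cofinal _ hcomp (B := {b | ∃ s < t, b = ⟨s, ⊥⟩}) ?_ ?_ ?_
      · rintro _ ⟨s, hs, rfl⟩
        exact hA s hs
      · intro b hb
        rcases (base_mono (le_of_lt hb)).eq_or_lt with h | h
        · obtain ⟨t', x⟩ := b
          obtain rfl : t' = t := h
          exact (not_lt_bot (mk_lt_mk.1 hb)).elim
        · obtain ⟨s, h₁, h₂⟩ := TreeOrder.exists_lt_of_isSuccLimit ht h
          exact ⟨⟨s, ⊥⟩, ⟨s, h₂, rfl⟩,
            le_of_mem_br h₁ le_rfl (mem_br_of_le (le_of_lt hb) h₁ h₂.le) _⟩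
      · have := (τ.nonempty_isLimit_coneIio_iff t).1 (hτ t ht)
        refine (this.of_iso (g.e t)).transport (D' := g.diag)
          (A' := {b | ∃ s < t, b = ⟨s, ⊥⟩}) (fun s _ => (⟨s, ⊥⟩ : g.Vertex))
          (fun s hs => ⟨s, hs, rfl⟩) (fun _ _ _ _ h => base_mono h)
          (fun r s _ _ h => bot_le_bot h _) ?_ (fun s _ => g.e s) ?_ ?_
        · rintro _ ⟨s, hs, rfl⟩
          exact ⟨s, hs, rfl⟩
        · intro r s hr hs hrs
          exact (g.diag_map_bot hrs).symm
        · intro s hs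
          exact g.diag_map_bot (le_of_lt hs)
  · exact (ha.2 _ (covBy_same hy)).elim
  · refine LimOn.of_cofinal _ hcomp (B := {b | ∃ y < x, b = ⟨t, y⟩}) ?_ ?_ ?_
    · rintro _ ⟨y, hy, rfl⟩
      exact mk_lt_mk.2 hy
    · intro b hb
      obtain ⟨t', y⟩ := b
      have hb' : (⟨t', y⟩ : g.Vertex) ≤ ⟨t, x⟩ := le_of_lt hb
      cases (show g.Le _ _ from hb') with
      | same h => exact ⟨⟨t, y⟩, ⟨y, mk_lt_mk.1 hb, rfl⟩, le_rfl⟩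
      | step h h' hy _ =>
        exact ⟨⟨t, ⊥⟩, ⟨⊥, lt_of_le_of_ne bot_le fun h => hx.1 (h ▸ isMin_bot), rfl⟩,
          le_of_mem_br h h' hy _⟩
    · have := ((g.sub t).nonempty_isLimit_coneIio_iff x).1 ((g.cont t).isLimit x hx)
      refine this.transport (D' := g.diag) (A' := {b | ∃ y < x, b = ⟨t, y⟩})
          (fun x _ => (⟨t, x⟩ : g.Vertex)) (fun x hx => ⟨x, hx, rfl⟩)
        (fun x y _ _ h => mk_le_mk.1 h) (fun x y _ _ h => mk_le_mk.2 h) ?_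
        (fun x _ => Iso.refl _) ?_ ?_
      · rintro _ ⟨x, hx, rfl⟩
        exact ⟨x, hx, rfl⟩
      · intro x y hx hy hxy
        have := g.diag_map_same hxy
        simp only [Iso.refl_hom]
        exact (Category.id_comp _).trans (this.symm.trans (Category.comp_id _).symm)
      · intro y hy
        exact (Category.comp_id _).trans (g.diag_map_same (le_of_lt hy))

end Grafting

end KappaTopos

/-! ### Branches of the grafted cotree -/

namespace KappaTopos

variable {C : Type u} [Category.{v} C]

namespace Grafting

variable {κ : Cardinal.{w}} {E : Precoverage C} {τ : Cotree.{w} C} {g : Grafting κ E τ}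

section Flag

variable {b : Flag g.Vertex}

variable (b) in
/-- The vertices of the basic tree under a branch of the grafted tree. -/
def support : Set τ.T := {t | ∃ x, ⟨t, x⟩ ∈ b}

theorem mem_support {a : g.Vertex} (h : a ∈ b) : a.base ∈ support b := ⟨a.top, h⟩

theorem bot_mem {t : τ.T} (h : t ∈ support b) : (⟨t, ⊥⟩ : g.Vertex) ∈ b := by
  obtain ⟨x, hx⟩ := h
  exact TreeOrder.mem_flag_of_le b hx (mk_le_mk.2 bot_le)

theorem mem_support_of_le {s t : τ.T} (h : s ≤ t) (ht : t ∈ support b) : s ∈ support b :=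
  ⟨⊥, TreeOrder.mem_flag_of_le b (bot_mem ht) (bot_le_bot h _)⟩

theorem isChain_support : IsChain (· ≤ ·) (support b) := by
  rintro s ⟨x, hx⟩ t ⟨y, hy⟩ -
  exact (b.le_or_le hx hy).imp base_mono base_mono

theorem isChain_fiber (t : τ.T) : IsChain (· ≤ ·) {x | (⟨t, x⟩ : g.Vertex) ∈ b} := by
  intro x hx y hy _
  exact (b.le_or_le hx hy).imp mk_le_mk.1 mk_le_mk.1

theorem le_of_mem_support {a : g.Vertex} (ha : a ∈ b) {t : τ.T} (ht : t ∈ support b)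
    (h : a.base < t) : a ≤ ⟨t, ⊥⟩ := by
  rcases b.le_or_le ha (bot_mem ht) with h' | h'
  · exact h'
  · exact (h.not_ge (base_mono h')).elim

/-- Regularity enters here: a branch is a union, over fewer than `κ` base vertices, of chains with
fewer than `κ` elements. -/
theorem mk_flag_lt (hκ : κ.IsRegular) (h : ∀ c : Flag τ.T, Cardinal.mk (c : Set τ.T) < κ)
    (b : Flag g.Vertex) : Cardinal.mk (b : Set g.Vertex) < κ := by
  have h₁ : Cardinal.mk (support b) < κ := by
    obtain ⟨c, hc⟩ := (isChain_support (b := b)).exists_subset_flag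
    exact (Cardinal.mk_le_mk_of_subset hc).trans_lt (h c)
  have h₂ (t : support b) : Cardinal.mk {x | (⟨t.1, x⟩ : g.Vertex) ∈ b} < κ := by
    obtain ⟨c, hc⟩ := (isChain_fiber (b := b) t.1).exists_subset_flag
    exact (Cardinal.mk_le_mk_of_subset hc).trans_lt ((g.cont t.1).branch_lt c)
  refine lt_of_le_of_lt ?_ (Cardinal.sum_lt_of_isRegular hκ h₁ h₂)
  rw [← Cardinal.mk_sigma]
  refine Cardinal.mk_le_of_injective
    (f := fun a : (b : Set g.Vertex) => ⟨⟨a.1.base, mem_support a.2⟩, ⟨a.1.top, a.2⟩⟩) ?_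
  rintro ⟨⟨t, x⟩, ha⟩ ⟨⟨t', x'⟩, ha'⟩ h
  simp only [Sigma.mk.injEq, Subtype.mk.injEq] at h
  obtain ⟨rfl, h⟩ := h
  obtain rfl : x = x' := by simpa using h
  rfl

end Flag

theorem isContinuous (hκ : κ.IsRegular)
    (hE : ∀ (X : C) (R : Presieve X), (∃ (Y : C) (f : Y ⟶ X), R f) →
      (∀ (Y : C) (f : Y ⟶ X), R f → IsIso f) → R ∈ E X)
    (hτ : ∀ t : τ.T, Order.IsSuccLimit t → Nonempty (IsLimit (τ.coneIio t)))
    (hb : ∀ c : Flag τ.T, Cardinal.mk (c : Set τ.T) < κ) : g.cotree.IsContinuous κ E where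
  predecessors_mem := by
    rintro ⟨t, x⟩ ht
    by_cases hx : x ∈ (g.sub t).leaf
    · obtain ⟨h₁, h₂⟩ := g.predecessors_of_mem ht hx
      exact hE _ _ h₁ h₂
    · rw [g.predecessors_of_notMem hx]
      exact (g.cont t).predecessors_mem x hx
  branch_lt := mk_flag_lt hκ hb
  isLimit a ha := (g.cotree.nonempty_isLimit_coneIio_iff a).2 (g.limOn_Iio hτ a ha)

section LiveBranch

/-- If a live branch stops above a vertex, this vertex is a leaf. -/
theorem mem_leaf_of_isMax (b : g.cotree.LiveBranch) {t : τ.T} (ht : t ∈ support b.1)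
    (hm : ∀ s ∈ support b.1, s ≤ t) : t ∈ τ.leaf := by
  by_contra htl
  have hle (a : g.Vertex) (ha : a ∈ b.1) (y : (g.sub t).T) (h : a.base ≠ t) : a ≤ ⟨t, y⟩ :=
    (le_of_mem_support ha ht ((hm _ (mem_support ha)).lt_of_ne h)).trans (mk_le_mk.2 bot_le)
  -- If `t` were not a leaf, the part of `b` over `t` would be a live branch of the grafted tree. By
  -- `surj` it leads to some successor `s`, and then `⟨s, ⊥⟩` lies above all of `b`, hence belongs
  -- to it.
  let f : Flag (g.sub t).T := ⟨{x | (⟨t, x⟩ : g.Vertex) ∈ b.1}, isChain_fiber t, fun S hS hfS => by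
    refine Set.Subset.antisymm hfS fun y hy => ?_
    refine Flag.mem_iff_forall_le_or_ge.2 fun a ha => ?_
    by_cases h : a.base = t
    · obtain ⟨t', x⟩ := a
      obtain rfl : t' = t := h
      exact (hS.total hy (hfS ha)).imp mk_le_mk.2 mk_le_mk.2
    · exact Or.inr (hle a ha y h)⟩
  have hf : ∀ x ∈ f, IsMax x → x ∈ (g.sub t).leaf := by
    intro x hx hxm
    by_contra hxl
    refine htl (b.2 ⟨t, x⟩ hx ?_)
    rintro ⟨t', y⟩ h
    cases (show g.Le _ _ from h) with
    | same h₁ => exact mk_le_mk.2 (hxm h₁)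
    | step h₁ h₂ hx' y => exact (hxl ((g.br h₁).2 x hx' hxm)).elim
  obtain ⟨s, hs, hbr⟩ := g.surj t htl ⟨f, hf⟩
  refine hs.lt.not_ge (hm s ⟨⊥, ?_⟩)
  refine TreeOrder.mem_flag_of_forall_lt _ fun a ha => ?_
  by_cases h : a.base = t
  · obtain ⟨t', x⟩ := a
    obtain rfl : t' = t := h
    exact le_of_mem_br hs le_rfl (by rw [hbr]; exact ha) _
  · exact (hle a ha ⊥ h).trans (bot_le_bot hs.le _)

/-- The branch of the basic tree under a live branch of the grafted tree. -/
theorem exists_flag_eq_support (b : g.cotree.LiveBranch) :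
    ∃ c : Flag τ.T, (c : Set τ.T) = support b.1 := by
  rcases TreeOrder.exists_flag_or_Iio (fun _ _ h ht => mem_support_of_le h ht)
    (isChain_support (b := b.1)) with h | ⟨t, ht⟩
  · exact h
  -- If the support were `Set.Iio t`, then `⟨t, ⊥⟩` would lie above the whole branch. The only
  -- obstruction is a vertex covered by `t`, which would be last in the support and hence a leaf,
  -- yet lies below `t`.
  · exfalso
    refine (lt_irrefl t : ¬ t < t) (ht.ge ⟨⊥, ?_⟩)
    refine TreeOrder.mem_flag_of_forall_lt _ fun a ha => ?_
    have hat : a.base < t := ht.ge (mem_support ha)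
    obtain ⟨s, hs, hs'⟩ := TreeOrder.exists_covBy_le hat
    rcases hs'.eq_or_lt with rfl | hs''
    · have hl := mem_leaf_of_isMax b (mem_support ha) fun r hr => by
        have hr' : r < s := ht.ge hr
        rcases TreeOrder.total hr'.le hat.le with h | h
        · exact h
        · rcases h.eq_or_lt with h | h
          · exact h.ge
          · exact (hs.2 h hr').elim
      exact (hat.not_ge (τ.isMax_of_mem_leaf _ hl hat.le)).elim
    · exact (le_of_mem_support ha (ht.le hs'') hs.lt).trans (bot_le_bot hs' _)

/-- The live branch of the basic tree under a live branch of the grafted tree. -/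
noncomputable def baseBranch (b : g.cotree.LiveBranch) : τ.LiveBranch :=
  ⟨(exists_flag_eq_support b).choose, fun t ht hm => by
    have h := (exists_flag_eq_support b).choose_spec
    refine mem_leaf_of_isMax b (h.le ht) fun s hs => ?_
    rcases isChain_support.total hs (h.le ht) with h' | h'
    · exact h'
    · exact hm h'⟩

theorem coe_baseBranch (b : g.cotree.LiveBranch) :
    ((baseBranch b).1 : Set τ.T) = support b.1 := (exists_flag_eq_support b).choose_spec

/-- Over each vertex of `c` take the whole branch of the grafted tree that leads to the next vertex
of `c`; over a last vertex, which is a leaf, the grafted tree is a point. -/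
theorem exists_baseBranch_eq (c : τ.LiveBranch) : ∃ b : g.cotree.LiveBranch, baseBranch b = c := by
  have htop : ∀ t ∈ c.1, (∀ s ∈ c.1, ¬ t < s) → t ∈ τ.leaf := fun t ht h =>
    c.2 t ht (TreeOrder.isMax_of_isMax_flag c.1 ht fun s hs => by
      rcases c.1.le_or_le hs ht with h' | h'
      · exact h'
      · rcases h'.eq_or_lt with h' | h'
        · exact h'.ge
        · exact (h s hs h').elim)
  let A : Set g.Vertex := {a | a.base ∈ c.1 ∧
    ∀ s ∈ c.1, ∀ h : a.base ⋖ s, a.top ∈ (g.br h).1}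
  have hbot (t : τ.T) (ht : t ∈ c.1) : (⟨t, ⊥⟩ : g.Vertex) ∈ A :=
    ⟨ht, fun s hs h => (g.br h).1.bot_mem⟩
  have hsucc (t s : τ.T) (hs : s ∈ c.1) (h : t < s) : ∃ r, t ⋖ r ∧ r ∈ c.1 ∧ r ≤ s := by
    obtain ⟨r, h₁, h₂⟩ := TreeOrder.exists_covBy_le h
    exact ⟨r, h₁, TreeOrder.mem_flag_of_le _ hs h₂, h₂⟩
  have hlt (a a' : g.Vertex) (ha : a ∈ A) (ha' : a' ∈ A) (h : a.base < a'.base) : a ≤ a' := by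
    obtain ⟨r, h₁, h₂, h₃⟩ := hsucc _ _ ha'.1 h
    exact le_of_mem_br h₁ h₃ (ha.2 r h₂ h₁) _
  have hA : IsChain (· ≤ ·) A := by
    rintro ⟨t, x⟩ ha ⟨t', x'⟩ ha' -
    rcases c.1.le_or_le ha.1 ha'.1 with h | h
    · rcases h.eq_or_lt with h | h
      · obtain rfl : t = t' := h
        by_cases hs : ∃ s ∈ c.1, t < s
        · obtain ⟨s, hs, hts⟩ := hs
          obtain ⟨r, h₁, h₂, -⟩ := hsucc _ _ hs hts
          exact ((g.br h₁).1.le_or_le (ha.2 r h₂ h₁) (ha'.2 r h₂ h₁)).imp mk_le_mk.2 mk_le_mk.2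
        · push Not at hs
          have hl := htop t ha.1 hs
          rw [g.eq_bot t hl x, g.eq_bot t hl x']
          exact Or.inl le_rfl
      · exact Or.inl (hlt _ _ ha ha' h)
    · rcases h.eq_or_lt with h | h
      · obtain rfl : t' = t := h
        by_cases hs : ∃ s ∈ c.1, t' < s
        · obtain ⟨s, hs, hts⟩ := hs
          obtain ⟨r, h₁, h₂, -⟩ := hsucc _ _ hs hts
          exact ((g.br h₁).1.le_or_le (ha.2 r h₂ h₁) (ha'.2 r h₂ h₁)).imp mk_le_mk.2 mk_le_mk.2
        · push Not at hs
          have hl := htop t' ha.1 hs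
          rw [g.eq_bot t' hl x, g.eq_bot t' hl x']
          exact Or.inl le_rfl
      · exact Or.inr (hlt _ _ ha' ha h)
  let f : Flag g.Vertex := ⟨A, hA, fun S hS hAS => by
    refine Set.Subset.antisymm hAS ?_
    rintro ⟨t, x⟩ ha
    have ht : t ∈ c.1 := Flag.mem_iff_forall_le_or_ge.2 fun u hu =>
      (hS.total ha (hAS (hbot u hu))).imp base_mono base_mono
    refine ⟨ht, fun s hs h => ?_⟩
    rcases hS.total ha (hAS (hbot s hs)) with h' | h'
    · exact mem_br_of_le h' h le_rfl
    · exact (h.lt.not_ge (base_mono h')).elim⟩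
  have hf : ∀ a ∈ f, IsMax a → a ∈ g.cotree.leaf := by
    intro a ha hm
    refine htop a.base ha.1 fun s hs h => ?_
    exact h.not_ge (base_mono (hm (hlt a ⟨s, ⊥⟩ ha (hbot s hs) h)))
  let b : g.cotree.LiveBranch := ⟨f, hf⟩
  refine ⟨b, Subtype.ext (Flag.ext ((coe_baseBranch b).trans ?_))⟩
  ext t
  exact ⟨fun ⟨x, hx⟩ => hx.1, fun ht => ⟨⊥, hbot t ht⟩⟩

/-- A limit of a branch of the basic tree is a limit of the branches of the grafted tree
above it. -/
theorem exists_limOn (b : g.cotree.LiveBranch) {Y : C}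
    {p : ∀ t, t ∈ (baseBranch b).1 → (Y ⟶ τ.obj t)}
    (hp : LimOn τ.diag ((baseBranch b).1 : Set τ.T) p) :
    ∃ q : ∀ a, a ∈ b.1 → (Y ⟶ g.cotree.obj a), LimOn g.diag (b.1 : Set g.Vertex) q ∧
      q ⊥ b.1.bot_mem ≫ (g.e ⊥).hom = p ⊥ (baseBranch b).1.bot_mem := by
  have hmem (t : τ.T) : t ∈ (baseBranch b).1 ↔ t ∈ support b.1 := by
    rw [← coe_baseBranch]
    rfl
  -- The roots over the base branch are cofinal in `b`, so the projections can be defined through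
  -- them, independently of the chosen root by `hq`. Over a last vertex the root is the only vertex.
  have hcof : ∀ a ∈ b.1, ∃ t ∈ (baseBranch b).1, a ≤ ⟨t, ⊥⟩ := by
    intro a ha
    by_cases h : ∃ s ∈ support b.1, a.base < s
    · obtain ⟨s, hs, has⟩ := h
      exact ⟨s, (hmem _).2 hs, le_of_mem_support ha hs has⟩
    · push Not at h
      refine ⟨a.base, (hmem _).2 (mem_support ha), ?_⟩
      have hl := mem_leaf_of_isMax b (mem_support ha) fun s hs => by
        rcases isChain_support.total hs (mem_support ha) with h' | h'
        · exact h'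
        · rcases h'.eq_or_lt with h' | h'
          · exact h'.ge
          · exact (h s hs h').elim
      exact mk_le_mk.2 (g.eq_bot _ hl _).le
  choose t ht hat using hcof
  let q (a : g.Vertex) (ha : a ∈ b.1) : Y ⟶ g.cotree.obj a :=
    p (t a ha) (ht a ha) ≫ (g.e (t a ha)).inv ≫ g.cotree.map (hat a ha)
  have hq (a : g.Vertex) (ha : a ∈ b.1) (s : τ.T) (hs : s ∈ (baseBranch b).1) (h : a ≤ ⟨s, ⊥⟩) :
      q a ha = p s hs ≫ (g.e s).inv ≫ g.cotree.map h := by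
    have H (s s' : τ.T) (hs : s ∈ (baseBranch b).1) (hs' : s' ∈ (baseBranch b).1) (hss : s ≤ s')
        (h : a ≤ ⟨s, ⊥⟩) (h' : a ≤ ⟨s', ⊥⟩) : p s hs ≫ (g.e s).inv ≫ g.cotree.map h =
          p s' hs' ≫ (g.e s').inv ≫ g.cotree.map h' := by
      have h₁ : (g.e s').inv ≫ g.cotree.map (bot_le_bot hss ⊥) = τ.map hss ≫ (g.e s).inv := by
        rw [Iso.inv_comp_eq, ← Category.assoc, Iso.eq_comp_inv]
        exact g.diag_map_bot hss
      rw [← hp.comp_map s s' hs hs' hss, ← g.cotree.map_comp_map h (bot_le_bot hss ⊥),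
        reassoc_of% h₁, Category.assoc]
    rcases (baseBranch b).1.le_or_le hs (ht a ha) with hss | hss
    · exact (H _ _ _ _ hss _ _).symm
    · exact H _ _ _ _ hss _ _
  have hqc : ∀ a a' (ha : a ∈ b.1) (ha' : a' ∈ b.1) (h : a ≤ a'),
      q a' ha' ≫ g.cotree.map h = q a ha := by
    intro a a' ha ha' h
    rw [hq a ha _ (ht a' ha') (h.trans (hat a' ha')), ← g.cotree.map_comp_map h (hat a' ha')]
    simp only [q, Category.assoc]
  have hqb (s : τ.T) (hs : s ∈ (baseBranch b).1) (hs' : (⟨s, ⊥⟩ : g.Vertex) ∈ b.1) :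
      q ⟨s, ⊥⟩ hs' ≫ (g.e s).hom = p s hs := by
    have h₁ : g.cotree.map (le_refl (⟨s, ⊥⟩ : g.Vertex)) = 𝟙 _ := g.diag.map_id _
    rw [hq _ _ s hs le_rfl, h₁, Category.comp_id, Category.assoc, Iso.inv_hom_id, Category.comp_id]
  refine ⟨q, ?_, hqb ⊥ _ _⟩
  refine LimOn.of_cofinal _ hqc (B := {a | ∃ s ∈ (baseBranch b).1, a = ⟨s, ⊥⟩}) ?_ ?_ ?_
  · rintro _ ⟨s, hs, rfl⟩
    exact bot_mem ((hmem s).1 hs)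
  · intro a ha
    exact ⟨_, ⟨_, ht a ha, rfl⟩, hat a ha⟩
  · refine hp.transport (D' := g.diag) (A' := {a | ∃ s ∈ (baseBranch b).1, a = ⟨s, ⊥⟩})
      (fun s _ => (⟨s, ⊥⟩ : g.Vertex)) (fun s hs => ⟨s, hs, rfl⟩) (fun _ _ _ _ h => base_mono h)
      (fun _ _ _ _ h => bot_le_bot h _) ?_ (fun s _ => g.e s) ?_ ?_
    · rintro _ ⟨s, hs, rfl⟩
      exact ⟨s, hs, rfl⟩
    · intro r s hr hs hrs
      exact (g.diag_map_bot hrs).symm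
    · intro s hs
      exact hqb s hs _

/-- The families of cocompositions of the basic tree are obtained from the grafted tree. -/
theorem ofArrows_mem_treeClosure (hκ : κ.IsRegular)
    (hE : ∀ (X : C) (R : Presieve X), (∃ (Y : C) (f : Y ⟶ X), R f) →
      (∀ (Y : C) (f : Y ⟶ X), R f → IsIso f) → R ∈ E X) (hE' : pbClosure E ≤ E)
    (hτ : ∀ t : τ.T, Order.IsSuccLimit t → Nonempty (IsLimit (τ.coneIio t)))
    (hb : ∀ c : Flag τ.T, Cardinal.mk (c : Set τ.T) < κ)
    (g : Grafting κ E τ) (Z : τ.LiveBranch → C)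
    (p : ∀ b : τ.LiveBranch, ∀ a, a ∈ b.1 → (Z b ⟶ τ.obj a))
    (hp : ∀ b, LimOn τ.diag (b.1 : Set τ.T) (p b)) :
    Presieve.ofArrows Z (fun b => p b ⊥ b.1.bot_mem) ∈ treeClosure κ E τ.root := by
  choose q hq hq' using fun b : g.cotree.LiveBranch => exists_limOn b (hp (baseBranch b))
  have := mem_treeClosure_of_iso hE' g.cotree (isContinuous hκ hE hτ hb)
    (g.e ⊥) (fun b => Z (baseBranch b)) q hq
  convert this using 1
  refine le_antisymm ?_ ?_
  · rintro _ _ ⟨c⟩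
    obtain ⟨b, rfl⟩ := exists_baseBranch_eq (g := g) c
    rw [← hq' b]
    exact ⟨b⟩
  · rintro _ _ ⟨b⟩
    have : Presieve.ofArrows Z (fun b : τ.LiveBranch => p b ⊥ b.1.bot_mem)
      (p (baseBranch b) ⊥ (baseBranch b).1.bot_mem) := ⟨baseBranch b⟩
    rw [← hq' b] at this
    exact this

end LiveBranch

end Grafting

end KappaTopos

namespace KappaTopos

variable {C : Type u} [Category.{v} C]

/-! ### Duplicating vertices, and idempotence of the tree operation -/

section Decorate

variable (τ : Cotree.{w} C) (L : τ.T → Type w) [∀ s, Nonempty (L s)] [Subsingleton (L ⊥)]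

/-- The cotree obtained from `τ` by decorating its vertices by arbitrary labels. -/
noncomputable abbrev Cotree.decorate : Cotree.{w} C where
  T := Thread L (fun _ _ => True)
  orderBot := Thread.orderBot (fun r _ => Classical.arbitrary (L r)) (fun l => by
    refine ⟨fun _ => funext fun r => funext fun hr => ?_, fun _ => trivial⟩
    obtain rfl := le_bot_iff.1 hr
    exact Subsingleton.elim _ _)
  wellFounded := TreeOrder.wellFounded
  isChain_Iic := TreeOrder.isChain_Iic
  diag := Thread.pt_mono.functor.op ⋙ τ.diag
  leaf := {p | p.pt ∈ τ.leaf}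
  isMax_of_mem_leaf p hp q hq :=
    Thread.le_of_pt_le le_rfl hq (τ.isMax_of_mem_leaf _ hp (Thread.pt_le hq))

variable {τ L}

/-- Labels are unconstrained and always exist, so a branch of threads can be prolonged as long as
its support is not a branch. -/
theorem decorate_exists_flag (b : Flag (τ.decorate L).T) :
    ∃ c : Flag τ.T, (c : Set τ.T) = Thread.support b := by
  rcases Thread.support_cases b with h | ⟨t, ht⟩
  · exact h
  · exact (Thread.not_ok_extendLabel ht (Classical.arbitrary (L t)) trivial).elim

/-- The branch under a branch of the decorated cotree. -/
noncomputable def decorateBranch (b : (τ.decorate L).LiveBranch) : τ.LiveBranch :=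
  ⟨(decorate_exists_flag b.1).choose, fun t ht hm => by
    obtain ⟨p, hp, rfl⟩ := (decorate_exists_flag b.1).choose_spec.le ht
    exact b.2 p hp fun q hq => Thread.le_of_pt_le le_rfl hq (hm (Thread.pt_le hq))⟩

theorem coe_decorateBranch (b : (τ.decorate L).LiveBranch) :
    ((decorateBranch b).1 : Set τ.T) = Thread.support b.1 := (decorate_exists_flag b.1).choose_spec

open Classical in
theorem exists_decorateBranch_eq (c : τ.LiveBranch) :
    ∃ b : (τ.decorate L).LiveBranch, decorateBranch b = c := by
  let p (t : τ.T) : (τ.decorate L).T :=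
    ⟨t, fun r _ => if h : r = ⊥ then (h ▸ Classical.arbitrary (L ⊥)) else Classical.arbitrary (L r),
      fun _ _ => trivial⟩
  have hp : ∀ s t, s ≤ t → p s ≤ p t := fun s t h => ⟨h, fun _ _ => rfl⟩
  let f : Flag (τ.decorate L).T := ⟨p '' c.1, by
      rintro _ ⟨s, hs, rfl⟩ _ ⟨t, ht, rfl⟩ -
      exact (c.1.le_or_le hs ht).imp (hp _ _) (hp _ _), fun S hS hcS => by
    refine Set.Subset.antisymm hcS fun q hq => ?_
    have hq' : q.pt ∈ c.1 := Flag.mem_iff_forall_le_or_ge.2 fun s hs =>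
      (hS.total hq (hcS ⟨s, hs, rfl⟩)).imp Thread.pt_le Thread.pt_le
    refine ⟨_, hq', ?_⟩
    exact le_antisymm (Thread.le_of_chain hS (hcS ⟨_, hq', rfl⟩) hq le_rfl)
      (Thread.le_of_chain hS hq (hcS ⟨_, hq', rfl⟩) le_rfl)⟩
  have hf : ∀ q ∈ f, IsMax q → q ∈ (τ.decorate L).leaf := by
    rintro _ ⟨s, hs, rfl⟩ hm
    exact c.2 s hs fun t hst => Thread.pt_le (hm (hp s t hst))
  let b : (τ.decorate L).LiveBranch := ⟨f, hf⟩
  refine ⟨b, Subtype.ext (Flag.ext ((coe_decorateBranch b).trans ?_))⟩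
  ext t
  constructor
  · rintro ⟨_, ⟨s, hs, rfl⟩, rfl⟩
    exact hs
  · intro ht
    exact ⟨p t, ⟨t, ht, rfl⟩, rfl⟩

/-- A chain of threads is order-isomorphic to its set of vertices and carries the same diagram. -/
theorem decorate_limOn {A : Set (τ.decorate L).T} (hA : IsChain (· ≤ ·) A) {B : Set τ.T}
    (hAB : ∀ t, t ∈ B ↔ ∃ q ∈ A, q.pt = t) {X : C} {p : ∀ t, t ∈ B → (X ⟶ τ.obj t)}
    (hp : LimOn τ.diag B p) : LimOn (τ.decorate L).diag A
      (fun q hq => p q.pt ((hAB _).2 ⟨q, hq, rfl⟩)) := by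
  choose f hf hf' using fun t => (hAB t).1
  have H : ∀ t t' (h : t = t') (ht : t ∈ B) (ht' : t' ∈ B),
      p t ht ≫ eqToHom (by rw [h]) = p t' ht' := by
    rintro t _ rfl ht ht'
    exact Category.comp_id _
  have H' : ∀ s t s' t' (h : s ≤ t) (h' : s' ≤ t') (hs : s = s') (ht : t = t'),
      (eqToHom (by rw [ht]) : τ.obj t ⟶ τ.obj t') ≫ τ.map h' =
        τ.map h ≫ eqToHom (by rw [hs]) := by
    rintro s t _ _ h h' rfl rfl
    rw [eqToHom_refl, eqToHom_refl, Category.comp_id, Category.id_comp]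
  refine hp.transport f hf (fun s t hs ht h => ?_) (fun s t hs ht h => ?_) (fun q hq => ?_)
    (fun t ht => eqToIso (by
      have := hf' t ht
      exact congr_arg (fun t => τ.obj t) this)) ?_ ?_
  · have := Thread.pt_le h
    rwa [hf', hf'] at this
  · refine Thread.le_of_chain hA (hf _ _) (hf _ _) ?_
    rwa [hf', hf']
  · have hq' := (hAB _).2 ⟨q, hq, rfl⟩
    refine ⟨q.pt, hq', le_antisymm ?_ ?_⟩
    · exact Thread.le_of_chain hA (hf _ _) hq (hf' _ _).le
    · exact Thread.le_of_chain hA hq (hf _ _) (hf' _ _).ge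
  · intro s t hs ht hst
    exact H' _ _ _ _ _ hst (hf' s hs) (hf' t ht)
  · intro t ht
    exact H _ _ (hf' t ht) _ ht

theorem decorate_isLimit
    (hτ : ∀ t : τ.T, Order.IsSuccLimit t → Nonempty (IsLimit (τ.coneIio t)))
    (q : (τ.decorate L).T) (hq : Order.IsSuccLimit q) :
    Nonempty (IsLimit ((τ.decorate L).coneIio q)) := by
  rw [Cotree.nonempty_isLimit_coneIio_iff]
  refine decorate_limOn ((TreeOrder.isChain_Iic q).mono Set.Iio_subset_Iic_self) (fun t => ?_)
    ((τ.nonempty_isLimit_coneIio_iff _).1 (hτ q.pt (Thread.isSuccLimit_pt hq)))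
  constructor
  · intro ht
    exact ⟨q.restrict t (le_of_lt ht), Thread.lt_of_le_of_pt_lt (Thread.restrict_le _ _ _) ht, rfl⟩
  · rintro ⟨r, hr, rfl⟩
    exact Thread.pt_lt hr

end Decorate

open Classical in
/-- The `κ`-tree operation is idempotent. -/
theorem treeClosure_weakTree_le {κ : Cardinal.{w}} (hκ : κ.IsRegular) {E : Precoverage C}
    (hE : ∀ (X : C) (R : Presieve X), (∃ (Y : C) (f : Y ⟶ X), R f) →
      (∀ (Y : C) (f : Y ⟶ X), R f → IsIso f) → R ∈ E X) (hE' : pbClosure E ≤ E) :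
    treeClosure κ (weakTree κ E) ≤ treeClosure κ E := by
  rintro _ _ ⟨τ, hτ, c⟩
  -- Matching the arrows of the predecessor family relates the successors of `t` to the live
  -- branches of `σ`. If `t` is not a leaf, each successor has a branch and each branch a successor,
  -- but neither is determined by the other.
  have H : ∀ t : τ.T, ∃ (σ : Cotree.{w} C) (e : σ.root ≅ τ.obj t), σ.IsContinuous κ E ∧
      (∀ s (h : t ⋖ s), ∃ (b : σ.LiveBranch) (p : ∀ a, a ∈ b.1 → (τ.obj s ⟶ σ.obj a)),
        LimOn σ.diag (b.1 : Set σ.T) p ∧ p ⊥ b.1.bot_mem ≫ e.hom = τ.map h.le) ∧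
      (t ∉ τ.leaf → ∀ b : σ.LiveBranch, ∃ (s : τ.T) (h : t ⋖ s)
        (p : ∀ a, a ∈ b.1 → (τ.obj s ⟶ σ.obj a)),
        LimOn σ.diag (b.1 : Set σ.T) p ∧ p ⊥ b.1.bot_mem ≫ e.hom = τ.map h.le) ∧
      (t ∈ τ.leaf → ∀ x : σ.T, x = ⊥) := by
    intro t
    by_cases ht : t ∈ τ.leaf
    · refine ⟨Cotree.single (τ.obj t), Iso.refl _, Cotree.isContinuous_single hκ _ _,
        fun s h => ?_, fun h => (h ht).elim, fun _ x => rfl⟩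
      exact (h.lt.not_ge (τ.isMax_of_mem_leaf t ht h.le)).elim
    · obtain ⟨σ, e, h₁, h₂, h₃⟩ := hτ.predecessors_mem t ht
      refine ⟨σ, e, h₁, fun s h => h₂ _ ⟨(⟨s, h⟩ : {s // t ⋖ s})⟩, fun _ b => ?_,
        fun h => (ht h).elim⟩
      obtain ⟨Y, p, hp, hp'⟩ := h₃ b
      generalize hf : p ⊥ b.1.bot_mem ≫ e.hom = f at hp'
      obtain ⟨s⟩ := hp'
      exact ⟨s.1, s.2, p, hp, hf⟩
  choose sub e cont hr hs htriv using H
  let B (t s : τ.T) (h : t ⋖ s) : Type w := {b : (sub t).LiveBranch //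
    ∃ p : ∀ a, a ∈ b.1 → (τ.obj s ⟶ (sub t).obj a),
        LimOn (sub t).diag (b.1 : Set (sub t).T) p ∧ p ⊥ b.1.bot_mem ≫ (e t).hom = τ.map h.le}
  -- A copy of `s` for every branch matched with it. Quantifying over all `t ⋖ s`, of which there is
  -- at most one, avoids separating cases.
  let L (s : τ.T) : Type w := ∀ t (h : t ⋖ s), B t s h
  have : ∀ s, Nonempty (L s) := fun s => ⟨fun t h => ⟨(hr t s h).choose, (hr t s h).choose_spec⟩⟩
  have : Subsingleton (L ⊥) := ⟨fun l l' => funext fun t => funext fun h =>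
    (not_lt_bot h.lt).elim⟩
  let d {p q : (τ.decorate L).T} (h : p ⋖ q) : B p.pt q.pt (Thread.covBy_iff.1 h).2 :=
    q.label q.pt le_rfl p.pt (Thread.covBy_iff.1 h).2
  let g : Grafting κ E (τ.decorate L) :=
    { sub := fun p => sub p.pt
      cont := fun p => cont p.pt
      e := fun p => e p.pt
      br := fun h => (d h).1
      p := fun h => (d h).2.choose
      lim := fun h => (d h).2.choose_spec.1
      p_bot := fun h => (d h).2.choose_spec.2
      surj := fun p hp b => by
        obtain ⟨s, h, hb⟩ := hs p.pt hp b
        -- Only the label at `p.pt` is prescribed, so that the copy of `s` leads to the given branch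
        -- `b`.
        let l₀ : L s := Classical.arbitrary (L s)
        obtain ⟨q, hpq, rfl, hq⟩ := p.exists_extend h
          (Function.update l₀ p.pt (fun _ => ⟨b, hb⟩)) trivial
        refine ⟨q, hpq, ?_⟩
        have : q.label q.pt le_rfl p.pt (Thread.covBy_iff.1 hpq).2 = ⟨b, hb⟩ := by
          rw [hq, Function.update_self]
        exact congr_arg Subtype.val this
      eq_bot := fun p hp => htriv p.pt hp }
  have hbranch (b : Flag (τ.decorate L).T) : Cardinal.mk (b : Set (τ.decorate L).T) < κ :=
    (Thread.mk_flag b).trans_lt (Thread.mk_support_lt hτ.branch_lt)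
  have := Grafting.ofArrows_mem_treeClosure hκ hE hE' (decorate_isLimit hτ.isLimit) hbranch g
    (fun b => (c (decorateBranch b)).cone.pt) _ (fun b => decorate_limOn b.1.chain_le 
      (fun t => Set.ext_iff.1 (coe_decorateBranch b) t)
      (τ.limOn_of_isLimit (c (decorateBranch b)).isLimit))
  have key : τ.cocompositionFamily c = Presieve.ofArrows (fun b => (c (decorateBranch b)).cone.pt)
      (fun b : (τ.decorate L).LiveBranch => (c (decorateBranch b)).cone.π.app
        (op ⟨⊥, (decorateBranch b).1.bot_mem⟩)) := by
    refine le_antisymm ?_ ?_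
    · rintro _ _ ⟨b'⟩
      obtain ⟨b, rfl⟩ := exists_decorateBranch_eq (L := L) b'
      exact ⟨b⟩
    · rintro _ _ ⟨b⟩
      exact ⟨decorateBranch b⟩
  rw [key]
  exact this

end KappaTopos

namespace KappaTopos

variable {C : Type u} [Category.{v} C]

/-! ### Composition of families as a tree with two levels -/

section TwoLevel

/-- The vertices of a tree with two levels above the root. -/
inductive TwoLevel (ι : Type w) (σ : ι → Type w) : Type w
  | root : TwoLevel ι σ
  | mid (i : ι) : TwoLevel ι σ
  | top (i : ι) (j : σ i) : TwoLevel ι σ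

namespace TwoLevel

variable {ι : Type w} {σ : ι → Type w}

/-- The order of the tree. -/
inductive Le : TwoLevel ι σ → TwoLevel ι σ → Prop
  | root (x) : Le root x
  | mid (i) : Le (mid i) (mid i)
  | mid_top (i j) : Le (mid i) (top i j)
  | top (i j) : Le (top i j) (top i j)

instance : PartialOrder (TwoLevel ι σ) where
  le := Le
  le_refl x := by
    cases x with
    | root => exact Le.root _
    | mid i => exact Le.mid i
    | top i j => exact Le.top i j
  le_trans x y z h h' := by
    cases h with
    | root => exact Le.root _
    | mid i => exact h'
    | mid_top i j => cases h'; exact Le.mid_top i j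
    | top i j => exact h'
  le_antisymm x y h h' := by
    cases h with
    | root => cases h'; rfl
    | mid i => rfl
    | mid_top i j => cases h'
    | top i j => rfl

instance : OrderBot (TwoLevel ι σ) where
  bot := root
  bot_le := Le.root

theorem isMax_top (i : ι) (j : σ i) : IsMax (top i j : TwoLevel ι σ) := by
  intro x hx
  cases (show Le _ _ from hx)
  exact le_rfl

/-- The height of a vertex. -/
def height : TwoLevel ι σ → Fin 3
  | root => 0
  | mid _ => 1
  | top _ _ => 2

theorem eq_of_le_of_height {x y : TwoLevel ι σ} (h : x ≤ y) (h' : y.height ≤ x.height) :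
    x = y := by
  cases (show Le _ _ from h) with
  | root =>
    cases y with
    | root => rfl
    | mid i => simp [height] at h'
    | top i j => simp [height] at h'
  | mid i => rfl
  | mid_top i j => simp [height] at h'
  | top i j => rfl

theorem height_lt {x y : TwoLevel ι σ} (h : x < y) : x.height < y.height := by
  by_contra h'
  exact h.ne (eq_of_le_of_height h.le (not_lt.1 h'))

instance : TreeOrder (TwoLevel ι σ) where
  wellFounded := ⟨Subrelation.wf (fun h => height_lt h)
    (InvImage.wf height (wellFounded_lt (α := Fin 3)))⟩
  isChain_Iic z x hx y hy _ := by
    cases (show Le _ _ from hx) with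
    | root => exact Or.inl (Le.root _)
    | mid i =>
      cases (show Le _ _ from hy) with
      | root => exact Or.inr (Le.root _)
      | mid => exact Or.inl le_rfl
    | mid_top i j =>
      cases (show Le _ _ from hy) with
      | root => exact Or.inr (Le.root _)
      | mid_top => exact Or.inl le_rfl
      | top => exact Or.inl (Le.mid_top i j)
    | top i j => exact Or.inr hy

theorem root_covBy_mid (i : ι) : (root : TwoLevel ι σ) ⋖ mid i :=
  ⟨lt_of_le_of_ne (Le.root _) (by simp), fun c h h' => by
    have h₁ := height_lt h
    have h₂ := height_lt h'
    simp only [height] at h₁ h₂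
    omega⟩

theorem mid_covBy_top (i : ι) (j : σ i) : (mid i : TwoLevel ι σ) ⋖ top i j :=
  ⟨lt_of_le_of_ne (Le.mid_top i j) (by simp), fun c h h' => by
    have h₁ := height_lt h
    have h₂ := height_lt h'
    simp only [height] at h₁ h₂
    omega⟩

theorem not_isSuccLimit (x : TwoLevel ι σ) : ¬ Order.IsSuccLimit x := by
  intro h
  cases x with
  | root => exact h.1 fun _ _ => Le.root _
  | mid i => exact h.2 _ (root_covBy_mid i)
  | top i j => exact h.2 _ (mid_covBy_top i j)

section Cotree

variable {S : C} {X : ι → C} {Z : ∀ i, σ i → C} (f : ∀ i, X i ⟶ S) (g : ∀ i j, Z i j ⟶ X i)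

variable (S X Z) in
/-- The objects of the cotree of the composition of families. -/
abbrev tobj : TwoLevel ι σ → C
  | root => S
  | mid i => X i
  | top i j => Z i j

/-- The arrows of the cotree of the composition of families. -/
inductive Arr : ∀ x y : TwoLevel ι σ, (tobj S X Z y ⟶ tobj S X Z x) → Prop
  | root : Arr root root (𝟙 S)
  | root_mid (i : ι) : Arr root (mid i) (f i)
  | root_top (i : ι) (j : σ i) : Arr root (top i j) (g i j ≫ f i)
  | mid (i : ι) : Arr (mid i) (mid i) (𝟙 (X i))
  | mid_top (i : ι) (j : σ i) : Arr (mid i) (top i j) (g i j)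
  | top (i : ι) (j : σ i) : Arr (top i j) (top i j) (𝟙 (Z i j))

theorem Arr.exists_of_le (x y : TwoLevel ι σ) (h : x ≤ y) : ∃ m, Arr f g x y m := by
  cases (show Le _ _ from h) with
  | root =>
    cases y with
    | root => exact ⟨_, Arr.root⟩
    | mid i => exact ⟨_, Arr.root_mid i⟩
    | top i j => exact ⟨_, Arr.root_top i j⟩
  | mid i => exact ⟨_, Arr.mid i⟩
  | mid_top i j => exact ⟨_, Arr.mid_top i j⟩
  | top i j => exact ⟨_, Arr.top i j⟩

theorem Arr.unique (x y : TwoLevel ι σ) (m m' : tobj S X Z y ⟶ tobj S X Z x)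
    (h : Arr f g x y m) (h' : Arr f g x y m') : m = m' := by
  cases h <;> cases h' <;> rfl

theorem Arr.id (x : TwoLevel ι σ) : Arr f g x x (𝟙 _) := by
  cases x with
  | root => exact Arr.root
  | mid i => exact Arr.mid i
  | top i j => exact Arr.top i j

theorem Arr.comp (x y z : TwoLevel ι σ) (m : tobj S X Z y ⟶ tobj S X Z x)
    (m' : tobj S X Z z ⟶ tobj S X Z y) (h : Arr f g x y m) (h' : Arr f g y z m') :
    Arr f g x z (m' ≫ m) := by
  cases h with
  | root => rwa [Category.comp_id]
  | root_mid i =>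
    cases h' with
    | mid => rw [Category.id_comp]; exact Arr.root_mid i
    | mid_top _ j => exact Arr.root_top i j
  | root_top i j => cases h'; rw [Category.id_comp]; exact Arr.root_top i j
  | mid i => rwa [Category.comp_id]
  | mid_top i j => cases h'; rw [Category.id_comp]; exact Arr.mid_top i j
  | top i j => rwa [Category.comp_id]

/-- The cotree of the composition of families. -/
noncomputable abbrev cotree : Cotree.{w} C where
  T := TwoLevel ι σ
  isChain_Iic := TreeOrder.isChain_Iic
  wellFounded := TreeOrder.wellFounded
  diag := diagOfRel (tobj S X Z) (Arr f g) (Arr.exists_of_le f g) (Arr.unique f g) (Arr.id f g)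
    (Arr.comp f g)
  leaf := {x | ∃ i j, x = top i j}
  isMax_of_mem_leaf := by
    rintro _ ⟨i, j, rfl⟩
    exact isMax_top i j

theorem cotree_map {x y : TwoLevel ι σ} (h : x ≤ y) {m : tobj S X Z y ⟶ tobj S X Z x}
    (hm : Arr f g x y m) : (cotree f g).map h = m :=
  diagOfRel_map (tobj S X Z) (Arr f g) (Arr.exists_of_le f g) (Arr.unique f g) (Arr.id f g)
    (Arr.comp f g) h hm

theorem isContinuous_cotree {κ : Cardinal.{w}} (hκ : κ.IsRegular) {E : Precoverage C}
    (hf : Presieve.ofArrows X f ∈ E S) (hg : ∀ i, Presieve.ofArrows (Z i) (g i) ∈ E (X i)) :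
    (cotree f g).IsContinuous κ E where
  predecessors_mem x hx := by
    cases x with
    | root =>
      convert hf using 1
      refine le_antisymm ?_ ?_
      · rintro _ _ ⟨⟨y, hy⟩⟩
        cases y with
        | root => exact (lt_irrefl _ hy.lt).elim
        | mid i =>
          change Presieve.ofArrows X f ((cotree f g).map hy.le)
          rw [cotree_map f g hy.le (Arr.root_mid i)]
          exact ⟨i⟩
        | top i j => exact (hy.2 (root_covBy_mid i).lt (mid_covBy_top i j).lt).elim
      · rintro _ _ ⟨i⟩
        have := cotree_map f g (root_covBy_mid i).le (Arr.root_mid i)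
        change (cotree f g).predecessors root (f i)
        rw [← this]
        exact ⟨(⟨_, root_covBy_mid i⟩ : {y : TwoLevel ι σ // root ⋖ y})⟩
    | mid i =>
      convert hg i using 1
      refine le_antisymm ?_ ?_
      · rintro _ _ ⟨⟨y, hy⟩⟩
        cases (show Le _ _ from hy.le) with
        | mid => exact (lt_irrefl _ hy.lt).elim
        | mid_top _ j =>
          change Presieve.ofArrows (Z i) (g i) ((cotree f g).map hy.le)
          rw [cotree_map f g hy.le (Arr.mid_top i j)]
          exact ⟨j⟩
      · rintro _ _ ⟨j⟩
        have := cotree_map f g (mid_covBy_top i j).le (Arr.mid_top i j)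
        change (cotree f g).predecessors (mid i) (g i j)
        rw [← this]
        exact ⟨(⟨_, mid_covBy_top i j⟩ : {y : TwoLevel ι σ // mid i ⋖ y})⟩
    | top i j => exact (hx ⟨i, j, rfl⟩).elim
  branch_lt b := by
    refine lt_of_lt_of_le ?_ hκ.aleph0_le
    have : Finite (b : Set (TwoLevel ι σ)) := by
      refine Finite.of_injective (fun x => x.1.height) fun x y h => Subtype.ext ?_
      rcases b.le_or_le x.2 y.2 with h' | h'
      · exact eq_of_le_of_height h' (le_of_eq h.symm)
      · exact (eq_of_le_of_height h' (le_of_eq h)).symm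
    exact Cardinal.mk_lt_aleph0
  isLimit x hx := (not_isSuccLimit x hx).elim

/-- Only top vertices are leaves, so a branch that stops earlier, at a vertex with an empty family,
is not live. -/
theorem exists_top_mem (b : (cotree f g).LiveBranch) : ∃ i j, top i j ∈ b.1 := by
  by_contra h
  push Not at h
  by_cases h' : ∃ i, mid i ∈ b.1
  · obtain ⟨i, hi⟩ := h'
    obtain ⟨_, _, h''⟩ := b.2 _ hi (TreeOrder.isMax_of_isMax_flag _ hi fun x hx => by
      rcases b.1.le_or_le hx hi with h' | h'
      · exact h'
      · cases (show Le _ _ from h') with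
        | mid => exact le_rfl
        | mid_top _ j => exact (h _ _ hx).elim)
    cases h''
  · push Not at h'
    obtain ⟨_, _, h''⟩ := b.2 _ b.1.bot_mem (TreeOrder.isMax_of_isMax_flag _ b.1.bot_mem
      fun x hx => by
        cases x with
        | root => exact Le.root _
        | mid i => exact (h' _ hx).elim
        | top i j => exact (h _ _ hx).elim)
    cases h''

/-- The live branches are those below the top vertices, and the limit of such a branch is the object
at its top. -/
theorem comp_mem_treeClosure {κ : Cardinal.{w}} (hκ : κ.IsRegular) {E : Precoverage C}
    (hf : Presieve.ofArrows X f ∈ E S) (hg : ∀ i, Presieve.ofArrows (Z i) (g i) ∈ E (X i)) :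
    Presieve.ofArrows (fun a : Σ i, σ i => Z a.1 a.2) (fun a => g a.1 a.2 ≫ f a.1) ∈
      treeClosure κ E S := by
  have hex (b : (cotree f g).LiveBranch) : ∃ x ∈ b.1, x ∈ (cotree f g).leaf := by
    obtain ⟨i, j, h⟩ := exists_top_mem f g b
    exact ⟨_, h, i, j, rfl⟩
  choose x hx hxl using hex
  have hle (b : (cotree f g).LiveBranch) (y : TwoLevel ι σ) (hy : y ∈ b.1) : y ≤ x b := by
    rcases b.1.le_or_le hy (hx b) with h | h
    · exact h
    · exact (cotree f g).isMax_of_mem_leaf _ (hxl b) h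
  have := mem_treeClosure_of_eq (cotree f g) (isContinuous_cotree f g hκ hf hg) rfl
    (fun b => (cotree f g).obj (x b)) (fun b y hy => (cotree f g).map (hle b y hy)) (fun b =>
      LimOn.of_isGreatest (t := x b) ⟨hx b, fun y hy => hle b y hy⟩ _
        (fun y z hy hz h => (cotree f g).map_comp_map h (hle b z hz)) (by
          have : (cotree f g).map (le_refl (x b)) = 𝟙 _ := (cotree f g).diag.map_id _
          rw [this]
          exact IsIso.id ((cotree f g).obj (x b))))
  simp only [eqToHom_refl, Category.comp_id] at this
  convert this using 1
  refine le_antisymm ?_ ?_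
  · rintro _ _ ⟨⟨i, j⟩⟩
    let b : (cotree f g).LiveBranch := ⟨TreeOrder.flagIic (top i j) (isMax_top _ _),
      fun y hy hm => ⟨i, j, le_antisymm hy (hm hy)⟩⟩
    have H : ∀ y : TwoLevel ι σ, y = x b → Presieve.ofArrows (fun b => (cotree f g).obj (x b))
        (fun b => (cotree f g).map (hle b ⊥ b.1.bot_mem))
        ((cotree f g).map (bot_le : ⊥ ≤ y)) := by
      rintro _ rfl
      exact ⟨b⟩
    have h := H (top i j) (le_antisymm (hle b _ (le_refl (top i j))) (hx b))
    rwa [cotree_map f g _ (Arr.root_top i j)] at h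
  · rintro _ _ ⟨b⟩
    have H : ∀ y ∈ (cotree f g).leaf, Presieve.ofArrows (fun a : Σ i, σ i => Z a.1 a.2)
        (fun a => g a.1 a.2 ≫ f a.1) ((cotree f g).map (bot_le : ⊥ ≤ y)) := by
      rintro _ ⟨i, j, rfl⟩
      rw [cotree_map f g _ (Arr.root_top i j)]
      exact ⟨(⟨i, j⟩ : Σ i, σ i)⟩
    exact H _ (hxl b)

end Cotree

end TwoLevel

end TwoLevel

end KappaTopos

namespace KappaTopos

variable {C : Type u} [Category.{v} C]

/-! ### Pullbacks of cotrees -/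

section Pullback

theorem pbClosure_pbClosure_le (E : Precoverage C) : pbClosure (pbClosure E) ≤ pbClosure E := by
  rintro Y R' ⟨X, g, R, ⟨X₀, g₀, R₀, hR₀, h₁, h₂⟩, h₃, h₄⟩
  refine ⟨X₀, g ≫ g₀, R₀, hR₀, fun P p hp => ?_, fun Z f hf => ?_⟩
  · obtain ⟨Z, f, q, hf, hq⟩ := h₃ p hp
    obtain ⟨Z', f', q', hf', hq'⟩ := h₁ f hf
    exact ⟨Z', f', q ≫ q', hf', hq.paste_vert hq'⟩
  · obtain ⟨P, p, q, hp, hq⟩ := h₂ f hf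
    obtain ⟨P', p', q', hp', hq'⟩ := h₄ p hp
    exact ⟨P', p', q' ≫ q, hp', hq'.paste_vert hq⟩

variable [HasPullbacks C]

namespace Cotree

variable (τ : Cotree.{w} C) {Y : C} (g : Y ⟶ τ.root)

/-- The pullback of the diagram of a cotree along an arrow to the root. -/
noncomputable abbrev pullbackDiag : τ.Tᵒᵖ ⥤ C where
  obj t := pullback (τ.map (bot_le : ⊥ ≤ t.unop)) g
  map {t s} f := pullback.lift (pullback.fst _ _ ≫ τ.diag.map f) (pullback.snd _ _) (by
    have h : τ.diag.map f ≫ τ.map (bot_le : ⊥ ≤ s.unop) = τ.map (bot_le : ⊥ ≤ t.unop) :=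
      τ.map_comp_map _ (leOfHom f.unop)
    rw [Category.assoc, h, pullback.condition])
  map_id t := by
    apply pullback.hom_ext <;> simp
  map_comp f f' := by
    apply pullback.hom_ext
    · refine (pullback.lift_fst _ _ _).trans ?_
      rw [Category.assoc, pullback.lift_fst, ← Category.assoc, pullback.lift_fst, Category.assoc,
        Functor.map_comp]
    · refine (pullback.lift_snd _ _ _).trans ?_
      rw [Category.assoc, pullback.lift_snd, pullback.lift_snd]

/-- A compatible family of arrows into the pulled-back objects is a compatible family into the
original ones together with a single arrow to `Y`: as `⊥` is in `A`, all second components agree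
with the one at the root. -/
theorem pullbackDiag_limOn {A : Set τ.T} (hA : ⊥ ∈ A) {Z : C}
    {p : ∀ a, a ∈ A → (Z ⟶ τ.obj a)} (hp : LimOn τ.diag A p) {P : C} {l : P ⟶ Y} {q : P ⟶ Z}
    (h : IsPullback l q g (p ⊥ hA)) {p' : ∀ a, a ∈ A → (P ⟶ (τ.pullbackDiag g).obj (op a))}
    (h₁ : ∀ a ha, p' a ha ≫ pullback.fst _ _ = q ≫ p a ha)
    (h₂ : ∀ a ha, p' a ha ≫ pullback.snd _ _ = l) : LimOn (τ.pullbackDiag g) A p' where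
  comp_map a b ha hb hab := by
    apply pullback.hom_ext
    · rw [Category.assoc, pullback.lift_fst, ← Category.assoc, h₁, h₁, Category.assoc,
        hp.comp_map a b ha hb hab]
    · rw [Category.assoc, pullback.lift_snd, h₂, h₂]
  existsUnique := by
    intro W k hk
    have hk₁ : ∀ a b (ha : a ∈ A) (hb : b ∈ A) (h : a ≤ b),
        (k b hb ≫ pullback.fst _ _) ≫ τ.diag.map (homOfLE h).op = k a ha ≫ pullback.fst _ _ := by
      intro a b ha hb hab
      rw [← hk a b ha hb hab, Category.assoc, Category.assoc, pullback.lift_fst]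
    have hk₂ : ∀ a (ha : a ∈ A), k a ha ≫ pullback.snd _ _ = k ⊥ hA ≫ pullback.snd _ _ := by
      intro a ha
      rw [← hk ⊥ a hA ha bot_le, Category.assoc]
      exact congr_arg (k a ha ≫ ·) (pullback.lift_snd _ _ _).symm
    obtain ⟨m, hm, hm'⟩ := hp.existsUnique _ hk₁
    have hm₀ : (k ⊥ hA ≫ pullback.snd _ _) ≫ g = m ≫ p ⊥ hA := by
      have h₀ : τ.map (le_refl ⊥) = 𝟙 _ := τ.diag.map_id _
      rw [hm, Category.assoc, ← pullback.condition]
      exact congr_arg (k ⊥ hA ≫ ·) ((congr_arg (pullback.fst _ g ≫ ·) h₀).trans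
        (Category.comp_id _))
    refine ⟨h.lift _ _ hm₀, fun a ha => ?_, fun n hn => h.hom_ext ?_ ?_⟩
    · apply pullback.hom_ext
      · rw [Category.assoc, h₁, ← Category.assoc, h.lift_snd, hm]
      · rw [Category.assoc, h₂, h.lift_fst]
        exact (hk₂ a ha).symm
    · rw [h.lift_fst, ← hn, Category.assoc, h₂]
    · rw [h.lift_snd]
      refine hm' _ fun a ha => ?_
      rw [Category.assoc, ← h₁, ← Category.assoc, hn]

theorem isContinuous_pullback {κ : Cardinal.{w}} {E : Precoverage C} (hE : pbClosure E ≤ E)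
    (hτ : τ.IsContinuous κ E) : (τ.withDiag (τ.pullbackDiag g)).IsContinuous κ E where
  predecessors_mem t ht := by
    have H (s : τ.T) (h : t ≤ s) : IsPullback ((τ.pullbackDiag g).map (homOfLE h).op)
        (pullback.fst (τ.map bot_le) g) (pullback.fst (τ.map bot_le) g) (τ.map h) := by
      refine IsPullback.of_right (h₁₂ := pullback.snd _ _) (h₂₂ := τ.map bot_le) (v₁₃ := g) ?_ ?_ ?_
      · rw [pullback.lift_snd, τ.map_comp_map]
        exact (IsPullback.of_hasPullback _ _).flip
      · exact pullback.lift_fst _ _ _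
      · exact (IsPullback.of_hasPullback _ _).flip
    refine hE _ ⟨_, pullback.fst (τ.map bot_le) g, _, hτ.predecessors_mem t ht, ?_, ?_⟩
    · rintro _ _ ⟨s⟩
      exact ⟨_, _, _, ⟨s⟩, H s.1 s.2.le⟩
    · rintro _ _ ⟨s⟩
      exact ⟨_, _, _, ⟨s⟩, H s.1 s.2.le⟩
  branch_lt := hτ.branch_lt
  isLimit t ht := by
    rw [nonempty_isLimit_coneIio_iff]
    have ht' : (⊥ : τ.T) < t := bot_lt_iff_ne_bot.2 fun h => ht.1 (h ▸ isMin_bot)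
    refine τ.pullbackDiag_limOn g (A := Set.Iio t) ht'
      ((τ.nonempty_isLimit_coneIio_iff t).1 (hτ.isLimit t ht))
      (IsPullback.of_hasPullback (τ.map bot_le) g).flip (fun a ha => ?_) (fun a ha => ?_)
    · exact pullback.lift_fst _ _ _
    · exact pullback.lift_snd _ _ _

end Cotree

/-- A pullback family may contain several isomorphic copies of one leg, whereas a tree family uses
one limit per branch; hence the target `weakTree`. -/
theorem pbClosure_treeClosure_le {κ : Cardinal.{w}} {E : Precoverage C} (hE : pbClosure E ≤ E) :
    pbClosure (treeClosure κ E) ≤ weakTree κ E := by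
  rintro Y R' ⟨X, g, R, hR, h₁, h₂⟩
  obtain ⟨τ, hτ, c⟩ := hR
  have h₀ : τ.map (le_refl ⊥) = 𝟙 _ := τ.diag.map_id _
  have : IsIso (τ.map (bot_le : (⊥ : τ.T) ≤ ⊥)) := h₀ ▸ inferInstance
  have H (b : τ.LiveBranch) {P : C} (l : P ⟶ Y) (q : P ⟶ (c b).cone.pt)
      (h : IsPullback l q g (τ.cocomposition b (c b).cone)) :
      ∃ p' : ∀ a, a ∈ b.1 → (P ⟶ (τ.pullbackDiag g).obj (op a)),
        LimOn (τ.pullbackDiag g) (b.1 : Set τ.T) p' ∧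
          p' ⊥ b.1.bot_mem ≫ pullback.snd _ _ = l := by
    have hp := τ.limOn_of_isLimit (c b).isLimit
    refine ⟨fun a ha => pullback.lift (q ≫ (c b).cone.π.app (op ⟨a, ha⟩)) l ?_,
      τ.pullbackDiag_limOn g (A := (b.1 : Set τ.T)) b.1.bot_mem hp h
        (fun a ha => pullback.lift_fst _ _ _) (fun a ha => pullback.lift_snd _ _ _),
      pullback.lift_snd _ _ _⟩
    exact (Category.assoc _ _ _).trans
      ((congr_arg (q ≫ ·) (hp.comp_map ⊥ a b.1.bot_mem ha bot_le)).trans h.w.symm)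
  refine ⟨τ.withDiag (τ.pullbackDiag g), asIso (pullback.snd (τ.map bot_le) g),
    τ.isContinuous_pullback g hE hτ, fun P l hl => ?_, fun b => ?_⟩
  · obtain ⟨Z, f, q, hf, hq⟩ := h₁ l hl
    obtain ⟨b⟩ := hf
    obtain ⟨p', hp', hp''⟩ := H b l q hq
    exact ⟨b, p', hp', hp''⟩
  · obtain ⟨P, l, q, hl, hq⟩ := h₂ _ ⟨b⟩
    obtain ⟨p', hp', hp''⟩ := H b l q hq
    refine ⟨P, p', hp', ?_⟩
    have : R' (p' ⊥ b.1.bot_mem ≫ pullback.snd _ _) := hp''.symm ▸ hl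
    exact this

end Pullback

/-! ### Closure properties of the generated collection -/

section Bracket

/-- The closure properties of the class of families with which the cotrees are labelled. -/
structure IsPbClosed (E : Precoverage C) : Prop where
  mem_of_isIso : ∀ (X : C) (R : Presieve X), (∃ (Y : C) (f : Y ⟶ X), R f) →
    (∀ (Y : C) (f : Y ⟶ X), R f → IsIso f) → R ∈ E X
  pbClosure_le : pbClosure E ≤ E

/-- A nonempty family of isomorphisms on `X` is a pullback of the identity of the terminal object
along `X ⟶ 1`; this is the role of that family in a `κ`-site. -/
theorem IsKappaSite.isPbClosed {κ : Cardinal.{w}} {E : Precoverage C} (hE : IsKappaSite κ E) :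
    IsPbClosed (pbClosure E) where
  mem_of_isIso X R hR hR' := by
    obtain ⟨T, ⟨hT⟩, h⟩ := hE.exists_terminal
    refine ⟨T, hT.from X, _, h, fun P p hp => ?_, ?_⟩
    · have := hR' _ p hp
      exact ⟨T, 𝟙 T, hT.from P, ⟨⟩, IsPullback.of_horiz_isIso ⟨hT.hom_ext _ _⟩⟩
    · rintro _ _ ⟨⟩
      obtain ⟨P, p, hp⟩ := hR
      have := hR' _ p hp
      exact ⟨P, p, hT.from P, hp, IsPullback.of_horiz_isIso ⟨hT.hom_ext _ _⟩⟩
  pbClosure_le := pbClosure_pbClosure_le E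

/-- Compose `R` with identity families. Smallness of `C` lets the legs of `R` index a tree in the
required universe. -/
theorem mem_treeClosure {κ : Cardinal.{u}} {C : Type u} [SmallCategory C] {E : Precoverage C}
    (hκ : κ.IsRegular) (hE : ∀ X, Presieve.singleton (𝟙 X) ∈ E X) {X : C} {R : Presieve X}
    (hR : R ∈ E X) : R ∈ treeClosure κ E X := by
  have := TwoLevel.comp_mem_treeClosure (ι := R.uncurry) (σ := fun _ => PUnit)
    (X := fun f => f.1.1) (Z := fun f _ => f.1.1)
    (fun f => f.1.2) (fun f _ => 𝟙 _) hκ (E := E) (S := X) ?_ ?_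
  · convert this using 1
    refine le_antisymm (fun Y f hf => ?_) ?_
    · have : Presieve.ofArrows (fun a : Σ _ : R.uncurry, PUnit => a.1.1.1)
        (fun a => 𝟙 a.1.1.1 ≫ a.1.1.2) (𝟙 Y ≫ f) :=
          ⟨(⟨⟨⟨Y, f⟩, hf⟩, ⟨⟩⟩ : Σ _ : R.uncurry, PUnit)⟩
      rwa [Category.id_comp] at this
    · rintro _ _ ⟨⟨⟨f, hf⟩, -⟩⟩
      rw [Category.id_comp]
      exact hf
  · convert hR using 1
    refine le_antisymm ?_ (fun Y f hf => ?_)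
    · rintro _ _ ⟨f⟩
      exact f.2
    · exact ⟨(⟨⟨Y, f⟩, hf⟩ : R.uncurry)⟩
  · intro f
    have h := hE f.1.1
    rwa [← Presieve.ofArrows_pUnit] at h

namespace IsPbClosed

theorem singleton_mem {C : Type u} [SmallCategory C] {E : Precoverage C} (hE : IsPbClosed E)
    {X Y : C} (f : X ⟶ Y) [IsIso f] : Presieve.singleton f ∈ E Y := by
  refine hE.mem_of_isIso _ _ ⟨X, f, ⟨⟩⟩ ?_
  rintro _ _ ⟨⟩
  infer_instance

theorem le_treeClosure {κ : Cardinal.{u}} {C : Type u} [SmallCategory C] {E : Precoverage C}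
    (hE : IsPbClosed E) (hκ : κ.IsRegular) : E ≤ treeClosure κ E :=
  fun _ _ hR => mem_treeClosure hκ (fun _ => hE.singleton_mem _) hR

variable {κ : Cardinal.{u}} {C : Type u} [SmallCategory C] {E : Precoverage C} (hE : IsPbClosed E)
  (hκ : κ.IsRegular)

include hE hκ

theorem treeClosure_weakTree_le : treeClosure κ (weakTree κ E) ≤ treeClosure κ E :=
  KappaTopos.treeClosure_weakTree_le hκ hE.mem_of_isIso hE.pbClosure_le

theorem treeClosure_treeClosure_le : treeClosure κ (treeClosure κ E) ≤ treeClosure κ E :=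
  (treeClosure_mono (treeClosure_le_weakTree κ E)).trans (hE.treeClosure_weakTree_le hκ)

/-- A weak tree family composed with identities is a tree family over `weakTree κ E`, which
idempotence flattens to a tree family with chosen limits. -/
theorem weakTree_le : weakTree κ E ≤ treeClosure κ E := by
  intro X R hR
  exact hE.treeClosure_weakTree_le hκ X (mem_treeClosure hκ (singleton_id_mem_weakTree hκ E) hR)

theorem pbClosure_treeClosure_le [HasPullbacks C] :
    pbClosure (treeClosure κ E) ≤ treeClosure κ E :=
  (KappaTopos.pbClosure_treeClosure_le hE.pbClosure_le).trans (hE.weakTree_le hκ)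

theorem isStableUnderComposition : (treeClosure κ E).IsStableUnderComposition where
  comp_mem_coverings {_ S _} f hf {_ _} g hg :=
    hE.treeClosure_treeClosure_le hκ S (TwoLevel.comp_mem_treeClosure f g hκ hf hg)

theorem isStableUnderBaseChange [HasPullbacks C] :
    (treeClosure κ E).IsStableUnderBaseChange where
  mem_coverings_of_isPullback {ι S X} f hf {Y} g {P} p₁ p₂ h := by
    refine hE.pbClosure_treeClosure_le hκ Y ⟨S, g, _, hf, ?_, ?_⟩
    · rintro _ _ ⟨i⟩
      exact ⟨_, _, p₂ i, ⟨i⟩, h i⟩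
    · rintro _ _ ⟨i⟩
      exact ⟨_, _, p₂ i, ⟨i⟩, h i⟩

theorem isGrothendieckTopology [HasPullbacks C] :
    IsGrothendieckTopology (treeClosure κ E) := by
  have h₁ : (treeClosure κ E).HasIsos :=
    ⟨fun f _ => hE.le_treeClosure hκ _ (hE.singleton_mem f)⟩
  have h₂ := hE.isStableUnderComposition hκ
  have h₃ := hE.isStableUnderBaseChange hκ
  exact ⟨h₁, h₃, h₂, fun _ _ => Precoverage.mem_toGrothendieck_iff_of_isStableUnderComposition⟩

end IsPbClosed

end Bracket

end KappaTopos

namespace KappaTopos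

/-! ### Path lifting for cotrees of presheaves -/

section Path

variable {C : Type u} [SmallCategory C]

/-- The properties of a cotree of presheaves, relative to a class of families `K`, which hold when
the cotree is a continuous cotree of sheaves. -/
structure IsLocallyContinuous (κ : Cardinal.{u}) (K : Precoverage C)
    (τ : Cotree.{u} (Cᵒᵖ ⥤ Type u)) : Prop where
  exists_cover : ∀ t ∉ τ.leaf, ∀ (V : C) (y : (τ.obj t).obj (op V)), ∃ R ∈ K V,
    ∀ (W : C) (f : W ⟶ V), R f → ∃ (s : τ.T) (h : t ⋖ s) (z : (τ.obj s).obj (op W)),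
      (τ.map h.le).app (op W) z = (τ.obj t).map f.op y
  branch_lt : ∀ b : Flag τ.T, Cardinal.mk (b : Set τ.T) < κ
  exists_lift : ∀ t : τ.T, Order.IsSuccLimit t → ∀ (V : C)
    (y : ∀ s, s < t → (τ.obj s).obj (op V)),
    (∀ r s (h : r ≤ s) (hs : s < t), (τ.map h).app (op V) (y s hs) = y r (h.trans_lt hs)) →
    ∃ z : (τ.obj t).obj (op V), ∀ s (hs : s < t), (τ.map hs.le).app (op V) z = y s hs

variable (τ : Cotree.{u} (Cᵒᵖ ⥤ Type u))

/-- The labels of the tree of local lifts of an element of the root of a cotree of presheaves. -/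
structure PathLabel (t : τ.T) : Type u where
  /-- the domain -/
  dom : C
  /-- the local lift -/
  elt : (τ.obj t).obj (op dom)
  /-- the arrows to the domains at the lower vertices -/
  arr : ∀ _ : τ.T, Σ W : C, (dom ⟶ W)

variable (σ : ∀ (t : τ.T) (V : C), (τ.obj t).obj (op V) → Presieve V)
  {U : C} (x : (τ.obj ⊥).obj (op U))

/-- The label at the root. -/
def rootLabel : PathLabel τ ⊥ := ⟨U, x, fun _ => ⟨U, 𝟙 U⟩⟩

variable {τ}

/-- The conditions on the label at a vertex of the tree of local lifts. -/
structure IsPath (s : τ.T) (l : ∀ r, r < s → PathLabel τ r) (a : PathLabel τ s) : Prop where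
  id : a.arr s = ⟨a.dom, 𝟙 _⟩
  -- The targets of the arrows in a label are not fixed by its type, which keeps labels independent
  -- of one another; equalities in the sigma type say that these targets are the lower domains.
  exists_arr : ∀ r (hr : r < s), ∃ f, a.arr r = ⟨(l r hr).dom, f⟩
  comp : ∀ r q (hrq : r < q) (hq : q < s) f g,
    (l q hq).arr r = ⟨(l r (hrq.trans hq)).dom, f⟩ → a.arr q = ⟨(l q hq).dom, g⟩ →
    a.arr r = ⟨(l r (hrq.trans hq)).dom, g ≫ f⟩
  map_elt : ∀ r (hr : r < s) f, a.arr r = ⟨(l r hr).dom, f⟩ →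
    (τ.map hr.le).app (op a.dom) a.elt = (τ.obj r).map f.op (l r hr).elt
  step : ∀ r (hr : r ⋖ s) f, a.arr r = ⟨(l r hr.lt).dom, f⟩ →
    σ r (l r hr.lt).dom (l r hr.lt).elt f
  -- At a limit stage the domain must be a limit of the lower domains, which makes the tree of lifts
  -- a continuous cotree.
  limit : Order.IsSuccLimit s → ∀ (W : C) (k : ∀ r (hr : r < s), W ⟶ (l r hr).dom),
    (∀ r q (hrq : r < q) (hq : q < s) f, (l q hq).arr r = ⟨(l r (hrq.trans hq)).dom, f⟩ →
      k q hq ≫ f = k r (hrq.trans hq)) →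
    ∃! m : W ⟶ a.dom, ∀ r (hr : r < s) f, a.arr r = ⟨(l r hr).dom, f⟩ → m ≫ f = k r hr
  root : s = ⊥ → HEq a (rootLabel τ x)

theorem isPath_bot (l : ∀ r, r < (⊥ : τ.T) → PathLabel τ r) :
    IsPath σ x ⊥ l (rootLabel τ x) where
  id := rfl
  exists_arr _ hr := (not_lt_bot hr).elim
  comp _ _ _ hq := (not_lt_bot hq).elim
  map_elt _ hr := (not_lt_bot hr).elim
  step _ hr := (not_lt_bot hr.lt).elim
  limit h := (h.1 isMin_bot).elim
  root _ := HEq.rfl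

variable {σ x} in
theorem isPath_extendLabel {t : τ.T} {l : ∀ r, r < t → PathLabel τ r} {a : PathLabel τ t}
    (h : IsPath σ x t l a) : IsPath σ x t (fun r hr => Thread.extendLabel l a r hr.le)
      (Thread.extendLabel l a t le_rfl) := by
  rw [Thread.extendLabel_self]
  convert h
  exact Thread.extendLabel_of_lt _ _ _ _

/-- The tree of local lifts of an element of the root. -/
abbrev PathTree : Type u :=
  Thread (PathLabel τ) (fun s l => IsPath σ x s (fun r hr => l r hr.le) (l s le_rfl))

namespace PathTree

noncomputable instance : OrderBot (PathTree σ x) :=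
  Thread.orderBot (fun r hr => (le_bot_iff.1 hr).symm ▸ rootLabel τ x) (by
    intro l
    constructor
    · intro h
      funext r hr
      obtain rfl := le_bot_iff.1 hr
      exact eq_of_heq (h.root rfl)
    · rintro rfl
      exact isPath_bot σ x _)

variable {σ x}

/-- The last label. -/
def top (p : PathTree σ x) : PathLabel τ p.pt := p.label p.pt le_rfl

theorem isPath (p : PathTree σ x) :
    IsPath σ x p.pt (fun r hr => p.label r hr.le) p.top := p.valid p.pt le_rfl

/-- The relation between threads defining the diagram of the tree of local lifts. -/
def Rel (p q : PathTree σ x) (f : q.top.dom ⟶ p.top.dom) : Prop :=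
  p ≤ q ∧ q.top.arr p.pt = ⟨p.top.dom, f⟩

theorem label_eq_top {p q : PathTree σ x} (h : p ≤ q) : q.label p.pt h.1 = p.top :=
  h.2 p.pt le_rfl

theorem exists_rel {p q : PathTree σ x} (h : p ≤ q) : ∃ f, Rel p q f := by
  rcases h.eq_or_lt with rfl | h'
  · exact ⟨𝟙 _, h, p.isPath.id⟩
  · have := q.isPath.exists_arr p.pt (Thread.pt_lt h')
    rw [label_eq_top h] at this
    obtain ⟨f, hf⟩ := this
    exact ⟨f, h, hf⟩

theorem Rel.eq {p q : PathTree σ x} {f g : q.top.dom ⟶ p.top.dom} (hf : Rel p q f)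
    (hg : Rel p q g) : f = g :=
  eq_of_heq (Sigma.mk.inj (hf.2.symm.trans hg.2)).2

theorem rel_id (p : PathTree σ x) : Rel p p (𝟙 _) := ⟨le_rfl, p.isPath.id⟩

theorem Rel.comp {p q r : PathTree σ x} {f : q.top.dom ⟶ p.top.dom} {g : r.top.dom ⟶ q.top.dom}
    (hf : Rel p q f) (hg : Rel q r g) : Rel p r (g ≫ f) := by
  rcases hf.1.eq_or_lt with rfl | h
  · obtain rfl := hf.eq (rel_id _)
    rwa [Category.comp_id]
  rcases hg.1.eq_or_lt with rfl | h'
  · obtain rfl := hg.eq (rel_id _)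
    rwa [Category.id_comp]
  refine ⟨hf.1.trans hg.1, ?_⟩
  have := r.isPath.comp p.pt q.pt (Thread.pt_lt h) (Thread.pt_lt h')
  rw [label_eq_top hg.1, label_eq_top (hf.1.trans hg.1)] at this
  exact this f g hf.2 hg.2

variable (σ x) in
/-- The cotree of local lifts. -/
noncomputable abbrev cotree : Cotree.{u} C where
  T := PathTree σ x
  wellFounded := TreeOrder.wellFounded
  isChain_Iic := TreeOrder.isChain_Iic
  diag := diagOfRel (fun p => p.top.dom) Rel (fun _ _ h => exists_rel h)
    (fun _ _ _ _ h h' => h.eq h') rel_id (fun _ _ _ _ _ h h' => h.comp h')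
  leaf := {p | p.pt ∈ τ.leaf}
  isMax_of_mem_leaf p hp q hq := by
    refine Thread.le_of_pt_le le_rfl hq ?_
    exact τ.isMax_of_mem_leaf _ hp hq.1

theorem rel_map {p q : PathTree σ x} (h : p ≤ q) : Rel p q ((cotree σ x).map h) :=
  (exists_rel h).choose_spec

theorem map_eq {p q : PathTree σ x} (h : p ≤ q) {f : q.top.dom ⟶ p.top.dom} (hf : Rel p q f) :
    (cotree σ x).map h = f := (rel_map h).eq hf

theorem app_map {p q : PathTree σ x} (h : p ≤ q) :
    (τ.map h.1).app (op q.top.dom) q.top.elt =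
      (τ.obj p.pt).map ((cotree σ x).map h).op p.top.elt := by
  rcases h.eq_or_lt with rfl | h'
  · rw [map_eq h (rel_id p)]
    have h₁ : τ.map (le_refl p.pt) = 𝟙 _ := τ.diag.map_id _
    simp [h₁]
  · have h₂ := (rel_map h).2
    have h₁ := q.isPath.map_elt p.pt (Thread.pt_lt h')
    rw [label_eq_top h] at h₁
    exact h₁ _ h₂

/-- A lift `z` over a leg `f` of the chosen cover becomes a valid label once `f` is composed with
the arrows carried by `p`. -/
theorem predecessors_of (p : PathTree σ x) {s : τ.T} (hs : p.pt ⋖ s) {W : C}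
    {f : W ⟶ p.top.dom} (hf : σ p.pt p.top.dom p.top.elt f) (z : (τ.obj s).obj (op W))
    (hz : (τ.map hs.le).app (op W) z = (τ.obj p.pt).map f.op p.top.elt) :
    (cotree σ x).predecessors p f := by
  classical
  -- Only the values at the vertices `≤ s` are subject to conditions.
  let a : PathLabel τ s := ⟨W, z, fun r => if r = s then ⟨W, 𝟙 W⟩ else
    ⟨(p.top.arr r).1, f ≫ (p.top.arr r).2⟩⟩
  have ha (r) (hr : r ≤ p.pt) (g : p.top.dom ⟶ (p.label r hr).dom)
      (hg : p.top.arr r = ⟨(p.label r hr).dom, g⟩) : a.arr r = ⟨(p.label r hr).dom, f ≫ g⟩ := by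
    refine (if_neg (hr.trans_lt hs.lt).ne).trans ?_
    rw [hg]
  have H (r) (hr : r ≤ p.pt) : ∃ g : p.top.dom ⟶ (p.label r hr).dom,
      p.top.arr r = ⟨(p.label r hr).dom, g⟩ ∧ (τ.map hr).app _ p.top.elt =
        (τ.obj r).map g.op (p.label r hr).elt := by
    refine ⟨_, (rel_map (Thread.restrict_le p r hr)).2, ?_⟩
    exact app_map (Thread.restrict_le p r hr)
  have key : IsPath σ x s
      (fun r hr => p.label r (TreeOrder.le_of_lt_of_covBy hr hs)) a := by
    constructor
    · exact if_pos rfl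
    · intro r hr
      obtain ⟨g, hg, -⟩ := H r (TreeOrder.le_of_lt_of_covBy hr hs)
      exact ⟨_, ha r _ g hg⟩
    · intro r q hrq hq g g' h h'
      have hq' := TreeOrder.le_of_lt_of_covBy hq hs
      obtain ⟨k, hk, -⟩ := H q hq'
      obtain rfl : f ≫ k = g' := eq_of_heq (Sigma.mk.inj ((ha q _ k hk).symm.trans h')).2
      rw [Category.assoc]
      refine ha r _ _ ?_
      have h₁ : Rel (p.restrict r (hrq.le.trans hq')) (p.restrict q hq') g :=
        ⟨⟨hrq.le, fun _ _ => rfl⟩, h⟩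
      have h₂ : Rel (p.restrict q hq') p k := ⟨Thread.restrict_le _ _ _, hk⟩
      exact (h₁.comp h₂).2
    · intro r hr g hg
      obtain ⟨k, hk, hk'⟩ := H r (TreeOrder.le_of_lt_of_covBy hr hs)
      obtain rfl : f ≫ k = g := eq_of_heq (Sigma.mk.inj ((ha r _ k hk).symm.trans hg)).2
      have h₁ : τ.map hr.le =
        τ.map hs.le ≫ τ.map (TreeOrder.le_of_lt_of_covBy hr hs) := (τ.map_comp_map _ _).symm
      rw [h₁, NatTrans.comp_app, comp_apply]
      erw [hz]
      rw [NatTrans.naturality_apply, hk']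
      simp
    · intro r hr g hg
      obtain rfl := TreeOrder.covBy_left_unique hs hr
      obtain rfl : f ≫ 𝟙 _ = g :=
        eq_of_heq (Sigma.mk.inj ((ha _ le_rfl _ p.isPath.id).symm.trans hg)).2
      rw [Category.comp_id]
      exact hf
    · intro h
      exact (h.2 _ hs).elim
    · rintro rfl
      exact (not_lt_bot hs.lt).elim
  obtain ⟨q, hq, hq₁, hq₂⟩ := p.exists_extend hs a (by
    exact isPath_extendLabel key)
  obtain rfl := hq₁
  have hq₃ : PathTree.top q = a := hq₂
  have key' (b : PathLabel τ q.pt) (hb : PathTree.top q = b) (g : b.dom ⟶ p.top.dom)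
      (hg : b.arr p.pt = ⟨p.top.dom, g⟩) : (cotree σ x).predecessors p g := by
    subst hb
    have : (cotree σ x).map hq.le = g := map_eq hq.le ⟨hq.le, hg⟩
    rw [← this]
    exact ⟨(⟨q, hq⟩ : {q : PathTree σ x // p ⋖ q})⟩
  exact key' a hq₃ f ((ha p.pt le_rfl _ p.isPath.id).trans
    (congr_arg (Sigma.mk _) (Category.comp_id f)))

theorem predecessors_le (p : PathTree σ x) :
    (cotree σ x).predecessors p ≤ σ p.pt p.top.dom p.top.elt := by
  rintro _ _ ⟨q⟩
  obtain ⟨q, hq⟩ := q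
  have h := (rel_map hq.le).2
  have := q.isPath.step p.pt (Thread.covBy_iff.1 hq).2
  rw [label_eq_top hq.le] at this
  exact this _ h

/-- The step condition keeps the predecessors inside the chosen cover, and the lifts in `hσ'` make
every leg of it occur, so the predecessors of a vertex are exactly that cover. -/
theorem isContinuous {κ : Cardinal.{u}} {K : Precoverage C} (hτ : IsLocallyContinuous κ K τ)
    (hσ : ∀ t ∉ τ.leaf, ∀ V y, σ t V y ∈ K V)
    (hσ' : ∀ t ∉ τ.leaf, ∀ V y (W : C) (f : W ⟶ V), σ t V y f →
      ∃ (s : τ.T) (h : t ⋖ s) (z : (τ.obj s).obj (op W)),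
        (τ.map h.le).app (op W) z = (τ.obj t).map f.op y) :
    (cotree σ x).IsContinuous κ K where
  predecessors_mem p hp := by
    have h : (cotree σ x).predecessors p = σ p.pt p.top.dom p.top.elt := by
      refine le_antisymm p.predecessors_le fun W f hf => ?_
      obtain ⟨s, hs, z, hz⟩ := hσ' _ hp _ _ _ f hf
      exact p.predecessors_of hs hf z hz
    rw [h]
    exact hσ _ hp _ _
  branch_lt b := (Thread.mk_flag b).trans_lt (Thread.mk_support_lt hτ.branch_lt)
  isLimit p hp := by
    rw [Cotree.nonempty_isLimit_coneIio_iff]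
    have hp' := p.isPath.limit (Thread.isSuccLimit_pt hp)
    refine ⟨fun q r hq hr hqr => (cotree σ x).map_comp_map _ _, fun {W} k hk => ?_⟩
    have h₀ (r) (hr : r < p.pt) : p.restrict r hr.le < p :=
      Thread.lt_of_le_of_pt_lt (p.restrict_le r hr.le) hr
    obtain ⟨m, hm, hm'⟩ := hp' W (fun r hr => k (p.restrict r hr.le) (h₀ r hr)) (by
      intro r q hrq hq f hf
      have h : p.restrict r (hrq.trans hq).le ≤ p.restrict q hq.le := ⟨hrq.le, fun _ _ => rfl⟩
      have := hk _ _ (h₀ r (hrq.trans hq)) (h₀ q hq) h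
      rw [← this]
      exact congr_arg (k _ _ ≫ ·) (map_eq h ⟨h, hf⟩).symm)
    have key (n : W ⟶ p.top.dom) : (∀ q (hq : q < p), n ≫ (cotree σ x).map hq.le = k q hq) ↔
        ∀ r (hr : r < p.pt) f, p.top.arr r = ⟨(p.label r hr.le).dom, f⟩ →
          n ≫ f = k (p.restrict r hr.le) (h₀ r hr) := by
      constructor
      · intro h r hr f hf
        rw [← h _ (h₀ r hr)]
        exact congr_arg (n ≫ ·) (map_eq (h₀ r hr).le ⟨(h₀ r hr).le, hf⟩).symm
      · intro h q hq
        obtain ⟨r, hr, rfl⟩ : ∃ r, ∃ hr : r < p.pt, q = p.restrict r hr.le :=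
          ⟨q.pt, Thread.pt_lt hq, Thread.eq_of_pt_eq hq.le (p.restrict_le _ _) rfl⟩
        exact h r hr _ (rel_map hq.le).2
    exact ⟨m, (key m).2 hm, fun n hn => hm' n ((key n).1 hn)⟩

section Branch

variable (b : Flag (PathTree σ x)) {W : C} {π : ∀ p, p ∈ b → (W ⟶ p.top.dom)}

variable {b}

theorem exists_mem_flag {t : τ.T} (ht : t ∈ Thread.support b) :
    ∃ (l : ∀ r, r ≤ t → PathLabel τ r) (h : _), (⟨t, l, h⟩ : PathTree σ x) ∈ b := by
  obtain ⟨⟨t, l, h⟩, hp, rfl⟩ := ht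
  exact ⟨l, h, hp⟩

/-- The thread in a branch which ends at a given vertex. -/
noncomputable def threadAt (t : τ.T) (ht : t ∈ Thread.support b) : PathTree σ x :=
  ⟨t, (exists_mem_flag ht).choose, (exists_mem_flag ht).choose_spec.choose⟩

theorem threadAt_mem (t : τ.T) (ht : t ∈ Thread.support b) : threadAt t ht ∈ b :=
  (exists_mem_flag ht).choose_spec.choose_spec

theorem threadAt_mono {s t : τ.T} (hs : s ∈ Thread.support b) (ht : t ∈ Thread.support b)
    (h : s ≤ t) : threadAt s hs ≤ threadAt t ht :=
  Thread.le_of_chain b.chain_le (threadAt_mem s hs) (threadAt_mem t ht) h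

theorem glue_eq (t : τ.T) (ht : t ∈ Thread.support b) :
    Thread.glue t ht = (threadAt t ht).top :=
  (Thread.label_eq_glue (threadAt_mem t ht) t le_rfl ht).symm

/-- The lifts of `x` to the vertices of a branch, restricted to an object over the branch. -/
noncomputable def lift (π : ∀ p, p ∈ b → (W ⟶ p.top.dom)) (t : τ.T)
    (ht : t ∈ Thread.support b) : (τ.obj t).obj (op W) :=
  (τ.obj t).map (π _ (threadAt_mem t ht)).op (threadAt t ht).top.elt

theorem map_lift (hπ : ∀ p q (hp : p ∈ b) (hq : q ∈ b) (h : p ≤ q),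
      π q hq ≫ (cotree σ x).map h = π p hp) {s t : τ.T} (h : s ≤ t)
    (hs : s ∈ Thread.support b) (ht : t ∈ Thread.support b) :
    (τ.map h).app (op W) (lift π t ht) = lift π s hs := by
  have h' := threadAt_mono hs ht h
  rw [lift, lift, ← hπ _ _ (threadAt_mem s hs) (threadAt_mem t ht) h']
  refine (NatTrans.naturality_apply (τ.map h) _ _).trans ?_
  refine (congr_arg ((τ.obj s).map _) (app_map h')).trans ?_
  exact (Functor.map_comp_apply (τ.obj s) _ _ _).symm

theorem lift_bot (h : (⊥ : τ.T) ∈ Thread.support b) :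
    lift π ⊥ h = (τ.obj ⊥).map (π ⊥ b.bot_mem).op x := by
  have (p : PathTree σ x) (hp : p ∈ b) (hp' : p = ⊥) : HEq ((τ.obj p.pt).map (π p hp).op p.top.elt)
      ((τ.obj ⊥).map (π ⊥ b.bot_mem).op x) := by
    subst hp'
    rfl
  refine eq_of_heq (this _ (threadAt_mem _ h) ?_)
  exact le_antisymm (Thread.le_of_chain b.chain_le (threadAt_mem _ h) b.bot_mem le_rfl) bot_le

/-- Over the limit `W` of the branch the successive lifts are compatible, hence lift to a section at
`t`. With `W` and its projections this section is a valid label at `t`, and the branch could be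
extended. -/
theorem not_isSuccLimit {κ : Cardinal.{u}} {K : Precoverage C} (hτ : IsLocallyContinuous κ K τ)
    (hπ : LimOn (cotree σ x).diag (b : Set (PathTree σ x)) π) {t : τ.T}
    (ht : Set.Iio t = Thread.support b) : ¬ Order.IsSuccLimit t := by
  intro hl
  obtain ⟨z, hz⟩ := hτ.exists_lift t hl W (fun s hs => lift π s (ht.le hs))
    (fun r s h hs => map_lift hπ.comp_map h (ht.le (h.trans_lt hs)) (ht.le hs))
  classical
  -- The default value matters at `t` itself, which is outside the support and where the identity is
  -- required.
  let a : PathLabel τ t := ⟨W, z, fun r => if h : r ∈ Thread.support b then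
    ⟨_, π _ (threadAt_mem r h)⟩ else ⟨W, 𝟙 W⟩⟩
  have ha (r) (hr : r < t) : a.arr r = ⟨_, π _ (threadAt_mem r (ht.le hr))⟩ := dif_pos (ht.le hr)
  have ha' (r) (hr : r < t) (f) (hf : a.arr r = ⟨(threadAt r (ht.le hr)).top.dom, f⟩) :
      f = π _ (threadAt_mem r (ht.le hr)) :=
    eq_of_heq (Sigma.mk.inj (hf.symm.trans (ha r hr))).2
  have hrel {r q} (hrq : r < q) (hq : q < t) (f)
      (hf : (threadAt q (ht.le hq)).top.arr r =
        ⟨(threadAt r (ht.le (hrq.trans hq))).top.dom, f⟩) :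
      f = (cotree σ x).map (threadAt_mono (ht.le (hrq.trans hq)) (ht.le hq) hrq.le) :=
    (map_eq _ ⟨threadAt_mono (ht.le (hrq.trans hq)) (ht.le hq) hrq.le, hf⟩).symm
  have key : IsPath σ x t (fun r hr => (threadAt r (ht.le hr)).top) a := by
    constructor
    · exact dif_neg fun h => lt_irrefl t (ht.ge h)
    · exact fun r hr => ⟨_, ha r hr⟩
    · intro r q hrq hq f g hf hg
      rw [ha' q hq g hg, hrel hrq hq f hf]
      refine (ha r (hrq.trans hq)).trans (congr_arg (Sigma.mk _) ?_)
      exact (hπ.comp_map _ _ _ _ _).symm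
    · intro r hr f hf
      rw [ha' r hr f hf]
      exact hz r hr
    · exact fun r hr => (hl.2 r hr).elim
    · intro _ Z k hk
      have h₀ {p : PathTree σ x} (hp : p ∈ b) : ∃ (r : τ.T) (hr : r < t),
          p = threadAt r (ht.le hr) := by
        have hp' := ht.ge (Thread.pt_mem_support hp)
        refine ⟨p.pt, hp', ?_⟩
        have h := threadAt_mem p.pt (ht.le hp')
        exact le_antisymm (Thread.le_of_chain b.chain_le hp h le_rfl)
          (Thread.le_of_chain b.chain_le h hp le_rfl)
      have h₁ (p : PathTree σ x) (hp : p ∈ b) : ∃ f : Z ⟶ p.top.dom, ∀ r (hr : r < t) g,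
          Rel (threadAt r (ht.le hr)) p g → f ≫ g = k r hr := by
        obtain ⟨q, hq, rfl⟩ := h₀ hp
        refine ⟨k q hq, fun r hr g hg => ?_⟩
        rcases hg.1.1.eq_or_lt with h | h
        · obtain rfl : r = q := h
          obtain rfl := hg.eq (rel_id _)
          exact Category.comp_id _
        · exact hk r q h hq g hg.2
      choose k' hk' using h₁
      have h₂ (r) (hr : r < t) : k' _ (threadAt_mem r (ht.le hr)) = k r hr :=
        (Category.comp_id _).symm.trans (hk' _ (threadAt_mem r (ht.le hr)) r hr _ (rel_id _))
      obtain ⟨m, hm, hm'⟩ := hπ.existsUnique k' (by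
        intro p q hp hq hpq
        obtain ⟨r, hr, rfl⟩ := h₀ hp
        exact (hk' q hq r hr _ (rel_map hpq)).trans (h₂ r hr).symm)
      refine ⟨m, fun r hr f hf => ?_, fun n hn => hm' n fun p hp => ?_⟩
      · rw [ha' r hr f hf, ← h₂ r hr]
        exact hm _ _
      · obtain ⟨r, hr, rfl⟩ := h₀ hp
        exact (hn r hr _ (ha r hr)).trans (h₂ r hr).symm
    · rintro rfl
      exact (hl.1 isMin_bot).elim
  refine Thread.not_ok_extendLabel ht a (isPath_extendLabel ?_)
  exact (congr_arg (fun l => IsPath σ x t l a)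
    (funext fun r => funext fun hr => glue_eq r (ht.le hr))).mpr key

/-- If the support of `b` is a branch of `τ`, the lifts along it are the required sections, and it
is live because `b` is. Otherwise the support is `Set.Iio t`: if `t` covers some `r`, then `b` ends
over `r`, which would be a leaf below `t`; a limit `t` is excluded by `not_isSuccLimit`. -/
theorem exists_liveBranch {κ : Cardinal.{u}} {K : Precoverage C} (hτ : IsLocallyContinuous κ K τ)
    (b : (cotree σ x).LiveBranch) {π : ∀ p, p ∈ b.1 → (W ⟶ (cotree σ x).obj p)}
    (hπ : LimOn (cotree σ x).diag (b.1 : Set (PathTree σ x)) π) :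
    ∃ (c : τ.LiveBranch) (y : ∀ t, t ∈ c.1 → (τ.obj t).obj (op W)),
      (∀ s t (hs : s ∈ c.1) (ht : t ∈ c.1) (h : s ≤ t),
        (τ.map h).app (op W) (y t ht) = y s hs) ∧
      y ⊥ c.1.bot_mem = (τ.obj ⊥).map (π ⊥ b.1.bot_mem).op x := by
  obtain ⟨(b : Flag (PathTree σ x)), hb⟩ := b
  have hb' (p : PathTree σ x) (hp : p ∈ b) (h : ∀ q : PathTree σ x, p ≤ q → q.pt ≤ p.pt) :
      p.pt ∈ τ.leaf := hb p hp fun q hq => Thread.le_of_pt_le le_rfl hq (h q hq)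
  rcases Thread.support_cases b with ⟨c, hc⟩ | ⟨t, ht⟩
  · refine ⟨⟨c, fun t ht hm => ?_⟩, fun t ht => lift π t (hc.le ht), fun s t hs ht h =>
      map_lift hπ.comp_map h (hc.le hs) (hc.le ht), lift_bot (hc.le c.bot_mem)⟩
    obtain ⟨p, hp, rfl⟩ := hc.le ht
    exact hb' p hp fun q hq => hm hq.1
  · exfalso
    have h₀ : ⊥ < t := ht.ge (Thread.pt_mem_support b.bot_mem)
    rcases TreeOrder.bot_or_covBy_or_isSuccLimit t with rfl | ⟨r, hr⟩ | hl
    · exact lt_irrefl _ h₀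
    · have hp := threadAt_mem r (ht.le hr.lt)
      refine hr.lt.not_ge (τ.isMax_of_mem_leaf r (hb' _ hp fun q hq => ?_) hr.le)
      have hq' : q ∈ b := TreeOrder.mem_flag_of_forall_lt b fun p hp' =>
        (Thread.le_of_chain b.chain_le hp' hp
          (TreeOrder.le_of_lt_of_covBy (ht.ge (Thread.pt_mem_support hp')) hr)).trans hq
      exact TreeOrder.le_of_lt_of_covBy (ht.ge (Thread.pt_mem_support hq')) hr
    · exact not_isSuccLimit hτ hπ ht hl

end Branch

end PathTree

/-- Locally, an element of the root of a cotree lifts to a live branch. -/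
theorem IsLocallyContinuous.exists_liveBranch {κ : Cardinal.{u}} {K : Precoverage C}
    (hκ : κ.IsRegular) (hC : IsKappaLex κ C) (hK : treeClosure κ K ≤ K)
    (hτ : IsLocallyContinuous κ K τ) {U : C} (x : (τ.obj ⊥).obj (op U)) :
    ∃ R ∈ K U, ∀ (W : C) (f : W ⟶ U), R f →
      ∃ (c : τ.LiveBranch) (y : ∀ t, t ∈ c.1 → (τ.obj t).obj (op W)),
        (∀ s t (hs : s ∈ c.1) (ht : t ∈ c.1) (h : s ≤ t),
          (τ.map h).app (op W) (y t ht) = y s hs) ∧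
        y ⊥ c.1.bot_mem = (τ.obj ⊥).map f.op x := by
  have hσ (t : τ.T) (V : C) (y : (τ.obj t).obj (op V)) : ∃ R : Presieve V, t ∉ τ.leaf →
      R ∈ K V ∧ ∀ (W : C) (f : W ⟶ V), R f → ∃ (s : τ.T) (h : t ⋖ s)
        (z : (τ.obj s).obj (op W)), (τ.map h.le).app (op W) z = (τ.obj t).map f.op y := by
    by_cases ht : t ∈ τ.leaf
    · exact ⟨⊤, fun h => (h ht).elim⟩
    · obtain ⟨R, hR, h⟩ := hτ.exists_cover t ht V y
      exact ⟨R, fun _ => ⟨hR, h⟩⟩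
  choose σ hσ using hσ
  have h := PathTree.isContinuous (x := x) hτ (fun t ht V y => (hσ t V y ht).1)
    (fun t ht V y => (hσ t V y ht).2)
  have hc (b : (PathTree.cotree σ x).LiveBranch) :
      HasLimit ((PathTree.cotree σ x).branch b) :=
    Cotree.hasLimit_restrict _ hκ hC _ (h.branch_lt b.1)
  refine ⟨_, hK _ ⟨_, h, fun b => getLimitCone _⟩, ?_⟩
  rintro _ _ ⟨b⟩
  exact PathTree.exists_liveBranch hτ b (Cotree.limOn_of_isLimit _ (limit.isLimit _))

end Path

end KappaTopos

namespace KappaTopos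

/-! ### Extremal epimorphic families of sheaves -/

section SheafEmbedding

variable {C : Type u} [SmallCategory C] {𝓔 : Type u'} [Category.{u} 𝓔]

/-- The properties of the inclusion of sheaves into presheaves. -/
structure IsSheafEmbedding (J : GrothendieckTopology C) (Φ : 𝓔 ⥤ Cᵒᵖ ⥤ Type u) : Prop where
  full : Φ.Full
  faithful : Φ.Faithful
  preservesLimits : PreservesLimitsOfSize.{u, u} Φ
  isSheaf : ∀ X, Presieve.IsSheaf J (Φ.obj X)
  mem_essImage : ∀ P, Presieve.IsSheaf J P → ∃ X, Nonempty (Φ.obj X ≅ P)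

/-- The elements which lie in the image of some member of a family of arrows. -/
def imageSubfunctor (Φ : 𝓔 ⥤ Cᵒᵖ ⥤ Type u) {X : 𝓔} (R : Presieve X) : Subfunctor (Φ.obj X) where
  obj U := {x | ∃ (Z : 𝓔) (f : Z ⟶ X) (z : (Φ.obj Z).obj U), R f ∧ (Φ.map f).app U z = x}
  map g := by
    rintro _ ⟨Z, f, z, hf, rfl⟩
    exact ⟨Z, f, (Φ.obj Z).map g z, hf, NatTrans.naturality_apply _ _ _⟩

/-- A family of arrows is locally surjective. -/
def IsLocallySurjective (J : GrothendieckTopology C) (Φ : 𝓔 ⥤ Cᵒᵖ ⥤ Type u) {X : 𝓔}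
    (R : Presieve X) : Prop :=
  ∀ (U : Cᵒᵖ) (x : (Φ.obj X).obj U), x ∈ ((imageSubfunctor Φ R).sheafify J).obj U

namespace IsSheafEmbedding

variable {J : GrothendieckTopology C} {Φ : 𝓔 ⥤ Cᵒᵖ ⥤ Type u} (hΦ : IsSheafEmbedding J Φ)

include hΦ

/-- If `R` factors through a monomorphism `m`, the image of `m` is a subsheaf to which every section
belongs locally, hence globally. -/
theorem isExtremalEpiFamily_of_isLocallySurjective {X : 𝓔} {R : Presieve X}
    (hR : IsLocallySurjective J Φ R) : IsExtremalEpiFamily R := by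
  intro S m hm h
  have := hΦ.preservesLimits
  have := hΦ.full
  have := hΦ.faithful
  have hm' (U) : Function.Injective ((Φ.map m).app U) :=
    (mono_iff_injective _).1 inferInstance
  have hs : Presieve.IsSheaf J (Subfunctor.range (Φ.map m)).toFunctor := by
    have : IsIso (Subfunctor.toRange (Φ.map m)) := by
      rw [NatTrans.isIso_iff_isIso_app]
      intro U
      rw [isIso_iff_bijective]
      refine ⟨fun a b hab => hm' U (congr_arg Subtype.val hab), ?_⟩
      rintro ⟨_, z, rfl⟩
      exact ⟨z, rfl⟩
    exact Presieve.isSheaf_iso J (asIso (Subfunctor.toRange (Φ.map m))) (hΦ.isSheaf S)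
  have hs' := (Subfunctor.isSheaf_iff _ (hΦ.isSheaf X)).1 hs
  have : IsIso (Φ.map m) := by
    rw [NatTrans.isIso_iff_isIso_app]
    intro U
    rw [isIso_iff_bijective]
    refine ⟨hm' U, fun x => ?_⟩
    refine hs' U x (J.superset_covering ?_ (hR U x))
    rintro V g ⟨Z, f, z, hf, hz⟩
    obtain ⟨k, rfl⟩ := h f hf
    refine ⟨(Φ.map k).app _ z, ?_⟩
    rw [← hz, Φ.map_comp]
    rfl
  exact isIso_of_reflects_iso m Φ

/-- The sheafified image of `R` is a subsheaf through which `R` factors, so extremality forces it to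
be everything. -/
theorem isLocallySurjective_of_isExtremalEpiFamily {X : 𝓔} {R : Presieve X}
    (hR : IsExtremalEpiFamily R) : IsLocallySurjective J Φ R := by
  have := hΦ.full
  have := hΦ.faithful
  let G := (imageSubfunctor Φ R).sheafify J
  obtain ⟨S, ⟨e⟩⟩ := hΦ.mem_essImage G.toFunctor
    ((imageSubfunctor Φ R).sheafify_isSheaf (hΦ.isSheaf X))
  let m : S ⟶ X := Φ.preimage (e.hom ≫ G.ι)
  have hm : Φ.map m = e.hom ≫ G.ι := Φ.map_preimage _
  have : Mono (Φ.map m) := hm ▸ inferInstance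
  have : Mono m := Φ.mono_of_mono_map this
  have : IsIso m := hR m fun Y f hf => by
    refine ⟨Φ.preimage (Subfunctor.lift (G := G) (Φ.map f) ?_ ≫ e.inv), Φ.map_injective ?_⟩
    · rintro U _ ⟨y, rfl⟩
      exact (imageSubfunctor Φ R).le_sheafify J U ⟨Y, f, y, hf, rfl⟩
    · rw [Φ.map_comp, hm, Φ.map_preimage, Category.assoc, e.inv_hom_id_assoc]
      exact Subfunctor.lift_ι _ _
  intro U x
  have h : IsIso (Φ.map m) := inferInstance
  obtain ⟨s, hs⟩ := ((isIso_iff_bijective _).1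
    ((NatTrans.isIso_iff_isIso_app _).1 h U)).2 x
  rw [hm] at hs
  rw [← hs]
  exact (e.hom.app U s).2

theorem isExtremalEpiFamily_iff {X : 𝓔} {R : Presieve X} :
    IsExtremalEpiFamily R ↔ IsLocallySurjective J Φ R :=
  ⟨hΦ.isLocallySurjective_of_isExtremalEpiFamily, hΦ.isExtremalEpiFamily_of_isLocallySurjective⟩

/-- Local surjectivity is tested on sections, and sections preserve pullbacks. -/
theorem isExtremalEpiFamily_of_isPullbackFamily {X Y : 𝓔} {g : Y ⟶ X} {R : Presieve X}
    {R' : Presieve Y} (h : IsPullbackFamily g R R') (hR : IsExtremalEpiFamily R) :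
    IsExtremalEpiFamily R' := by
  have := hΦ.preservesLimits
  rw [hΦ.isExtremalEpiFamily_iff] at hR ⊢
  intro U y
  refine J.superset_covering ?_ (hR U ((Φ.map g).app U y))
  rintro V k ⟨Z, f, z, hf, hz⟩
  obtain ⟨P, p, q, hp, hq⟩ := h.2 f hf
  have hq' := (hq.map Φ).map ((evaluation Cᵒᵖ (Type u)).obj (op V))
  obtain ⟨w, hw, -⟩ := Types.exists_of_isPullback hq' ((Φ.obj Y).map k.op y) z
    ((NatTrans.naturality_apply (Φ.map g) _ _).trans hz.symm)
  exact ⟨P, p, w, hp, hw⟩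

/-- Path lifting applies to the cotree of underlying presheaves. A compatible lift along a live
branch is a section of its limit, because `Φ` and evaluation preserve limits. -/
theorem isExtremalEpiFamily_of_isTreeFamily {κ : Cardinal.{u}} (hκ : κ.IsRegular)
    (hC : IsKappaLex κ C) {K : Precoverage C}
    (hJ : ∀ (X : C) (S : Sieve X), S ∈ J X ↔ ∃ R ∈ K X, R ≤ S.arrows) (hK : treeClosure κ K ≤ K)
    {E : Precoverage 𝓔} (hE : ∀ X, ∀ R ∈ E X, IsExtremalEpiFamily R) {X : 𝓔} {R : Presieve X}
    (hR : R ∈ treeClosure κ E X) : IsExtremalEpiFamily R := by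
  have := hΦ.preservesLimits
  obtain ⟨τ, hτ, c⟩ := hR
  rw [hΦ.isExtremalEpiFamily_iff]
  let τ' : Cotree.{u} (Cᵒᵖ ⥤ Type u) := { τ with diag := τ.diag ⋙ Φ }
  have hlift (A : Set τ.T) (c : Cone (τ.restrict A)) (hc : IsLimit c) (V : C)
      (y : ∀ s, s ∈ A → (τ'.obj s).obj (op V))
      (hy : ∀ r s (h : r ≤ s) (hr : r ∈ A) (hs : s ∈ A),
        (τ'.map h).app (op V) (y s hs) = y r hr) :
      ∃ z : (Φ.obj c.pt).obj (op V), ∀ s (hs : s ∈ A),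
        (Φ.map (c.π.app (op ⟨s, hs⟩))).app (op V) z = y s hs := by
    let Ψ := Φ ⋙ (evaluation Cᵒᵖ (Type u)).obj (op V)
    have hc' := isLimitOfPreserves Ψ hc
    let y' : (τ.restrict A ⋙ Ψ).sections := ⟨fun s => y s.unop.1 s.unop.2, fun {s s'} f =>
      hy _ _ (leOfHom f.unop) _ _⟩
    exact ⟨(Types.isLimitEquivSections hc').symm y', fun s hs =>
      Types.isLimitEquivSections_symm_apply hc' y' (op ⟨s, hs⟩)⟩
  have hτ' : IsLocallyContinuous κ K τ' := by
    refine ⟨fun t ht V y => ?_, hτ.branch_lt, fun t ht V y hy => ?_⟩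
    · have h := hΦ.isLocallySurjective_of_isExtremalEpiFamily
        (hE _ _ (hτ.predecessors_mem t ht)) (op V) y
      obtain ⟨R, hR, hR'⟩ := (hJ _ _).1 h
      refine ⟨R, hR, fun W f hf => ?_⟩
      obtain ⟨_, _, z, ⟨s⟩, hz⟩ := hR' _ _ hf
      exact ⟨s.1, s.2, z, hz⟩
    · obtain ⟨hl⟩ := hτ.isLimit t ht
      exact hlift (Set.Iio t) _ hl V y fun r s h hr hs => hy r s h hs
  intro U x
  obtain ⟨R, hR, h⟩ := hτ'.exists_liveBranch hκ hC hK (U := U.unop) x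
  refine (hJ _ _).2 ⟨R, hR, fun V f hf => ?_⟩
  obtain ⟨b, y, hy, hy'⟩ := h V f hf
  obtain ⟨z, hz⟩ := hlift b.1 _ (c b).isLimit V y fun r s h hr hs => hy r s hr hs h
  exact ⟨_, _, z, ⟨b⟩, (hz ⊥ b.1.bot_mem).trans hy'⟩

theorem isCompatible {κ : Cardinal.{u}} (hκ : κ.IsRegular)
    (hC : IsKappaLex κ C) {K : Precoverage C}
    (hJ : ∀ (X : C) (S : Sieve X), S ∈ J X ↔ ∃ R ∈ K X, R ≤ S.arrows)
    (hK : treeClosure κ K ≤ K) : IsCompatible κ (extremalFamilies.{u} 𝓔) := by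
  have h (X : 𝓔) (R) (hR : R ∈ pbClosure (extremalFamilies.{u} 𝓔) X) :
      IsExtremalEpiFamily R := by
    obtain ⟨Y, g, S, hS, hR⟩ := hR
    exact hΦ.isExtremalEpiFamily_of_isPullbackFamily hR hS.2
  exact ⟨h, fun X R hR => hΦ.isExtremalEpiFamily_of_isTreeFamily hκ hC hJ hK h hR⟩

end IsSheafEmbedding

end SheafEmbedding

end KappaTopos

namespace KappaTopos

/-! ### Images, unions and coherence -/

section Coherent

variable {𝓔 : Type u'} [Category.{v} 𝓔]

theorem isIso_of_effectiveEpi_of_comp_eq {S X Y : 𝓔} {e : X ⟶ Y} (he : EffectiveEpi e)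
    (m : S ⟶ Y) [Mono m] {g : X ⟶ S} (h : g ≫ m = e) : IsIso m := by
  have : StrongEpi (g ≫ m) := h ▸ inferInstance
  have : StrongEpi m := strongEpi_of_strongEpi g m
  exact isIso_of_mono_of_strongEpi m

/-- Extremality makes the mono part of the factorization invertible. The equivalence transfers
pullback stability from extremal families to effective epimorphisms. -/
theorem effectiveEpi_iff_isExtremalEpiFamily
    (hfac : ∀ ⦃X Y : 𝓔⦄ (f : X ⟶ Y), ∃ (I : 𝓔) (e : X ⟶ I) (m : I ⟶ Y),
      EffectiveEpi e ∧ Mono m ∧ e ≫ m = f) {X Y : 𝓔} (e : X ⟶ Y) :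
    EffectiveEpi e ↔ IsExtremalEpiFamily (Presieve.singleton e) := by
  constructor
  · intro he S m hm h
    obtain ⟨g, hg⟩ := h e ⟨⟩
    exact isIso_of_effectiveEpi_of_comp_eq he m hg
  · intro h
    obtain ⟨I, e', m, he', hm, rfl⟩ := hfac e
    have : IsIso m := h m (by rintro _ _ ⟨⟩; exact ⟨e', rfl⟩)
    have := (effectiveEpi_iff_effectiveEpiFamily e').1 he'
    exact (effectiveEpi_iff_effectiveEpiFamily _).2 inferInstance

theorem isPullbackFamily_singleton {P X Y Z : 𝓔} {p : P ⟶ Y} {q : P ⟶ X} {g : Y ⟶ Z} {e : X ⟶ Z}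
    (h : IsPullback p q g e) :
    IsPullbackFamily g (Presieve.singleton e) (Presieve.singleton p) := by
  constructor
  · rintro _ _ ⟨⟩
    exact ⟨X, e, q, ⟨⟩, h⟩
  · rintro _ _ ⟨⟩
    exact ⟨P, p, q, ⟨⟩, h⟩

/-- For an upper bound `V` the family factors through the intersection of `V` with `U`, which is
therefore all of `U`. -/
theorem isLUB_of_isExtremalEpiFamily [HasPullbacks 𝓔] {X : 𝓔} {I : Type w} {S : I → Subobject X}
    {U : Subobject X} (h : ∀ i, S i ≤ U)
    (hU : IsExtremalEpiFamily
      (Presieve.ofArrows (fun i => (S i : 𝓔)) (fun i => Subobject.ofLE (S i) U (h i)))) :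
    IsLUB (Set.range S) U := by
  refine ⟨?_, fun V hV => ?_⟩
  · rintro _ ⟨i, rfl⟩
    exact h i
  · have : IsIso (pullback.snd V.arrow U.arrow) := by
      refine hU _ ?_
      rintro _ _ ⟨i⟩
      refine ⟨pullback.lift (Subobject.ofLE (S i) V (hV ⟨i, rfl⟩)) (Subobject.ofLE (S i) U (h i))
        ?_, pullback.lift_snd _ _ _⟩
      rw [Subobject.ofLE_arrow, Subobject.ofLE_arrow]
    refine Subobject.le_of_comm (inv (pullback.snd V.arrow U.arrow) ≫ pullback.fst _ _) ?_
    rw [Category.assoc, pullback.condition, IsIso.inv_hom_id_assoc]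

theorem isPullback_ofLE [HasPullbacks 𝓔] {X Y : 𝓔} (g : Y ⟶ X) {S U : Subobject X} (h : S ≤ U)
    (h' : (Subobject.pullback g).obj S ≤ (Subobject.pullback g).obj U) :
    IsPullback (Subobject.ofLE _ _ h') (Subobject.pullbackπ g S) (Subobject.pullbackπ g U)
      (Subobject.ofLE S U h) := by
  have hS := Subobject.isPullback g S
  have hU := Subobject.isPullback g U
  refine (IsPullback.of_bot (v₂₁ := ((Subobject.pullback g).obj U).arrow) (v₂₂ := U.arrow)
    (h₃₁ := g) ?_ ?_ hU).flip
  · rw [Subobject.ofLE_arrow, Subobject.ofLE_arrow]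
    exact hS
  · rw [← cancel_mono U.arrow, Category.assoc, Category.assoc, Subobject.ofLE_arrow, hS.w, hU.w,
      ← Category.assoc, Subobject.ofLE_arrow]

/-- The union is the image of the arrow from the coproduct: a subobject of it through which every
leg factors also receives the effective epimorphism from the coproduct. -/
theorem exists_isExtremalEpiFamily_ofLE
    (hfac : ∀ ⦃X Y : 𝓔⦄ (f : X ⟶ Y), ∃ (I : 𝓔) (e : X ⟶ I) (m : I ⟶ Y),
      EffectiveEpi e ∧ Mono m ∧ e ≫ m = f) {X : 𝓔} {I : Type w} [HasCoproductsOfShape I 𝓔]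
    (S : I → Subobject X) : ∃ (U : Subobject X) (h : ∀ i, S i ≤ U), IsExtremalEpiFamily
      (Presieve.ofArrows (fun i => (S i : 𝓔)) (fun i => Subobject.ofLE (S i) U (h i))) := by
  obtain ⟨Z, e, m, he, hm, hem⟩ := hfac (Sigma.desc fun i => (S i).arrow)
  have h (i) : S i ≤ Subobject.mk m := by
    refine Subobject.le_mk_of_comm (Sigma.ι (fun i => (S i : 𝓔)) i ≫ e) ?_
    rw [Category.assoc, hem, Sigma.ι_desc]
  refine ⟨Subobject.mk m, h, fun V m' hm' hV => ?_⟩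
  choose k hk using fun i => hV (Subobject.ofLE (S i) _ (h i)) ⟨i⟩
  have : IsIso (m' ≫ (Subobject.underlyingIso m).hom) := by
    refine isIso_of_effectiveEpi_of_comp_eq he _ (g := Sigma.desc k) ?_
    rw [← cancel_mono m, hem]
    refine Sigma.hom_ext _ _ fun i => ?_
    rw [Sigma.ι_desc, Category.assoc, Category.assoc, Sigma.ι_desc_assoc,
      Subobject.underlyingIso_hom_comp_eq_mk, ← Category.assoc, hk, Subobject.ofLE_arrow]
  exact IsIso.of_isIso_comp_right m' (Subobject.underlyingIso m).hom

end Coherent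

theorem IsSheafEmbedding.isInftyKappaCoherent {C : Type u} [SmallCategory C] {𝓔 : Type u'}
    [Category.{u} 𝓔] [HasLimitsOfSize.{u, u} 𝓔] [HasCoproducts.{u} 𝓔]
    (hfac : ∀ ⦃X Y : 𝓔⦄ (f : X ⟶ Y), ∃ (I : 𝓔) (e : X ⟶ I) (m : I ⟶ Y),
      EffectiveEpi e ∧ Mono m ∧ e ≫ m = f)
    {J : GrothendieckTopology C} {Φ : 𝓔 ⥤ Cᵒᵖ ⥤ Type u} (hΦ : IsSheafEmbedding J Φ)
    {κ : Cardinal.{u}} (hκ : κ.IsRegular) (hC : IsKappaLex κ C) {K : Precoverage C}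
    (hJ : ∀ (X : C) (S : Sieve X), S ∈ J X ↔ ∃ R ∈ K X, R ≤ S.arrows)
    (hK : treeClosure κ K ≤ K) : IsInftyKappaCoherent κ 𝓔 where
  isRegular := hκ
  isKappaLex _ _ _ := inferInstance
  exists_factorization := hfac
  effectiveEpi_of_isPullback P X Y Z p q g e h he := by
    rw [effectiveEpi_iff_isExtremalEpiFamily hfac] at he ⊢
    exact hΦ.isExtremalEpiFamily_of_isPullbackFamily (isPullbackFamily_singleton h) he
  exists_union X I S := by
    have : HasPullbacks 𝓔 := IsKappaLex.hasPullbacks (κ := κ) (fun _ _ _ => inferInstance) hκ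
    obtain ⟨U, h, hU⟩ := exists_isExtremalEpiFamily_ofLE hfac S
    refine ⟨U, isLUB_of_isExtremalEpiFamily h hU, fun Y g => ?_⟩
    have h' (i) : (Subobject.pullback g).obj (S i) ≤ (Subobject.pullback g).obj U :=
      (Subobject.pullback g).monotone (h i)
    -- Stability of the union reduces to stability of extremal families under pullback along
    -- `Subobject.pullbackπ g U`.
    refine isLUB_of_isExtremalEpiFamily h' (hΦ.isExtremalEpiFamily_of_isPullbackFamily
      (g := Subobject.pullbackπ g U) ⟨?_, ?_⟩ hU)
    · rintro _ _ ⟨i⟩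
      exact ⟨_, _, _, ⟨i⟩, isPullback_ofLE g (h i) (h' i)⟩
    · rintro _ _ ⟨i⟩
      exact ⟨_, _, _, ⟨i⟩, isPullback_ofLE g (h i) (h' i)⟩
  isCompatible := hΦ.isCompatible hκ hC hJ hK

end KappaTopos

namespace KappaTopos

/-! ### Categories of sheaves as `κ`-toposes -/

section Sheaves

variable {C : Type u} [SmallCategory C] (J : GrothendieckTopology C)

theorem isSheafEmbedding_sheafToPresheaf : IsSheafEmbedding J (sheafToPresheaf J (Type u)) where
  full := inferInstance
  faithful := inferInstance
  preservesLimits := inferInstance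
  isSheaf X := (isSheaf_iff_isSheaf_of_type J _).1 X.2
  mem_essImage P hP := ⟨⟨P, (isSheaf_iff_isSheaf_of_type J _).2 hP⟩, ⟨Iso.refl _⟩⟩

/-- Presheaves are the sheaves for the trivial topology, so the results on sheaf embeddings also
apply to the presheaf topos. -/
theorem isSheafEmbedding_id : IsSheafEmbedding (⊥ : GrothendieckTopology C) (𝟭 (Cᵒᵖ ⥤ Type u)) where
  full := inferInstance
  faithful := inferInstance
  preservesLimits := inferInstance
  isSheaf _ := Presieve.isSheaf_bot
  mem_essImage P _ := ⟨P, ⟨Iso.refl _⟩⟩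

theorem exists_factorization_sheaf {X Y : Sheaf J (Type u)} (f : X ⟶ Y) :
    ∃ (I : Sheaf J (Type u)) (e : X ⟶ I) (m : I ⟶ Y), EffectiveEpi e ∧ Mono m ∧ e ≫ m = f := by
  refine ⟨_, Sheaf.toImage f, Sheaf.imageι f, ?_, inferInstance, Sheaf.toImage_ι f⟩
  rw [← isRegularEpi_iff_effectiveEpi]
  exact IsRegularEpiCategory.regularEpiOfEpi _

theorem exists_factorization_presheaf {X Y : Cᵒᵖ ⥤ Type u} (f : X ⟶ Y) :
    ∃ (I : Cᵒᵖ ⥤ Type u) (e : X ⟶ I) (m : I ⟶ Y), EffectiveEpi e ∧ Mono m ∧ e ≫ m = f := by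
  refine ⟨_, Subfunctor.toRange f, (Subfunctor.range f).ι, ?_, inferInstance,
    Subfunctor.toRange_ι f⟩
  rw [← isRegularEpi_iff_effectiveEpi]
  exact IsRegularEpiCategory.regularEpiOfEpi _

theorem isGrothendieckTopos_sheaf : IsGrothendieckTopos (Sheaf J (Type u)) :=
  ⟨C, _, J, ⟨CategoryTheory.Equivalence.refl⟩⟩

theorem isGrothendieckTopos_presheaf : IsGrothendieckTopos (Cᵒᵖ ⥤ Type u) :=
  ⟨C, _, ⊥, ⟨(sheafBotEquivalence _).symm⟩⟩

variable {J} {κ : Cardinal.{u}} {K : Precoverage C}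

theorem isKappaTopos_sheaf (hκ : κ.IsRegular) (hC : IsKappaLex κ C)
    (hJ : ∀ (X : C) (S : Sieve X), S ∈ J X ↔ ∃ R ∈ K X, R ≤ S.arrows)
    (hK : treeClosure κ K ≤ K) : IsKappaTopos κ (Sheaf J (Type u)) where
  isGrothendieckTopos := isGrothendieckTopos_sheaf J
  isInftyKappaCoherent :=
    have : HasCoproducts.{u} (Sheaf J (Type u)) := fun _ => ⟨fun _ => HasColimit.mk
      ⟨Sheaf.sheafifyCocone (colimit.cocone _),
        Sheaf.isColimitSheafifyCocone _ (colimit.isColimit _)⟩⟩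
    (isSheafEmbedding_sheafToPresheaf J).isInftyKappaCoherent
    (fun _ _ f => exists_factorization_sheaf J f) hκ hC hJ hK

end Sheaves

/-! ### Presheaves and the families of the trivial topology -/

section IsoFamilies

/-- The nonempty families of isomorphisms. -/
def isoFamilies (C : Type u) [Category.{v} C] : Precoverage C where
  coverings X := {R | (∃ (Y : C) (f : Y ⟶ X), R f) ∧ ∀ (Y : C) (f : Y ⟶ X), R f → IsIso f}

variable {C : Type u} [Category.{v} C]

/-- The inverses of the arrows to the root object form a cone with that object as apex; the induced
arrow into the limit inverts the projection. -/
theorem LimOn.isIso_of_isIso {T : Type w} [Preorder T] [OrderBot T] {D : Tᵒᵖ ⥤ C} {A : Set T}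
    {X : C} {p : ∀ a, a ∈ A → (X ⟶ D.obj (op a))} (h : LimOn D A p) (hA : ⊥ ∈ A)
    (hi : ∀ a ∈ A, IsIso (D.map (homOfLE (bot_le : ⊥ ≤ a)).op)) : IsIso (p ⊥ hA) := by
  have hmap {r s t : T} (h : r ≤ s) (h' : s ≤ t) : D.map (homOfLE h').op ≫ D.map (homOfLE h).op =
      D.map (homOfLE (h.trans h')).op := by
    rw [← D.map_comp]
    rfl
  choose q hq hq' using fun a ha => (hi a ha).out
  obtain ⟨m, hm, -⟩ := h.existsUnique q (by
    intro a b ha hb hab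
    have := hi a ha
    rw [← cancel_mono (D.map (homOfLE (bot_le : ⊥ ≤ a)).op), Category.assoc, hmap, hq', hq'])
  have h₀ : D.map (homOfLE (bot_le : (⊥ : T) ≤ ⊥)).op = 𝟙 _ := D.map_id _
  have h₁ : m ≫ p ⊥ hA = 𝟙 _ := by
    rw [hm]
    exact (Category.comp_id _).symm.trans ((congr_arg (q ⊥ hA ≫ ·) h₀.symm).trans (hq' ⊥ hA))
  refine ⟨m, h.hom_ext fun a ha => ?_, h₁⟩
  have := hi a ha
  rw [← cancel_mono (D.map (homOfLE (bot_le : ⊥ ≤ a)).op), Category.assoc, h.comp_map ⊥ a hA ha,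
    Category.assoc, h₁, Category.comp_id, Category.id_comp, h.comp_map ⊥ a hA ha]

/-- By transfinite induction every object of the cotree maps isomorphically to the root. Since the
families are nonempty, a branch can stop only at a leaf, so every branch is live and the resulting
family is nonempty. -/
theorem treeClosure_isoFamilies_le (κ : Cardinal.{w}) :
    treeClosure κ (isoFamilies C) ≤ isoFamilies C := by
  rintro _ _ ⟨τ, hτ, c⟩
  have hi (t : τ.T) : IsIso (τ.map (bot_le : ⊥ ≤ t)) := by
    have := τ.wellFounded
    induction t using WellFoundedLT.induction with
    | ind t ih =>
      rcases TreeOrder.bot_or_covBy_or_isSuccLimit t with rfl | ⟨r, hr⟩ | hl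
      · have h₀ : τ.map (bot_le : (⊥ : τ.T) ≤ ⊥) = 𝟙 _ := τ.diag.map_id _
        rw [h₀]
        infer_instance
      · have := ih r hr.lt
        have h₀ : τ.predecessors r (τ.map hr.le) := ⟨(⟨t, hr⟩ : {s : τ.T // r ⋖ s})⟩
        have h₁ : IsIso (τ.map hr.le) := (hτ.predecessors_mem r fun h =>
          hr.lt.not_ge (τ.isMax_of_mem_leaf r h hr.le)).2 _ _ h₀
        rw [← τ.map_comp_map bot_le hr.le]
        infer_instance
      · have h₁ : (⊥ : τ.T) < t := bot_lt_iff_ne_bot.2 fun h => hl.1 (h ▸ isMin_bot)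
        exact ((τ.nonempty_isLimit_coneIio_iff t).1 (hτ.isLimit t hl)).isIso_of_isIso h₁ ih
  constructor
  · obtain ⟨b, -⟩ := Flag.exists_mem (⊥ : τ.T)
    let b' : τ.LiveBranch := ⟨b, fun t _ ht => by
      by_contra h
      obtain ⟨_, _, ⟨s⟩⟩ := (hτ.predecessors_mem t h).1
      exact s.2.lt.not_ge (ht s.2.le)⟩
    exact ⟨_, _, ⟨b'⟩⟩
  · rintro _ _ ⟨b⟩
    exact (τ.limOn_of_isLimit (c b).isLimit).isIso_of_isIso b.1.bot_mem fun a _ => hi a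

theorem mem_bot_iff_exists_isoFamilies (X : C) (S : Sieve X) :
    S ∈ (⊥ : GrothendieckTopology C) X ↔ ∃ R ∈ isoFamilies C X, R ≤ S.arrows := by
  rw [GrothendieckTopology.bot_covering]
  constructor
  · rintro rfl
    refine ⟨Presieve.singleton (𝟙 X), ⟨⟨X, 𝟙 X, ⟨⟩⟩, ?_⟩, fun _ _ _ => trivial⟩
    rintro _ _ ⟨⟩
    infer_instance
  · rintro ⟨R, ⟨⟨Y, f, hf⟩, hR⟩, h⟩
    have := hR Y f hf
    rw [← Sieve.id_mem_iff_eq_top, ← IsIso.inv_hom_id f]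
    exact S.downward_closed (h _ _ hf) (inv f)

end IsoFamilies

theorem isKappaTopos_presheaf {C : Type u} [SmallCategory C] {κ : Cardinal.{u}}
    (hκ : κ.IsRegular) (hC : IsKappaLex κ C) : IsKappaTopos κ (Cᵒᵖ ⥤ Type u) where
  isGrothendieckTopos := isGrothendieckTopos_presheaf
  isInftyKappaCoherent := isSheafEmbedding_id.isInftyKappaCoherent
    (fun _ _ f => exists_factorization_presheaf f) hκ hC mem_bot_iff_exists_isoFamilies
    (treeClosure_isoFamilies_le κ)

end KappaTopos

namespace KappaTopos

/-! ### Intersections of fewer than `κ` covering sieves -/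

section Intersection

variable {C : Type u} [SmallCategory C]

/-- The subfunctors formed by the arrows in the sieves `S i` for `i < t`. -/
def sieveInterLT {X : C} {ι : Type u} [LinearOrder ι] (S : ι → Sieve X) (t : WithTop ι) :
    Subfunctor (yoneda.obj X) where
  obj V := {f : V.unop ⟶ X | ∀ i : ι, (i : WithTop ι) < t → S i f}
  map g _ hf i hi := (S i).downward_closed (hf i hi) g.unop

theorem sieveInterLT_antitone {X : C} {ι : Type u} [LinearOrder ι] (S : ι → Sieve X) :
    Antitone (sieveInterLT S) :=
  fun _ _ h _ _ hf i hi => hf i (hi.trans_le h)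

/-- Well-order `ι`. The partial intersections form a decreasing chain of subfunctors of `yoneda.obj
X`, continuous at limits: a cotree with one branch, where a section lifts locally from `i` to the
next vertex because `S i` covers. Lifting `𝟙 X` along the branch up to `⊤` yields a covering family
contained in all the sieves. -/
theorem iInf_mem_of_lt {κ : Cardinal.{u}} (hκ : κ.IsRegular) (hC : IsKappaLex κ C)
    {J : GrothendieckTopology C} {K : Precoverage C}
    (hJ : ∀ (X : C) (S : Sieve X), S ∈ J X ↔ ∃ R ∈ K X, R ≤ S.arrows) (hK : treeClosure κ K ≤ K)
    {X : C} {ι : Type u} (hι : Cardinal.mk ι < κ) {S : ι → Sieve X} (hS : ∀ i, S i ∈ J X) :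
    iInf S ∈ J X := by
  let : LinearOrder ι := IsWellOrder.linearOrder WellOrderingRel
  have : WellFoundedLT ι := ⟨(IsWellOrder.toIsWellFounded (r := WellOrderingRel (α := ι))).wf⟩
  let : OrderBot (WithTop ι) := WellFoundedLT.toOrderBot _
  have hT : TreeOrder (WithTop ι) := ⟨inferInstance, fun _ => isChain_of_trichotomous _⟩
  let τ : Cotree.{u} (Cᵒᵖ ⥤ Type u) :=
    { T := WithTop ι
      isChain_Iic := hT.isChain_Iic
      diag :=
        { obj := fun t => (sieveInterLT S t.unop).toFunctor
          map := fun f => Subfunctor.homOfLe (sieveInterLT_antitone S (leOfHom f.unop)) }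
      leaf := {⊤}
      isMax_of_mem_leaf := by
        rintro _ rfl
        exact isMax_top }
  have hτ : IsLocallyContinuous κ K τ := by
    refine ⟨fun t ht V y => ?_, fun b => ?_, fun t ht V y hy => ?_⟩
    · obtain ⟨s, hs, -⟩ := TreeOrder.exists_covBy_le (T := WithTop ι) (lt_top_iff_ne_top.2 ht)
      obtain ⟨i, rfl⟩ := WithTop.ne_top_iff_exists.1 ht
      obtain ⟨R, hR, hR'⟩ := (hJ _ _).1 (J.pullback_stable y.1 (hS i))
      refine ⟨R, hR, fun W f hf => ⟨s, hs, ⟨f ≫ y.1, fun j hj => ?_⟩, rfl⟩⟩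
      rcases (TreeOrder.le_of_lt_of_covBy (T := WithTop ι) hj hs).eq_or_lt with h | h
      · obtain rfl := WithTop.coe_injective h
        exact hR' _ _ hf
      · exact (S j).downward_closed (y.2 j h) f
    · refine (Cardinal.mk_set_le _).trans_lt ?_
      exact (Cardinal.mk_option (α := ι)).trans_lt
        (Cardinal.add_lt_of_lt hκ.aleph0_le hι (Cardinal.one_lt_aleph0.trans_le hκ.aleph0_le))
    · have h₀ : (⊥ : τ.T) < t := bot_lt_iff_ne_bot.2 fun h => ht.1 (h ▸ isMin_bot)
      have hy' (s) (hs : s < t) : (y s hs).1 = (y ⊥ h₀).1 :=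
        congr_arg Subtype.val (hy ⊥ s bot_le hs)
      refine ⟨⟨(y ⊥ h₀).1, fun i hi => ?_⟩, fun s hs => Subtype.ext (hy' s hs).symm⟩
      obtain ⟨r, hr, hrt⟩ := TreeOrder.exists_lt_of_isSuccLimit (T := WithTop ι) ht hi
      rw [← hy' r hrt]
      exact (y r hrt).2 i hr.lt
  obtain ⟨R, hR, h⟩ := hτ.exists_liveBranch hκ hC hK (U := X)
    ⟨𝟙 X, fun i hi => (not_lt_bot hi).elim⟩
  refine (hJ _ _).2 ⟨R, hR, fun W f hf => ?_⟩
  obtain ⟨c, y, hy, hy'⟩ := h W f hf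
  have hc : (⊤ : WithTop ι) ∈ c.1 := c.1.top_mem
  have h₁ : (y ⊤ hc).1 = f := (congr_arg Subtype.val
    ((hy ⊥ ⊤ c.1.bot_mem hc bot_le).trans hy')).trans (Category.comp_id f)
  rw [← h₁]
  rintro _ ⟨i, rfl⟩
  exact (y ⊤ hc).2 i (WithTop.coe_lt_top i)

end Intersection

end KappaTopos

namespace KappaTopos

/-! ### Sheafification preserves `κ`-small limits -/

section LocallyBijective

variable {C : Type u} [SmallCategory C] {J : GrothendieckTopology C}

theorem eq_of_mem_of_isSheaf {P : Cᵒᵖ ⥤ Type u} (hP : Presieve.IsSheaf J P) {U : C} {S : Sieve U}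
    (hS : S ∈ J U) {x y : P.obj (op U)}
    (h : ∀ (V : C) (f : V ⟶ U), S f → P.map f.op x = P.map f.op y) : x = y :=
  (hP _ hS).isSeparatedFor.ext fun V f hf => h V f hf

variable {L : Type u} [SmallCategory L] {F G : L ⥤ Cᵒᵖ ⥤ Type u} {α : F ⟶ G} {c : Cone F}
  {d : Cone G} {β : c.pt ⟶ d.pt}

theorem cone_map_apply {F : L ⥤ Cᵒᵖ ⥤ Type u} (c : Cone F) (l : L) {U V : C} (f : V ⟶ U)
    (x : c.pt.obj (op U)) : (c.π.app l).app (op V) (c.pt.map f.op x) =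
      (F.obj l).map f.op ((c.π.app l).app (op U) x) :=
  NatTrans.naturality_apply (c.π.app l) f.op x

theorem exists_section_of_isLimit (hc : IsLimit c) {V : C} (t : ∀ l, (F.obj l).obj (op V))
    (ht : ∀ {l l' : L} (φ : l ⟶ l'), (F.map φ).app (op V) (t l) = t l') :
    ∃ x : c.pt.obj (op V), ∀ l, (c.π.app l).app (op V) x = t l := by
  have hc' := isLimitOfPreserves ((evaluation Cᵒᵖ (Type u)).obj (op V)) hc
  obtain ⟨x, hx, -⟩ := (Types.isLimit_iff _).1 ⟨hc'⟩ t fun φ => ht φ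
  exact ⟨x, hx⟩

theorem section_ext_of_isLimit (hc : IsLimit c) {V : C} {x y : c.pt.obj (op V)}
    (h : ∀ l, (c.π.app l).app (op V) x = (c.π.app l).app (op V) y) : x = y := by
  have hc' := isLimitOfPreserves ((evaluation Cᵒᵖ (Type u)).obj (op V)) hc
  exact ((Types.isLimit_iff_bijective_sectionOfCone _).1 ⟨hc'⟩).1 (Subtype.ext (funext h))

variable {κ : Cardinal.{u}}

/-- Locally `x` and `y` come from sections of the presheaf limit. For each `l` the components of
these agree on some cover, by local injectivity; on the intersection of these fewer than `κ` covers
they agree for all `l`. -/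
theorem section_ext_of_isLocallyInjective (hL : Cardinal.mk L < κ)
    (hJ : ∀ (X : C) (ι : Type u), Cardinal.mk ι < κ → ∀ S : ι → Sieve X, (∀ i, S i ∈ J X) →
      iInf S ∈ J X) (hc : IsLimit c) (h : ∀ l, β ≫ d.π.app l = c.π.app l ≫ α.app l)
    (hα : ∀ l, Presheaf.IsLocallyInjective J (α.app l)) (hβ : Presheaf.IsLocallySurjective J β)
    (hd : Presieve.IsSheaf J d.pt) {U : C} {x y : d.pt.obj (op U)}
    (hxy : ∀ l, (d.π.app l).app (op U) x = (d.π.app l).app (op U) y) : x = y := by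
  have h' {V : C} (t : c.pt.obj (op V)) (l) : (d.π.app l).app _ (β.app _ t) =
      (α.app l).app _ ((c.π.app l).app _ t) :=
    ConcreteCategory.congr_hom (congr_app (h l) (op V)) t
  refine eq_of_mem_of_isSheaf hd (J.intersection_covering (Presheaf.imageSieve_mem J β x)
    (Presheaf.imageSieve_mem J β y)) ?_
  rintro V f ⟨⟨s, hs⟩, ⟨t, ht⟩⟩
  have hst (l) := Presheaf.equalizerSieve_mem J (α.app l) ((c.π.app l).app (op V) s)
    ((c.π.app l).app (op V) t) (by
      rw [← h', ← h', hs, ht, cone_map_apply, cone_map_apply, hxy])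
  refine eq_of_mem_of_isSheaf hd (hJ _ _ hL _ hst) fun W g hg => ?_
  rw [← hs, ← ht, ← NatTrans.naturality_apply, ← NatTrans.naturality_apply]
  refine congr_arg (β.app (op W)) (section_ext_of_isLimit hc fun l => ?_)
  rw [cone_map_apply, cone_map_apply]
  exact hg _ ⟨l, rfl⟩

/-- On a common cover all components lift to `F`. The lifts need not be compatible, but the failure
along each arrow of `L` disappears on a cover; with fewer than `κ` arrows one cover serves for all.
-/
theorem exists_section_of_isLocallySurjective (hL : HasCardinalLT (Arrow L) κ)
    (hJ : ∀ (X : C) (ι : Type u), Cardinal.mk ι < κ → ∀ S : ι → Sieve X, (∀ i, S i ∈ J X) →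
      iInf S ∈ J X) (hc : IsLimit c) (h : ∀ l, β ≫ d.π.app l = c.π.app l ≫ α.app l)
    (hα : ∀ l, Presheaf.IsLocallyInjective J (α.app l))
    (hα' : ∀ l, Presheaf.IsLocallySurjective J (α.app l)) {U : C}
    (s : ∀ l, (G.obj l).obj (op U))
    (hs : ∀ {l l' : L} (φ : l ⟶ l'), (G.map φ).app (op U) (s l) = s l') :
    ∃ S ∈ J U, ∀ (V : C) (f : V ⟶ U), S f → ∃ y : d.pt.obj (op V), ∀ l,
      (d.π.app l).app (op V) y = (G.obj l).map f.op (s l) := by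
  have hL' : Cardinal.mk (Arrow L) < κ := (hasCardinalLT_iff_cardinal_mk_lt _ _).1 hL
  have hL'' : Cardinal.mk L < κ :=
    (hasCardinalLT_iff_cardinal_mk_lt _ _).1 (hasCardinalLT_of_hasCardinalLT_arrow hL)
  let S : Sieve U :=
    { arrows := fun V f => ∃ y : d.pt.obj (op V), ∀ l,
        (d.π.app l).app (op V) y = (G.obj l).map f.op (s l)
      downward_closed := by
        rintro V W f ⟨y, hy⟩ g
        refine ⟨d.pt.map g.op y, fun l => ?_⟩
        rw [cone_map_apply, hy, op_comp, Functor.map_comp_apply] }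
  refine ⟨S, ?_, fun V f hf => hf⟩
  refine J.transitive (hJ _ _ hL'' _ fun l => Presheaf.imageSieve_mem J (α.app l) (s l)) _ ?_
  intro V f hf
  choose t ht using fun l => hf _ ⟨l, rfl⟩
  have key (φ : Arrow L) := Presheaf.equalizerSieve_mem J (α.app φ.right)
    ((F.map φ.hom).app (op V) (t φ.left)) (t φ.right) (by
      have h₁ : (α.app φ.right).app (op V) ((F.map φ.hom).app (op V) (t φ.left)) =
          (G.map φ.hom).app (op V) ((α.app φ.left).app (op V) (t φ.left)) :=
        ConcreteCategory.congr_hom (congr_app (α.naturality φ.hom) (op V)) _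
      rw [h₁, ht, ht, NatTrans.naturality_apply, hs])
  refine J.superset_covering ?_ (hJ _ _ hL' _ key)
  intro W g hg
  obtain ⟨x, hx⟩ := exists_section_of_isLimit hc (fun l => (F.obj l).map g.op (t l)) (by
    intro l l' φ
    rw [NatTrans.naturality_apply]
    exact hg _ ⟨Arrow.mk φ, rfl⟩)
  refine ⟨β.app _ x, fun l => ?_⟩
  have h₁ : (d.π.app l).app _ (β.app _ x) = (α.app l).app _ ((c.π.app l).app _ x) :=
    ConcreteCategory.congr_hom (congr_app (h l) (op W)) x
  rw [h₁, hx, NatTrans.naturality_apply, ht, op_comp, Functor.map_comp_apply]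

/-- Uniqueness of sections with given components makes the local sections match, so they glue in the
sheaf `d.pt`. -/
theorem nonempty_isLimit_of_locallyBijective (hL : HasCardinalLT (Arrow L) κ)
    (hJ : ∀ (X : C) (ι : Type u), Cardinal.mk ι < κ → ∀ S : ι → Sieve X, (∀ i, S i ∈ J X) →
      iInf S ∈ J X) (hc : IsLimit c) (h : ∀ l, β ≫ d.π.app l = c.π.app l ≫ α.app l)
    (hα : ∀ l, Presheaf.IsLocallyInjective J (α.app l))
    (hα' : ∀ l, Presheaf.IsLocallySurjective J (α.app l))
    (hβ : Presheaf.IsLocallySurjective J β)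
    (hG : ∀ l, Presieve.IsSheaf J (G.obj l)) (hd : Presieve.IsSheaf J d.pt) :
    Nonempty (IsLimit d) := by
  have hL'' : Cardinal.mk L < κ :=
    (hasCardinalLT_iff_cardinal_mk_lt _ _).1 (hasCardinalLT_of_hasCardinalLT_arrow hL)
  have hext {U : C} {x y : d.pt.obj (op U)}
      (hxy : ∀ l, (d.π.app l).app (op U) x = (d.π.app l).app (op U) y) : x = y :=
    section_ext_of_isLocallyInjective hL'' hJ hc h hα hβ hd hxy
  refine ⟨evaluationJointlyReflectsLimits _ fun U => ((Types.isLimit_iff _).2 ?_).some⟩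
  intro s hs
  obtain ⟨S, hS, hS'⟩ := exists_section_of_isLocallySurjective (U := U.unop) hL hJ hc h hα hα' s
    (fun φ => hs φ)
  choose y hy using hS'
  obtain ⟨x, hx, -⟩ := hd S hS (fun V f hf => y V f hf) (by
    intro V V' W g g' f f' hf hf' hgf
    refine hext fun l => ?_
    rw [cone_map_apply, cone_map_apply, hy, hy,
      ← Functor.map_comp_apply, ← Functor.map_comp_apply, ← op_comp, ← op_comp, hgf])
  have hx' (l) : (d.π.app l).app U x = s l := by
    refine eq_of_mem_of_isSheaf (hG l) hS fun V f hf => ?_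
    refine (cone_map_apply d l f x).symm.trans ?_
    rw [hx f hf, hy]
  exact ⟨x, hx', fun z hz => hext fun l => (hz l).trans (hx' l).symm⟩

end LocallyBijective

/-- The unit of sheafification is locally bijective, so the previous criterion compares a limit cone
of presheaves with its sheafification; the inclusion of sheaves reflects limits. -/
theorem preservesKappaLimits_presheafToSheaf {C : Type u} [SmallCategory C]
    {J : GrothendieckTopology C} {κ : Cardinal.{u}}
    (hJ : ∀ (X : C) (ι : Type u), Cardinal.mk ι < κ → ∀ S : ι → Sieve X, (∀ i, S i ∈ J X) →
      iInf S ∈ J X) : PreservesKappaLimits κ (presheafToSheaf J (Type u)) := by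
  intro L _ hL
  refine ⟨fun {D} => ⟨fun {c} hc => ?_⟩⟩
  have h := nonempty_isLimit_of_locallyBijective (J := J)
    (α := Functor.whiskerLeft D (sheafificationAdjunction J (Type u)).unit)
    (d := (sheafToPresheaf J (Type u)).mapCone ((presheafToSheaf J (Type u)).mapCone c))
    (β := toSheafify J c.pt) hL hJ hc
    (fun l => (toSheafify_naturality J (c.π.app l)).symm)
    (fun l => inferInstanceAs (Presheaf.IsLocallyInjective J (toSheafify J (D.obj l))))
    (fun l => inferInstanceAs (Presheaf.IsLocallySurjective J (toSheafify J (D.obj l))))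
    inferInstance
    (fun l => (isSheaf_iff_isSheaf_of_type J _).1 ((presheafToSheaf J (Type u)).obj _).2)
    ((isSheaf_iff_isSheaf_of_type J _).1 ((presheafToSheaf J (Type u)).obj _).2)
  exact ⟨isLimitOfReflects _ h.some⟩

end KappaTopos

namespace KappaTopos

theorem le_pbClosure {C : Type u} [Category.{v} C] (E : Precoverage C) : E ≤ pbClosure E :=
  fun X R hR => ⟨X, 𝟙 X, R, hR, fun P p hp => ⟨P, p, 𝟙 P, hp, IsPullback.of_vert_isIso ⟨by simp⟩⟩,
    fun P p hp => ⟨P, p, 𝟙 P, hp, IsPullback.of_vert_isIso ⟨by simp⟩⟩⟩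

/-! ### The sheafified Yoneda embedding -/

section Yoneda

variable {C : Type u} [SmallCategory C] {J : GrothendieckTopology C}

theorem preservesKappaLimits_yoneda_comp {κ : Cardinal.{u}}
    (h : PreservesKappaLimits κ (presheafToSheaf J (Type u))) :
    PreservesKappaLimits κ (yoneda ⋙ presheafToSheaf J (Type u)) := by
  intro L _ hL
  have := h L hL
  exact comp_preservesLimitsOfShape _ _

/-- A section of the sheafified representable is locally given by an arrow `g` into `X`, and `g`
factors locally through legs of `R` because the sieve generated by `R` covers. -/
theorem isExtremalEpiFamily_map_yoneda {X : C} {R : Presieve X} (hR : Sieve.generate R ∈ J X) :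
    IsExtremalEpiFamily (R.map (yoneda ⋙ presheafToSheaf J (Type u))) := by
  refine (isSheafEmbedding_sheafToPresheaf J).isExtremalEpiFamily_of_isLocallySurjective ?_
  intro U x
  refine J.transitive (Presheaf.imageSieve_mem J (toSheafify J (yoneda.obj X)) x) _ ?_
  rintro V f ⟨g, hg⟩
  refine J.superset_covering ?_ (J.pullback_stable g hR)
  rintro W p ⟨Z, q, k, hk, hq⟩
  refine ⟨_, _, (toSheafify J (yoneda.obj Z)).app _ q, Presieve.map_map hk, ?_⟩
  have h₁ : (sheafifyMap J (yoneda.map k)).app _ ((toSheafify J (yoneda.obj Z)).app (op W) q) =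
      (toSheafify J (yoneda.obj X)).app (op W) (q ≫ k) :=
    (ConcreteCategory.congr_hom (congr_app (toSheafify_naturality J (yoneda.map k)) (op W)) q).symm
  refine h₁.trans ?_
  rw [hq]
  have h₂ : (toSheafify J (yoneda.obj X)).app (op W) ((yoneda.obj X).map p.op g) =
      (sheafify J (yoneda.obj X)).map p.op ((toSheafify J (yoneda.obj X)).app (op V) g) :=
    NatTrans.naturality_apply _ _ _
  refine h₂.trans ?_
  rw [hg, op_comp, Functor.map_comp_apply]
  rfl

end Yoneda

end KappaTopos

theorem mainTheorem10 {C : Type u} [SmallCategory C] (κ : Cardinal.{u}) (hκ : κ.IsRegular)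
    (E : Precoverage C) (hE : KappaTopos.IsKappaSite κ E) :
    (KappaTopos.pbClosure (KappaTopos.bracket κ E) ≤ KappaTopos.bracket κ E ∧
      KappaTopos.treeClosure κ (KappaTopos.bracket κ E) ≤ KappaTopos.bracket κ E) ∧
    KappaTopos.IsGrothendieckTopology (KappaTopos.bracket κ E) ∧
    KappaTopos.IsKappaTopos κ (Sheaf (KappaTopos.topology κ E) (Type u)) ∧
    (KappaTopos.IsKappaToposMap κ (sheafToPresheaf (KappaTopos.topology κ E) (Type u)) ∧
      KappaTopos.PreservesKappaLimits κ
        (presheafToSheaf (KappaTopos.topology κ E) (Type u))) ∧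
    (KappaTopos.PreservesKappaLimits κ
        (yoneda ⋙ presheafToSheaf (KappaTopos.topology κ E) (Type u)) ∧
      ∀ (X : C), ∀ R ∈ E X, KappaTopos.IsExtremalEpiFamily
        (R.map (yoneda ⋙ presheafToSheaf (KappaTopos.topology κ E) (Type u)))) := by
  have hC := hE.isKappaLex
  have : HasPullbacks C := hC.hasPullbacks hκ
  have hK : KappaTopos.treeClosure κ (KappaTopos.bracket κ E) ≤ KappaTopos.bracket κ E :=
    hE.isPbClosed.treeClosure_treeClosure_le hκ
  have hG : KappaTopos.IsGrothendieckTopology (KappaTopos.bracket κ E) :=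
    hE.isPbClosed.isGrothendieckTopology hκ
  have hJ : ∀ (X : C) (S : Sieve X), S ∈ KappaTopos.topology κ E X ↔
    ∃ R ∈ KappaTopos.bracket κ E X, R ≤ S.arrows := hG.mem_iff
  have hT : KappaTopos.IsKappaTopos κ (Sheaf (KappaTopos.topology κ E) (Type u)) :=
    KappaTopos.isKappaTopos_sheaf hκ hC hJ hK
  have ha : KappaTopos.PreservesKappaLimits κ
      (presheafToSheaf (KappaTopos.topology κ E) (Type u)) :=
    KappaTopos.preservesKappaLimits_presheafToSheaf fun _ _ hι _ hS =>
      KappaTopos.iInf_mem_of_lt hκ hC hJ hK hι hS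
  refine ⟨⟨hE.isPbClosed.pbClosure_treeClosure_le hκ, hK⟩, hG, hT,
    ⟨⟨hT, KappaTopos.isKappaTopos_presheaf hκ hC, _, ⟨sheafificationAdjunction _ _⟩,
      inferInstance, ha⟩, ha⟩, KappaTopos.preservesKappaLimits_yoneda_comp ha, fun X R hR => ?_⟩
  refine KappaTopos.isExtremalEpiFamily_map_yoneda ((hJ X _).2 ⟨R, ?_, Sieve.le_generate R⟩)
  exact hE.isPbClosed.le_treeClosure hκ X (KappaTopos.le_pbClosure E X hR)
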